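/- Let $(E,\mathcal E,\mu)$ be a probability space and $T:E\to E$ a bijective bimeasurable map preserving $\mu$. Let $(X_i)_{i\ge1}$ be i.i.d. $\mathbb Z$-valued random variables on a probability space $(\Omega,\mathcal A,\mathbb P)$, $S_0=0$, $S_n=\sum_{i=1}^nX_i$, and assume that the random walk $(S_n)$ is transient, i.e. $\mathbb P(\exists n\ge1:\ S_n=0)<1$. Then its Green function $G(0,x)=\sum_{k\ge0}\mathbb P(S_k=x)$, $x\in\mathbb Z$, is finite. Let $f\in L^2(\mu)$ be (measurable and) real valued with $\mathbb E_\mu(f)=0$, and put $\xi_i=f\circ T^i$ and $\mathcal M_i=\sigma(\xi_j,\ j\le i)$ for $i\in\mathbb Z$. For $n\in\mathbb N$ let $$\theta_2(n)=\sup_{l\ge1}\ \frac1l\ \sup\Big\{\big\|\mathbb E_\mu\big(\varphi(\xi_{j_1},\dots,\xi_{j_l})\,\big|\,\mathcal M_p\big)-\mathbb E_\mu\big(\varphi(\xi_{j_1},\dots,\xi_{j_l})\big)\big\|_{2}\Big\},$$ where the inner supremum is over all integers $p$ and $p+n\le j_1<\dots<j_l$ and all $\varphi:\mathbb R^l\to\mathbb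 R$ with $|\varphi(x)-\varphi(y)|\le\sum_{i=1}^l|x_i-y_i|$ for all $x,y$. Assume (A3) there is a function $g:[0,\infty)\to[0,\infty)$ with $\theta_2(n)\le g(n)$ for all $n\in\mathbb N$, such that $x\mapsto x^{3/2}g(x)$ is non-increasing on $(0,\infty)$ and $\sum_{i=0}^\infty2^{3i/2}g(2^{i\varepsilon})<\infty$ for some $0<\varepsilon<1$. Assume also that $$\sigma^2(f)=2\sum_{x\in\mathbb Z}G(0,x)\,\mathbb E_\mu(f\cdot f\circ T^x)-\mathbb E_\mu(f^2)$$ is finite and positive. Then for $\mathbb P$-almost every $\omega\in\Omega$, $$\frac1{\sqrt n}\sum_{k=0}^nf\circ T^{S_k(\omega)}\ \longrightarrow\ \mathcal N(0,\sigma^2(f))\qquad(n\to\infty)$$ in distribution under $\mu$. -/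

import Mathlib

open MeasureTheory ProbabilityTheory Filter Topology
open scoped ENNReal

noncomputable section

/-- The coefficient `θ₂(M, ξ)` of an `ℝ^l`-valued random variable `ξ` and a σ-algebra `M`: the
supremum of `‖E(φ(ξ) | M) - E(φ(ξ))‖₂` over all `φ : ℝ^l → ℝ` that are `1`-Lipschitz for the metric
`d₁(x, y) = ∑ i, |x i - y i|`. It takes values in `[0, ∞]`. -/
def thetaTwo {E : Type*} [MeasurableSpace E] (μ : Measure E) (M : MeasurableSpace E) {l : ℕ}
    (ξ : E → Fin l → ℝ) : ℝ≥0∞ :=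
  ⨆ (φ : (Fin l → ℝ) → ℝ) (_ : ∀ x y, |φ x - φ y| ≤ ∑ i, |x i - y i|),
    eLpNorm (fun e => (μ[fun e' => φ (ξ e') | M]) e - ∫ e', φ (ξ e') ∂μ) 2 μ

/-- The coefficient `θ_{k,2}(n)`, `k ∈ {1, 2, …} ∪ {∞}`, of a sequence `ξ` of real random variables
with respect to a sequence `M` of σ-algebras: the supremum over `1 ≤ l ≤ k` of
`(1/l) sup {θ₂(M_p, (ξ_{j_1}, …, ξ_{j_l})) : p + n ≤ j_1 < ⋯ < j_l}`. -/
def thetaSeq {E : Type*} [MeasurableSpace E] (μ : Measure E) (M : ℤ → MeasurableSpace E)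
    (ξ : ℤ → E → ℝ) (k : ℕ∞) (n : ℕ) : ℝ≥0∞ :=
  ⨆ (l : ℕ) (_ : 1 ≤ l) (_ : (l : ℕ∞) ≤ k),
    (l : ℝ≥0∞)⁻¹ * ⨆ (p : ℤ) (j : Fin l → ℤ) (_ : StrictMono j) (_ : ∀ i, p + n ≤ j i),
      thetaTwo μ (M p) (fun e i => ξ (j i) e)

/-- The past σ-algebra `M_i = σ(ξ_j, j ≤ i)`. -/
abbrev pastSigma {E : Type*} (ξ : ℤ → E → ℝ) (i : ℤ) : MeasurableSpace E :=
  ⨆ (j : ℤ) (_ : j ≤ i), MeasurableSpace.comap (ξ j) inferInstance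

/-- The weak dependence condition on `ξ`: the coefficients `θ₂(n) = θ_{∞,2}(n)`, taken with respect
to the past σ-algebras of `ξ`, are bounded by `g(n)`, where `g : [0, ∞) → [0, ∞)` is such that
`x ↦ x^{3/2} g(x)` is non-increasing on `(0, ∞)` and `∑ i, 2^{3i/2} g(2^{iε}) < ∞` for some
`0 < ε < 1`. (Only the values of `g` on `[0, ∞)` matter.) -/
def ConditionA3 {E : Type*} [MeasurableSpace E] (μ : Measure E) (ξ : ℤ → E → ℝ) : Prop :=
  ∃ g : ℝ → ℝ, (∀ x, 0 ≤ x → 0 ≤ g x) ∧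
    (∀ n : ℕ, thetaSeq μ (pastSigma ξ) ξ ⊤ n ≤ ENNReal.ofReal (g n)) ∧
    AntitoneOn (fun x : ℝ => x ^ (3 / 2 : ℝ) * g x) (Set.Ioi 0) ∧
    ∃ ε : ℝ, 0 < ε ∧ ε < 1 ∧
      Summable (fun i : ℕ => (2 : ℝ) ^ (3 * (i : ℝ) / 2) * g ((2 : ℝ) ^ ((i : ℝ) * ε)))

/-- The iterate `T^x`, `x ∈ ℤ`, of an invertible bimeasurable map. -/
def iterZ {E : Type*} [MeasurableSpace E] (T : E ≃ᵐ E) (x : ℤ) : E → E :=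
  fun e => ((T.toEquiv : Equiv.Perm E) ^ x) e

/-- The walk with steps `X 0, X 1, …` started at `0`: `S_n` is the sum of the first `n` steps. -/
def walk {Ω : Type*} (X : ℕ → Ω → ℤ) (n : ℕ) (ω : Ω) : ℤ :=
  ∑ i ∈ Finset.range n, X i ω

/-- The steps `X` are independent, identically distributed, `ℤ`-valued random variables. -/
structure IsIIDSteps {Ω : Type*} [MeasurableSpace Ω] (P : Measure Ω) (X : ℕ → Ω → ℤ) : Prop where
  measurable : ∀ i, Measurable (X i)
  indep : iIndepFun X P
  ident : ∀ i, IdentDistrib (X i) (X 0) P P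

/-- The random walk is transient: it returns to its starting point with probability less
than one. -/
def IsTransientWalk {Ω : Type*} [MeasurableSpace Ω] (P : Measure Ω) (X : ℕ → Ω → ℤ) : Prop :=
  P {ω | ∃ n : ℕ, 1 ≤ n ∧ walk X n ω = 0} < 1

/-- The Green function `G(0, x) = ∑ k, P(S_k = x)`, with values in `[0, ∞]`. -/
def greenFunction {Ω : Type*} [MeasurableSpace Ω] (P : Measure Ω) (X : ℕ → Ω → ℤ) (x : ℤ) : ℝ≥0∞ :=
  ∑' k : ℕ, P {ω | walk X k ω = x}

/-- `σ²(f) = 2 ∑_{x ∈ ℤ} G(0, x) E_μ(f · f ∘ T^x) - E_μ(f²)`. If the series does not converge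
absolutely, the value is `-E_μ(f²) ≤ 0`, so positivity of this number entails that the
series converges. -/
def sigmaSq {Ω E : Type*} [MeasurableSpace Ω] [MeasurableSpace E] (P : Measure Ω) (X : ℕ → Ω → ℤ)
    (μ : Measure E) (T : E ≃ᵐ E) (f : E → ℝ) : ℝ :=
  2 * ∑' x : ℤ, (greenFunction P X x).toReal * ∫ e, f e * f (iterZ T x e) ∂μ - ∫ e, f e ^ 2 ∂μ

end

/-! Fix the walk. The normalised sum is a linear form `∑ a_z ξ_z`, where `a_z` is `n^{-1/2}` times
the number of visits to `z`. So it suffices to prove a central limit theorem for deterministic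
weights on a weakly dependent stationary sequence, and to control the occupation counts of almost
every path.

Deterministic side: the dependence condition gives `θ₂(q) = O(q^{-3/2})`. Covariances at distance
`d` are then `O(d^{-3/2})`, which is summable, so `∑ a_i ξ_i` has variance `O(∑ a_i²)`. Cut `ℤ` into
blocks of length about `n^{9/20}` separated by gaps of length about `n^{2/5}`, and truncate at
`n^{1/100}`. Gaps and truncation remainders are negligible in `L²`. The characteristic function of
what is left factorises over the blocks up to a small error
(`WeaklyDependent.norm_charFun_sub_prod_le`), and each block sum is uniformly small, so each factor
is nearly Gaussian. All errors are collected in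
`WeaklyDependent.norm_charFun_sum_sub_exp_variance_le`. They vanish once the weights are `O(n^{1/100
- 1/2})` with bounded sum of squares.

Walk side: the variance is `(1/n) ∑ c(y) N_n(y)`, with `c` the autocovariance and `N_n(y)` the
number of pairs of times at which the walk differs by `y`. Almost surely `N_n(y)/n` tends to `G(0,y)
+ G(0,-y) - 1_{y=0}` (`ae_tendsto_pairCount`): pairs at bounded time distance obey a law of large
numbers, and the others are controlled by the maximal ergodic theorem. As `c` is even, the limiting
variance is `σ²(f)`. Finally, transience makes the number of returns geometrically small, and
Borel–Cantelli bounds all visit counts by `D n^{1/100}` (`ae_exists_visits_le`). -/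

/-! ### Weak dependence and the covariance inequality. -/

/-- Cauchy–Schwarz inequality for integrals of real functions. -/
theorem abs_integral_mul_le_sqrt_mul_sqrt {E : Type*} [MeasurableSpace E] {μ : Measure E}
    {f g : E → ℝ} (hf : MemLp f 2 μ) (hg : MemLp g 2 μ) :
    |∫ e, f e * g e ∂μ| ≤ √(∫ e, f e ^ 2 ∂μ) * √(∫ e, g e ^ 2 ∂μ) := by
  have h := integral_mul_norm_le_Lp_mul_Lq (μ := μ) (f := f) (g := g)
    (p := 2) (q := 2) Real.HolderConjugate.two_two (by simpa using hf) (by simpa using hg)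
  simp only [Real.rpow_two, Real.norm_eq_abs, sq_abs, ← Real.sqrt_eq_rpow] at h
  refine le_trans ?_ h
  refine (abs_integral_le_integral_abs).trans (le_of_eq ?_)
  simp [abs_mul]

theorem eLpNorm_two_eq_ofReal_sqrt {E : Type*} [MeasurableSpace E] {μ : Measure E}
    {f : E → ℝ} (hf : MemLp f 2 μ) :
    eLpNorm f 2 μ = ENNReal.ofReal √(∫ e, f e ^ 2 ∂μ) := by
  rw [hf.eLpNorm_eq_integral_rpow_norm two_ne_zero ENNReal.ofNat_ne_top]
  simp [Real.sqrt_eq_rpow]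

/-- Polynomial `θ₂`-weak dependence of order `3/2` with constant `C`. -/
def WeaklyDependent {E : Type*} [MeasurableSpace E] (μ : Measure E) (ξ : ℤ → E → ℝ) (C : ℝ) :
    Prop :=
  ∀ (l : ℕ) (p : ℤ) (q : ℕ), 1 ≤ l → 1 ≤ q → ∀ j : Fin l → ℤ, StrictMono j → (∀ i, p + q ≤ j i) →
    ∀ φ : (Fin l → ℝ) → ℝ, (∀ x y, |φ x - φ y| ≤ ∑ i, |x i - y i|) →
    eLpNorm (fun e => (μ[fun e' => φ (fun i => ξ (j i) e') | pastSigma ξ p]) e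
      - ∫ e', φ (fun i => ξ (j i) e') ∂μ) 2 μ ≤ ENNReal.ofReal (l * (C * (q : ℝ) ^ (-(3 / 2) : ℝ)))

/-- Comparing `x^{3/2} g(x)` at `x = q` with its value at `x = 1` gives `g(q) ≤ g(1) q^{-3/2}`, so
`C = g 1` works. -/
theorem ConditionA3.exists_weaklyDependent {E : Type*} [MeasurableSpace E] {μ : Measure E}
    {ξ : ℤ → E → ℝ} (h : ConditionA3 μ ξ) : ∃ C, 0 ≤ C ∧ WeaklyDependent μ ξ C := by
  obtain ⟨g, hg0, hθ, hanti, -⟩ := h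
  refine ⟨g 1, hg0 1 zero_le_one, fun l p q hl hq j hj hjp φ hφ => ?_⟩
  have hq0 : (0 : ℝ) < q := by exact_mod_cast hq
  have hgq : g q ≤ g 1 * (q : ℝ) ^ (-(3 / 2) : ℝ) := by
    have := hanti (show (1 : ℝ) ∈ Set.Ioi 0 by simp) (show (q : ℝ) ∈ Set.Ioi 0 from hq0)
      (by exact_mod_cast hq)
    simp only [Real.one_rpow, one_mul] at this
    rw [Real.rpow_neg hq0.le, ← div_eq_mul_inv, le_div_iff₀ (by positivity)]
    linarith
  have h1 : (l : ℝ≥0∞)⁻¹ * thetaTwo μ (pastSigma ξ p) (fun e i => ξ (j i) e)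
      ≤ ENNReal.ofReal (g q) := by
    refine le_trans ?_ (hθ q)
    unfold thetaSeq
    refine le_iSup_of_le l (le_iSup_of_le hl (le_iSup_of_le le_top ?_))
    gcongr
    exact le_iSup_of_le p (le_iSup_of_le j (le_iSup_of_le hj (le_iSup_of_le hjp le_rfl)))
  have h2 : eLpNorm (fun e => (μ[fun e' => φ (fun i => ξ (j i) e') | pastSigma ξ p]) e
      - ∫ e', φ (fun i => ξ (j i) e') ∂μ) 2 μ
      ≤ thetaTwo μ (pastSigma ξ p) (fun e i => ξ (j i) e) := by
    unfold thetaTwo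
    exact le_iSup_of_le φ (le_iSup_of_le hφ le_rfl)
  have hl0 : (l : ℝ≥0∞) ≠ 0 := by simp; omega
  calc _ ≤ thetaTwo μ (pastSigma ξ p) (fun e i => ξ (j i) e) := h2
    _ = l * ((l : ℝ≥0∞)⁻¹ * thetaTwo μ (pastSigma ξ p) (fun e i => ξ (j i) e)) := by
        rw [← mul_assoc, ENNReal.mul_inv_cancel hl0 (by simp), one_mul]
    _ ≤ l * ENNReal.ofReal (g q) := by gcongr
    _ ≤ _ := by
        rw [ENNReal.ofReal_mul (by positivity), ENNReal.ofReal_natCast]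
        gcongr

theorem pastSigma_le {E : Type*} [m : MeasurableSpace E] {ξ : ℤ → E → ℝ}
    (hξ : ∀ i, Measurable (ξ i)) (p : ℤ) : pastSigma ξ p ≤ m :=
  iSup₂_le fun i _ => (hξ i).comap_le

theorem measurable_pastSigma {E : Type*} {ξ : ℤ → E → ℝ} {i p : ℤ} (h : i ≤ p) :
    Measurable[pastSigma ξ p] (ξ i) :=
  measurable_iff_comap_le.2 (le_iSup₂_of_le i h le_rfl)

theorem continuous_of_abs_sub_le_sum {l : ℕ} {φ : (Fin l → ℝ) → ℝ} {L : ℝ} (hL : 0 ≤ L)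
    (hφ : ∀ x y, |φ x - φ y| ≤ L * ∑ i, |x i - y i|) : Continuous φ := by
  have : LipschitzWith (L.toNNReal * l) φ := by
    refine LipschitzWith.of_dist_le_mul fun x y => (hφ x y).trans ?_
    rw [NNReal.coe_mul, mul_assoc, Real.coe_toNNReal L hL]
    refine mul_le_mul_of_nonneg_left ?_ hL
    calc ∑ i, |x i - y i| ≤ ∑ i : Fin l, dist x y :=
          Finset.sum_le_sum fun i _ => dist_le_pi_dist x y i
      _ = _ := by simp
  exact this.continuous

theorem memLp_of_abs_sub_le_sum {E : Type*} [MeasurableSpace E] {μ : Measure E}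
    [IsFiniteMeasure μ] {l : ℕ} {φ : (Fin l → ℝ) → ℝ} {L : ℝ} (hL : 0 ≤ L)
    (hφ : ∀ x y, |φ x - φ y| ≤ L * ∑ i, |x i - y i|) {η : E → Fin l → ℝ}
    (hηm : ∀ i, Measurable (fun e => η e i)) (hη : ∀ i, MemLp (fun e => η e i) 2 μ) :
    MemLp (fun e => φ (η e)) 2 μ := by
  have hs : MemLp (fun e => ∑ i, |η e i|) 2 μ :=
    memLp_finsetSum (f := fun i e => |η e i|) _ fun i _ => (hη i).abs
  have hb : MemLp (fun e => |φ 0| + L * ∑ i, |η e i|) 2 μ :=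
    (memLp_const (|φ 0|)).add (hs.const_mul L)
  refine hb.of_le ?_ (ae_of_all _ fun e => ?_)
  · exact ((continuous_of_abs_sub_le_sum hL hφ).measurable.comp
      (measurable_pi_lambda _ hηm)).aestronglyMeasurable
  · have := hφ (η e) 0
    simp only [Pi.zero_apply, sub_zero] at this
    rw [Real.norm_eq_abs, Real.norm_eq_abs]
    refine le_trans ?_ (le_abs_self _)
    have := abs_sub_abs_le_abs_sub (φ (η e)) (φ 0)
    linarith

/-- As `U` is `M`-measurable, `Φ` may be replaced by its conditional expectation. The covariance
becomes the integral of `U` against `E(Φ | M) - E(Φ)`, and Cauchy–Schwarz applies. -/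
theorem abs_integral_mul_sub_le_condExp {E : Type*} {M m0 : MeasurableSpace E} {μ : Measure E}
    [IsProbabilityMeasure μ] (hM : M ≤ m0) {U Φ : E → ℝ} (hU : StronglyMeasurable[M] U)
    (hU2 : MemLp U 2 μ) (hΦ2 : MemLp Φ 2 μ) :
    |∫ e, U e * Φ e ∂μ - (∫ e, U e ∂μ) * ∫ e, Φ e ∂μ|
      ≤ √(∫ e, U e ^ 2 ∂μ) * √(∫ e, ((μ[Φ | M]) e - ∫ e', Φ e' ∂μ) ^ 2 ∂μ) := by
  have hΦ1 : Integrable Φ μ := hΦ2.integrable one_le_two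
  have hU1 : Integrable U μ := hU2.integrable one_le_two
  have hUΦ : Integrable (U * Φ) μ := hU2.integrable_mul hΦ2
  have hcE : MemLp (μ[Φ | M]) 2 μ := hΦ2.condExp one_le_two
  have hD : MemLp (fun e => (μ[Φ | M]) e - ∫ e', Φ e' ∂μ) 2 μ := hcE.sub (memLp_const _)
  have h1 : ∫ e, U e * Φ e ∂μ = ∫ e, U e * (μ[Φ | M]) e ∂μ := by
    change ∫ e, (U * Φ) e ∂μ = _
    rw [← integral_condExp hM]
    exact integral_congr_ae (condExp_mul_of_stronglyMeasurable_left hU hUΦ hΦ1)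
  have hUc : Integrable (fun e => U e * (μ[Φ | M]) e) μ := hU2.integrable_mul hcE
  have h2 : ∫ e, U e * Φ e ∂μ - (∫ e, U e ∂μ) * ∫ e, Φ e ∂μ
      = ∫ e, U e * ((μ[Φ | M]) e - ∫ e', Φ e' ∂μ) ∂μ := by
    simp only [mul_sub]
    rw [integral_sub hUc (hU1.mul_const _), integral_mul_const, h1]
  rw [h2]
  exact abs_integral_mul_le_sqrt_mul_sqrt hU2 hD

/-- Covariance inequality: a square integrable past variable against a Lipschitz functional of the
future. -/
theorem WeaklyDependent.abs_cov_le {E : Type*} [MeasurableSpace E] {μ : Measure E}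
    [IsProbabilityMeasure μ] {ξ : ℤ → E → ℝ} {C : ℝ} (h : WeaklyDependent μ ξ C) (hC : 0 ≤ C)
    (hξm : ∀ i, Measurable (ξ i)) (hξ : ∀ i, MemLp (ξ i) 2 μ)
    {p : ℤ} {q : ℕ} (hq : 1 ≤ q) {U : E → ℝ} (hU : Measurable[pastSigma ξ p] U)
    (hU2 : MemLp U 2 μ) {l : ℕ} {j : Fin l → ℤ} (hj : StrictMono j) (hjp : ∀ i, p + q ≤ j i)
    {φ : (Fin l → ℝ) → ℝ} {L : ℝ} (hL : 0 < L) (hφ : ∀ x y, |φ x - φ y| ≤ L * ∑ i, |x i - y i|) :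
    |∫ e, U e * φ (fun i => ξ (j i) e) ∂μ - (∫ e, U e ∂μ) * ∫ e, φ (fun i => ξ (j i) e) ∂μ|
      ≤ √(∫ e, U e ^ 2 ∂μ) * (L * (l * (C * (q : ℝ) ^ (-(3 / 2) : ℝ)))) := by
  -- The dependence coefficients only concern `l ≥ 1`; for `l = 0` the functional is constant and
  -- the covariance vanishes.
  rcases Nat.eq_zero_or_pos l with rfl | hl
  · have : ∀ x : Fin 0 → ℝ, φ x = φ 0 := fun x => by rw [Subsingleton.elim x 0]
    simp only [this, integral_mul_const, integral_const, probReal_univ, smul_eq_mul, one_mul,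
      sub_self, abs_zero]
    positivity
  have hMle := pastSigma_le hξm p
  set Φ : E → ℝ := fun e => φ (fun i => ξ (j i) e) with hΦ
  have hΦ2 : MemLp Φ 2 μ := memLp_of_abs_sub_le_sum hL.le hφ (fun i => hξm _) (fun i => hξ _)
  refine (abs_integral_mul_sub_le_condExp hMle hU.stronglyMeasurable hU2 hΦ2).trans ?_
  refine mul_le_mul_of_nonneg_left ?_ (Real.sqrt_nonneg _)
  have hD : MemLp (fun e => (μ[Φ | pastSigma ξ p]) e - ∫ e', Φ e' ∂μ) 2 μ :=
    (hΦ2.condExp one_le_two).sub (memLp_const _)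
  -- Dividing by `L` makes the functional `1`-Lipschitz, as the coefficient requires.
  have h3 := h l p q hl hq j hj hjp (fun x => L⁻¹ * φ x) (fun x y => by
    rw [← mul_sub, abs_mul, abs_of_pos (inv_pos.2 hL), inv_mul_le_iff₀ hL]
    exact hφ x y)
  have h4 : (fun e => (μ[fun e' => L⁻¹ * φ (fun i => ξ (j i) e') | pastSigma ξ p]) e
      - ∫ e', L⁻¹ * φ (fun i => ξ (j i) e') ∂μ)
      =ᵐ[μ] fun e => L⁻¹ * ((μ[Φ | pastSigma ξ p]) e - ∫ e', Φ e' ∂μ) := by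
    filter_upwards [condExp_smul (μ := μ) (L⁻¹) Φ (pastSigma ξ p)] with e he
    rw [integral_const_mul, mul_sub]
    congr 1
  rw [eLpNorm_congr_ae h4, eLpNorm_two_eq_ofReal_sqrt (hD.const_mul _),
    ENNReal.ofReal_le_ofReal_iff (by positivity)] at h3
  simp only [mul_pow] at h3
  rw [integral_const_mul, Real.sqrt_mul (by positivity), Real.sqrt_sq (by positivity),
    inv_mul_le_iff₀ hL] at h3
  exact h3

/-! ### Variance bounds for weighted sums. -/

/-- Schur test for a quadratic form whose kernel is dominated by a summable convolution kernel. -/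
theorem abs_sum_sum_mul_le_of_abs_le {A : Finset ℤ} {a : ℤ → ℝ} {d : ℤ → ℤ → ℝ} {w : ℤ → ℝ}
    (hw0 : ∀ x, 0 ≤ w x) (hw : Summable w) (hd : ∀ i ∈ A, ∀ k ∈ A, |d i k| ≤ w (i - k)) :
    |∑ i ∈ A, ∑ k ∈ A, a i * a k * d i k| ≤ (∑ i ∈ A, a i ^ 2) * ∑' x, w x := by
  -- Rows and columns of the kernel are both partial sums of `w`; with `|a_i a_k| ≤ (a_i² + a_k²)/2`
  -- this bounds the form.
  have hrow : ∀ k, ∑ i ∈ A, w (i - k) ≤ ∑' x, w x := fun k => by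
    rw [← (Equiv.subRight k).tsum_eq w]
    exact ((Equiv.subRight k).summable_iff.2 hw).sum_le_tsum A fun _ _ => hw0 _
  have hcol : ∀ i, ∑ k ∈ A, w (i - k) ≤ ∑' x, w x := fun i => by
    rw [← (Equiv.subLeft i).tsum_eq w]
    exact ((Equiv.subLeft i).summable_iff.2 hw).sum_le_tsum A fun _ _ => hw0 _
  calc |∑ i ∈ A, ∑ k ∈ A, a i * a k * d i k|
      ≤ ∑ i ∈ A, ∑ k ∈ A, (a i ^ 2 * w (i - k) / 2 + a k ^ 2 * w (i - k) / 2) := by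
        refine (Finset.abs_sum_le_sum_abs _ _).trans (Finset.sum_le_sum fun i hi => ?_)
        refine (Finset.abs_sum_le_sum_abs _ _).trans (Finset.sum_le_sum fun k hk => ?_)
        rw [abs_mul]
        have h1 : |a i * a k| ≤ (a i ^ 2 + a k ^ 2) / 2 := by
          rw [abs_le]
          constructor <;> nlinarith [sq_nonneg (a i + a k), sq_nonneg (a i - a k)]
        calc |a i * a k| * |d i k| ≤ (a i ^ 2 + a k ^ 2) / 2 * w (i - k) :=
              mul_le_mul h1 (hd i hi k hk) (abs_nonneg _) (by positivity)
          _ = _ := by ring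
    _ = (∑ i ∈ A, a i ^ 2 / 2 * ∑ k ∈ A, w (i - k)) + ∑ k ∈ A, a k ^ 2 / 2 * ∑ i ∈ A, w (i - k) := by
        simp_rw [Finset.sum_add_distrib]
        congr 1
        · simp_rw [Finset.mul_sum]
          exact Finset.sum_congr rfl fun i _ => Finset.sum_congr rfl fun k _ => by ring
        · rw [Finset.sum_comm]
          simp_rw [Finset.mul_sum]
          exact Finset.sum_congr rfl fun i _ => Finset.sum_congr rfl fun k _ => by ring
    _ ≤ (∑ i ∈ A, a i ^ 2 / 2 * ∑' x, w x) + ∑ k ∈ A, a k ^ 2 / 2 * ∑' x, w x := by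
        gcongr with i _ k _
        · exact hcol i
        · exact hrow k
    _ = _ := by
        rw [← Finset.sum_mul, ← Finset.sum_div]
        ring

/-- The centred random variable `h(ξ_i) - E h(ξ_i)`. -/
noncomputable def centered {E : Type*} [MeasurableSpace E] (μ : Measure E) (ξ : ℤ → E → ℝ)
    (h : ℝ → ℝ) (i : ℤ) (e : E) : ℝ :=
  h (ξ i e) - ∫ e', h (ξ i e') ∂μ

section Centered

variable {E : Type*} [MeasurableSpace E] {μ : Measure E} [IsProbabilityMeasure μ]
  {ξ : ℤ → E → ℝ} {C V : ℝ} {h : ℝ → ℝ}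

theorem memLp_comp_of_abs_sub_le (hξm : ∀ i, Measurable (ξ i)) (hξ : ∀ i, MemLp (ξ i) 2 μ)
    (hh : ∀ x y, |h x - h y| ≤ |x - y|) (i : ℤ) : MemLp (fun e => h (ξ i e)) 2 μ :=
  memLp_of_abs_sub_le_sum (φ := fun x : Fin 1 → ℝ => h (x 0)) (L := 1) zero_le_one
    (fun x y => by simpa using hh _ _) (η := fun e _ => ξ i e) (fun _ => hξm i) (fun _ => hξ i)

theorem measurable_of_abs_sub_le (hh : ∀ x y, |h x - h y| ≤ |x - y|) : Measurable h :=
  (LipschitzWith.of_dist_le_mul (K := 1) fun x y => by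
    simpa [Real.dist_eq] using hh x y).continuous.measurable

theorem memLp_centered (hξm : ∀ i, Measurable (ξ i)) (hξ : ∀ i, MemLp (ξ i) 2 μ)
    (hh : ∀ x y, |h x - h y| ≤ |x - y|) (i : ℤ) : MemLp (centered μ ξ h i) 2 μ :=
  (memLp_comp_of_abs_sub_le hξm hξ hh i).sub (memLp_const _)

theorem integral_centered (hξm : ∀ i, Measurable (ξ i)) (hξ : ∀ i, MemLp (ξ i) 2 μ)
    (hh : ∀ x y, |h x - h y| ≤ |x - y|) (i : ℤ) : ∫ e, centered μ ξ h i e ∂μ = 0 := by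
  unfold centered
  rw [integral_sub ((memLp_comp_of_abs_sub_le hξm hξ hh i).integrable one_le_two)
    (integrable_const _)]
  simp

theorem integral_centered_mul_centered (hξm : ∀ i, Measurable (ξ i))
    (hξ : ∀ i, MemLp (ξ i) 2 μ) (hh : ∀ x y, |h x - h y| ≤ |x - y|) (i k : ℤ) :
    ∫ e, centered μ ξ h i e * centered μ ξ h k e ∂μ
      = ∫ e, h (ξ i e) * h (ξ k e) ∂μ - (∫ e, h (ξ i e) ∂μ) * ∫ e, h (ξ k e) ∂μ := by
  have hi := memLp_comp_of_abs_sub_le hξm hξ hh i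
  have hk := memLp_comp_of_abs_sub_le hξm hξ hh k
  have h1 : Integrable (fun e => h (ξ i e) * h (ξ k e)) μ := hi.integrable_mul hk
  have : ∀ e, centered μ ξ h i e * centered μ ξ h k e
      = h (ξ i e) * h (ξ k e) - (h (ξ i e) * ∫ e, h (ξ k e) ∂μ)
        - ((∫ e, h (ξ i e) ∂μ) * centered μ ξ h k e) := fun e => by
    unfold centered; ring
  simp_rw [this]
  rw [integral_sub, integral_sub h1, integral_mul_const, integral_const_mul,
    integral_centered hξm hξ hh]
  · ring
  · exact (hi.integrable one_le_two).mul_const _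
  · exact h1.sub ((hi.integrable one_le_two).mul_const _)
  · exact ((memLp_centered hξm hξ hh k).integrable one_le_two).const_mul _

/-- The earlier variable plays the past and the later one is a functional of a single future
coordinate (`l = 1`), at gap `q = |i - k|`. -/
theorem WeaklyDependent.abs_integral_centered_mul_le (hw : WeaklyDependent μ ξ C) (hC : 0 ≤ C)
    (hξm : ∀ i, Measurable (ξ i)) (hξ : ∀ i, MemLp (ξ i) 2 μ)
    (hh : ∀ x y, |h x - h y| ≤ |x - y|) (hV : ∀ i, ∫ e, h (ξ i e) ^ 2 ∂μ ≤ V) {i k : ℤ}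
    (hik : i ≠ k) :
    |∫ e, centered μ ξ h i e * centered μ ξ h k e ∂μ|
      ≤ √V * (C * |((i - k : ℤ) : ℝ)| ^ (-(3 / 2) : ℝ)) := by
  wlog hlt : i < k generalizing i k
  · have := this hik.symm (lt_of_le_of_ne (not_lt.1 hlt) hik.symm)
    rw [← neg_sub k i, Int.cast_neg, abs_neg]
    simpa only [mul_comm] using this
  obtain ⟨q, hq⟩ : ∃ q : ℕ, k = i + q := ⟨(k - i).toNat, by omega⟩
  have hq1 : 1 ≤ q := by omega
  rw [integral_centered_mul_centered hξm hξ hh]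
  have := hw.abs_cov_le hC hξm hξ (p := i) hq1 (U := fun e => h (ξ i e))
    ((measurable_of_abs_sub_le hh).comp (measurable_pastSigma le_rfl))
    (memLp_comp_of_abs_sub_le hξm hξ hh i) (l := 1) (j := fun _ => k)
    (Subsingleton.strictMono _) (fun _ => hq.ge) (φ := fun x => h (x 0)) (L := 1) one_pos
    (fun x y => by simpa using hh _ _)
  refine this.trans ?_
  have hc : |((i - k : ℤ) : ℝ)| = q := by
    rw [hq]
    simp
  rw [hc, one_mul, Nat.cast_one, one_mul]
  gcongr
  exact hV i

theorem integral_sq_centered_le (hξm : ∀ i, Measurable (ξ i))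
    (hξ : ∀ i, MemLp (ξ i) 2 μ) (hh : ∀ x y, |h x - h y| ≤ |x - y|)
    (hV : ∀ i, ∫ e, h (ξ i e) ^ 2 ∂μ ≤ V) (i : ℤ) :
    |∫ e, centered μ ξ h i e * centered μ ξ h i e ∂μ| ≤ V := by
  rw [abs_of_nonneg (integral_nonneg fun e => mul_self_nonneg _),
    integral_centered_mul_centered hξm hξ hh]
  have := hV i
  simp only [sq] at this
  nlinarith [mul_self_nonneg (∫ e, h (ξ i e) ∂μ)]

theorem integral_sum_sq_eq (hξm : ∀ i, Measurable (ξ i))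
    (hξ : ∀ i, MemLp (ξ i) 2 μ) (hh : ∀ x y, |h x - h y| ≤ |x - y|) (A : Finset ℤ) (a : ℤ → ℝ) :
    ∫ e, (∑ i ∈ A, a i * centered μ ξ h i e) ^ 2 ∂μ
      = ∑ i ∈ A, ∑ k ∈ A, a i * a k * ∫ e, centered μ ξ h i e * centered μ ξ h k e ∂μ := by
  have hint : ∀ i k, Integrable (fun e => centered μ ξ h i e * centered μ ξ h k e) μ :=
    fun i k => (memLp_centered hξm hξ hh i).integrable_mul (memLp_centered hξm hξ hh k)
  have : ∀ e, (∑ i ∈ A, a i * centered μ ξ h i e) ^ 2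
      = ∑ i ∈ A, ∑ k ∈ A, a i * a k * (centered μ ξ h i e * centered μ ξ h k e) := fun e => by
    rw [sq, Finset.sum_mul_sum]
    exact Finset.sum_congr rfl fun i _ => Finset.sum_congr rfl fun k _ => by ring
  simp_rw [this]
  rw [integral_finsetSum _ fun i _ => integrable_finsetSum _ fun k _ => (hint i k).const_mul _]
  refine Finset.sum_congr rfl fun i _ => ?_
  rw [integral_finsetSum _ fun k _ => (hint i k).const_mul _]
  exact Finset.sum_congr rfl fun k _ => integral_const_mul _ _

theorem summable_abs_int_rpow_three_halves :
    Summable fun x : ℤ => |(x : ℝ)| ^ (-(3 / 2) : ℝ) :=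
  Real.summable_abs_int_rpow (by norm_num)

theorem WeaklyDependent.integral_sum_sq_le (hw : WeaklyDependent μ ξ C) (hC : 0 ≤ C)
    (hξm : ∀ i, Measurable (ξ i)) (hξ : ∀ i, MemLp (ξ i) 2 μ)
    (hh : ∀ x y, |h x - h y| ≤ |x - y|) (hV : ∀ i, ∫ e, h (ξ i e) ^ 2 ∂μ ≤ V)
    (A : Finset ℤ) (a : ℤ → ℝ) :
    ∫ e, (∑ i ∈ A, a i * centered μ ξ h i e) ^ 2 ∂μ
      ≤ (∑ i ∈ A, a i ^ 2) * (V + √V * (C * ∑' x : ℤ, |(x : ℝ)| ^ (-(3 / 2) : ℝ))) := by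
  have hV0 : 0 ≤ V := (integral_nonneg fun e => sq_nonneg _).trans (hV 0)
  rw [integral_sum_sq_eq hξm hξ hh]
  -- The diagonal needs its own kernel: the real power `0 ^ (-(3/2))` is `0` by convention, so `w₂`
  -- vanishes at `0`.
  set w₁ : ℤ → ℝ := fun x => if x = 0 then V else 0
  set w₂ : ℤ → ℝ := fun x => √V * (C * |(x : ℝ)| ^ (-(3 / 2) : ℝ))
  have h₁ : HasSum w₁ V := hasSum_ite_eq 0 V
  have h₂ : HasSum w₂ (√V * (C * ∑' x : ℤ, |(x : ℝ)| ^ (-(3 / 2) : ℝ))) :=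
    (summable_abs_int_rpow_three_halves.hasSum.mul_left C).mul_left _
  have h0₁ : ∀ x, 0 ≤ w₁ x := fun x => by dsimp only [w₁]; split_ifs <;> simp [hV0]
  have h0₂ : ∀ x, 0 ≤ w₂ x := fun x => by positivity
  rw [← (h₁.add h₂).tsum_eq]
  refine (le_abs_self _).trans (abs_sum_sum_mul_le_of_abs_le
    (fun x => add_nonneg (h0₁ x) (h0₂ x)) (h₁.add h₂).summable fun i _ k _ => ?_)
  rcases eq_or_ne i k with rfl | hik
  · refine (integral_sq_centered_le hξm hξ hh hV i).trans ?_
    have := h0₂ (i - i)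
    have h3 : w₁ (i - i) = V := by simp [w₁]
    linarith
  · refine (hw.abs_integral_centered_mul_le hC hξm hξ hh hV hik).trans ?_
    exact le_add_of_nonneg_left (h0₁ _)

/-- The variance of a sum is almost the sum of the variances of well separated blocks. -/
theorem WeaklyDependent.abs_integral_sum_sq_sub_blocks_le (hw : WeaklyDependent μ ξ C)
    (hC : 0 ≤ C) (hξm : ∀ i, Measurable (ξ i)) (hξ : ∀ i, MemLp (ξ i) 2 μ)
    (hh : ∀ x y, |h x - h y| ≤ |x - y|) (hV : ∀ i, ∫ e, h (ξ i e) ^ 2 ∂μ ≤ V)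
    {A : Finset ℤ} (a : ℤ → ℝ) {β : ℤ → ℤ} {q : ℕ} (hq : 1 ≤ q)
    (hβ : ∀ i ∈ A, ∀ k ∈ A, β i < β k → i + q ≤ k) :
    |∫ e, (∑ i ∈ A, a i * centered μ ξ h i e) ^ 2 ∂μ
      - ∑ b ∈ A.image β, ∫ e, (∑ i ∈ A with β i = b, a i * centered μ ξ h i e) ^ 2 ∂μ|
      ≤ (∑ i ∈ A, a i ^ 2) * (√V * (C * ((q : ℝ) ^ (-(1 / 4) : ℝ)
        * ∑' x : ℤ, |(x : ℝ)| ^ (-(5 / 4) : ℝ)))) := by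
  have hq0 : (0 : ℝ) < q := by exact_mod_cast hq
  simp_rw [integral_sum_sq_eq hξm hξ hh]
  set d : ℤ → ℤ → ℝ := fun i k => ∫ e, centered μ ξ h i e * centered μ ξ h k e ∂μ
  have h1 : ∑ b ∈ A.image β, ∑ i ∈ A with β i = b, ∑ k ∈ A with β k = b, a i * a k * d i k
      = ∑ i ∈ A, ∑ k ∈ A, a i * a k * (if β i = β k then d i k else 0) := by
    rw [← Finset.sum_fiberwise_of_maps_to (g := β) (t := A.image β)
      (fun i hi => Finset.mem_image_of_mem β hi)]
    refine Finset.sum_congr rfl fun b _ => Finset.sum_congr rfl fun i hi => ?_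
    rw [Finset.sum_filter]
    refine Finset.sum_congr rfl fun k _ => ?_
    rw [(Finset.mem_filter.1 hi).2]
    by_cases hk : b = β k
    · simp [hk]
    · simp [hk, Ne.symm hk]
  -- Subtracting the within-block terms leaves only pairs of sites in different blocks, hence at
  -- distance at least `q`.
  rw [h1, ← Finset.sum_sub_distrib]
  simp_rw [← Finset.sum_sub_distrib, ← mul_sub]
  have hs : HasSum (fun x : ℤ => √V * (C * ((q : ℝ) ^ (-(1 / 4) : ℝ) * |(x : ℝ)| ^ (-(5 / 4) : ℝ))))
      (√V * (C * ((q : ℝ) ^ (-(1 / 4) : ℝ) * ∑' x : ℤ, |(x : ℝ)| ^ (-(5 / 4) : ℝ)))) :=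
    (((Real.summable_abs_int_rpow (by norm_num)).hasSum.mul_left _).mul_left C).mul_left _
  rw [← hs.tsum_eq]
  refine abs_sum_sum_mul_le_of_abs_le (fun x => by positivity) hs.summable fun i hi k hk => ?_
  by_cases hik : β i = β k
  · rw [if_pos hik, sub_self, abs_zero]
    positivity
  · rw [if_neg hik, sub_zero]
    have hne : i ≠ k := fun h => hik (by rw [h])
    refine (hw.abs_integral_centered_mul_le hC hξm hξ hh hV hne).trans ?_
    have hsep : (q : ℝ) ≤ |((i - k : ℤ) : ℝ)| := by
      have : (q : ℤ) ≤ |i - k| := by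
        rcases lt_or_gt_of_ne hik with hlt | hlt
        · have := hβ i hi k hk hlt
          rw [abs_sub_comm, abs_of_nonneg] <;> omega
        · have := hβ k hk i hi hlt
          rw [abs_of_nonneg] <;> omega
      exact_mod_cast this
    have hpos : 0 < |((i - k : ℤ) : ℝ)| := hq0.trans_le hsep
    gcongr
    -- The exponent is shared out: `1/4` yields decay in the separation `q`, and `5/4 > 1` keeps the
    -- kernel summable.
    rw [show (-(3 / 2) : ℝ) = -(1 / 4) + -(5 / 4) by norm_num, Real.rpow_add hpos]
    gcongr ?_ * _
    exact Real.rpow_le_rpow_of_nonpos hq0 hsep (by norm_num)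

end Centered

/-! ### Characteristic functions: factorisation and Gaussian approximation of one factor. -/

theorem norm_prod_sub_prod_le {ι : Type*} (S : Finset ι) {f g : ι → ℂ} (hf : ∀ i ∈ S, ‖f i‖ ≤ 1)
    (hg : ∀ i ∈ S, ‖g i‖ ≤ 1) : ‖∏ i ∈ S, f i - ∏ i ∈ S, g i‖ ≤ ∑ i ∈ S, ‖f i - g i‖ := by
  classical
  induction S using Finset.induction_on with
  | empty => simp
  | insert i S hi ih =>
    rw [Finset.prod_insert hi, Finset.prod_insert hi, Finset.sum_insert hi]
    have h1 := ih (fun k hk => hf k (Finset.mem_insert_of_mem hk))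
      (fun k hk => hg k (Finset.mem_insert_of_mem hk))
    have h2 : ‖∏ k ∈ S, f k‖ ≤ 1 := by
      rw [norm_prod]
      exact Finset.prod_le_one (fun _ _ => norm_nonneg _)
        (fun k hk => hf k (Finset.mem_insert_of_mem hk))
    have h3 : f i * ∏ k ∈ S, f k - g i * ∏ k ∈ S, g k
        = (f i - g i) * ∏ k ∈ S, f k + g i * (∏ k ∈ S, f k - ∏ k ∈ S, g k) := by ring
    rw [h3]
    refine (norm_add_le _ _).trans (add_le_add ?_ ?_)
    · rw [norm_mul]
      exact mul_le_of_le_one_right (norm_nonneg _) h2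
    · rw [norm_mul]
      exact (mul_le_of_le_one_left (norm_nonneg _) (hg i (Finset.mem_insert_self _ _))).trans h1

section CharacteristicFunction

variable {E : Type*} [MeasurableSpace E] {μ : Measure E} [IsProbabilityMeasure μ]

theorem integrable_cexp_mul_I {Z : E → ℝ} (hZ : Measurable Z) :
    Integrable (fun e => Complex.exp (Z e * Complex.I)) μ :=
  Integrable.of_bound (by fun_prop) 1 (ae_of_all _ fun e => (Complex.norm_exp_ofReal_mul_I _).le)

theorem norm_integral_cexp_mul_I_le {Z : E → ℝ} :
    ‖∫ e, Complex.exp (Z e * Complex.I) ∂μ‖ ≤ 1 := by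
  refine (norm_integral_le_of_norm_le_const (C := 1)
    (ae_of_all _ fun e => (Complex.norm_exp_ofReal_mul_I _).le)).trans ?_
  simp

theorem integrable_cos {Z : E → ℝ} (hZ : Measurable Z) : Integrable (fun e => Real.cos (Z e)) μ :=
  Integrable.of_bound (by fun_prop) 1 (ae_of_all _ fun e => Real.abs_cos_le_one _)

theorem integrable_sin {Z : E → ℝ} (hZ : Measurable Z) : Integrable (fun e => Real.sin (Z e)) μ :=
  Integrable.of_bound (by fun_prop) 1 (ae_of_all _ fun e => Real.abs_sin_le_one _)

theorem integral_cexp_mul_I {Z : E → ℝ} (hZ : Measurable Z) :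
    ∫ e, Complex.exp (Z e * Complex.I) ∂μ
      = ((∫ e, Real.cos (Z e) ∂μ : ℝ) : ℂ) + ((∫ e, Real.sin (Z e) ∂μ : ℝ) : ℂ) * Complex.I := by
  have : ∀ e, Complex.exp (Z e * Complex.I)
      = ((Real.cos (Z e) : ℝ) : ℂ) + ((Real.sin (Z e) : ℝ) : ℂ) * Complex.I := fun e => by
    rw [Complex.exp_mul_I]; push_cast; rfl
  simp_rw [this]
  rw [integral_add (integrable_cos hZ).ofReal ((integrable_sin hZ).ofReal.mul_const _),
    integral_mul_const, integral_complex_ofReal, integral_complex_ofReal]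

/-- The dependence coefficients test real functions only. The addition formulas reduce the complex
covariance to four real ones, two in the real part and two in the imaginary part. -/
theorem norm_integral_cexp_add_sub_mul_le {X Z : E → ℝ} (hX : Measurable X) (hZ : Measurable Z)
    {ε : ℝ}
    (h : ∀ f ∈ ({Real.cos, Real.sin} : Set (ℝ → ℝ)), ∀ g ∈ ({Real.cos, Real.sin} : Set (ℝ → ℝ)),
      |∫ e, f (X e) * g (Z e) ∂μ - (∫ e, f (X e) ∂μ) * ∫ e, g (Z e) ∂μ| ≤ ε) :
    ‖∫ e, Complex.exp (((X e + Z e : ℝ) : ℂ) * Complex.I) ∂μ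
      - (∫ e, Complex.exp (X e * Complex.I) ∂μ) * ∫ e, Complex.exp (Z e * Complex.I) ∂μ‖
      ≤ 4 * ε := by
  have hcc := h Real.cos (by simp) Real.cos (by simp)
  have hcs := h Real.cos (by simp) Real.sin (by simp)
  have hsc := h Real.sin (by simp) Real.cos (by simp)
  have hss := h Real.sin (by simp) Real.sin (by simp)
  have icc : Integrable (fun e => Real.cos (X e) * Real.cos (Z e)) μ :=
    (integrable_cos hZ).bdd_mul (by fun_prop) (ae_of_all _ fun e => Real.abs_cos_le_one (X e))
  have iss : Integrable (fun e => Real.sin (X e) * Real.sin (Z e)) μ :=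
    (integrable_sin hZ).bdd_mul (by fun_prop) (ae_of_all _ fun e => Real.abs_sin_le_one (X e))
  have isc : Integrable (fun e => Real.sin (X e) * Real.cos (Z e)) μ :=
    (integrable_cos hZ).bdd_mul (by fun_prop) (ae_of_all _ fun e => Real.abs_sin_le_one (X e))
  have ics : Integrable (fun e => Real.cos (X e) * Real.sin (Z e)) μ :=
    (integrable_sin hZ).bdd_mul (by fun_prop) (ae_of_all _ fun e => Real.abs_cos_le_one (X e))
  rw [integral_cexp_mul_I (Z := fun e => X e + Z e) (hX.add hZ), integral_cexp_mul_I hX,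
    integral_cexp_mul_I hZ]
  simp only [Real.cos_add, Real.sin_add]
  rw [integral_sub icc iss, integral_add isc ics]
  refine (Complex.norm_le_abs_re_add_abs_im _).trans ?_
  simp only [Complex.add_re, Complex.sub_re, Complex.mul_re, Complex.ofReal_re, Complex.I_re,
    Complex.ofReal_im, Complex.I_im, Complex.add_im, Complex.mul_im, Complex.sub_im]
  rw [abs_le] at hcc hcs hsc hss
  have h1 : ∀ x y : ℝ, |x| ≤ 2 * ε → |y| ≤ 2 * ε → |x| + |y| ≤ 4 * ε := fun x y hx hy => by
    linarith
  apply h1 <;> rw [abs_le] <;> constructor <;> linarith [hcc.1, hcc.2, hcs.1, hcs.2, hsc.1, hsc.2,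
    hss.1, hss.2]

theorem norm_cexp_mul_I_sub_taylor_le {x : ℝ} (hx : |x| ≤ 1) :
    ‖Complex.exp (x * Complex.I) - (1 + x * Complex.I - ((x ^ 2 / 2 : ℝ) : ℂ))‖ ≤ |x| ^ 3 / 3 := by
  have hn : ‖(x : ℂ) * Complex.I‖ = |x| := by simp
  have := Complex.exp_bound' (x := x * Complex.I) (n := 3) (by rw [hn]; norm_num; linarith)
  rw [hn] at this
  have h2 : (x * Complex.I : ℂ) ^ 2 = -(x : ℂ) ^ 2 := by rw [mul_pow, Complex.I_sq]; ring
  have h3 : ∑ k ∈ Finset.range 3, (x * Complex.I : ℂ) ^ k / k.factorial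
      = 1 + x * Complex.I - ((x ^ 2 / 2 : ℝ) : ℂ) := by
    simp only [Finset.sum_range_succ, Finset.sum_range_zero, h2]
    norm_num [Nat.factorial]
    ring
  rw [h3] at this
  refine this.trans (le_of_eq ?_)
  norm_num [Nat.factorial]
  ring

/-- Both terms are close to `1 - v/2` with `v` the variance: the first by a third-order Taylor
expansion with `|Z|³ ≤ δ Z²`, the second because `v ≤ δ²`. -/
theorem norm_integral_cexp_sub_exp_le {Z : E → ℝ} (hZ : Measurable Z) {δ : ℝ} (hδ : δ ≤ 1)
    (hb : ∀ e, |Z e| ≤ δ) (h0 : ∫ e, Z e ∂μ = 0) :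
    ‖∫ e, Complex.exp (Z e * Complex.I) ∂μ
      - Complex.exp (((-(∫ e, Z e ^ 2 ∂μ) / 2 : ℝ) : ℂ))‖ ≤ δ * ∫ e, Z e ^ 2 ∂μ := by
  obtain ⟨e₀⟩ : Nonempty E := nonempty_of_isProbabilityMeasure μ
  have hδ0 : 0 ≤ δ := (abs_nonneg _).trans (hb e₀)
  have hsq : ∀ e, Z e ^ 2 ≤ δ ^ 2 := fun e => by
    rw [← sq_abs]
    exact pow_le_pow_left₀ (abs_nonneg _) (hb e) 2
  have i1 : Integrable Z μ := Integrable.of_bound hZ.aestronglyMeasurable δ (ae_of_all _ hb)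
  have i2 : Integrable (fun e => Z e ^ 2) μ :=
    Integrable.of_bound (by fun_prop) (δ ^ 2) (ae_of_all _ fun e => by
      rw [Real.norm_eq_abs, abs_of_nonneg (sq_nonneg _)]; exact hsq e)
  set v := ∫ e, Z e ^ 2 ∂μ with hv
  have hv0 : 0 ≤ v := integral_nonneg fun e => sq_nonneg _
  have hvδ : v ≤ δ ^ 2 := by
    have := integral_mono i2 (integrable_const (δ ^ 2)) hsq
    simpa using this
  have iT : Integrable (fun e => (1 + Z e * Complex.I - ((Z e ^ 2 / 2 : ℝ) : ℂ))) μ :=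
    ((integrable_const _).add (i1.ofReal.mul_const _)).sub (i2.div_const 2).ofReal
  have hT : ∫ e, (1 + Z e * Complex.I - ((Z e ^ 2 / 2 : ℝ) : ℂ)) ∂μ = ((1 - v / 2 : ℝ) : ℂ) := by
    rw [integral_sub ((integrable_const _).add (i1.ofReal.mul_const _)) (i2.div_const 2).ofReal,
      integral_add (integrable_const _) (i1.ofReal.mul_const _), integral_mul_const,
      integral_complex_ofReal, integral_complex_ofReal, h0, integral_div]
    simp [hv]
  have h1 : ‖∫ e, Complex.exp (Z e * Complex.I) ∂μ - ((1 - v / 2 : ℝ) : ℂ)‖ ≤ δ / 3 * v := by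
    rw [← hT, ← integral_sub (integrable_cexp_mul_I hZ) iT, hv, ← integral_const_mul]
    refine norm_integral_le_of_norm_le (i2.const_mul _) (ae_of_all _ fun e => ?_)
    refine (norm_cexp_mul_I_sub_taylor_le ((hb e).trans hδ)).trans ?_
    have : |Z e| ^ 3 = |Z e| * Z e ^ 2 := by rw [← sq_abs (Z e)]; ring
    rw [this]
    nlinarith [hb e, sq_nonneg (Z e)]
  have h2 : ‖((1 - v / 2 : ℝ) : ℂ) - Complex.exp (((-v / 2 : ℝ) : ℂ))‖ ≤ δ / 4 * v := by
    rw [← Complex.ofReal_exp, ← Complex.ofReal_sub, Complex.norm_real, Real.norm_eq_abs]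
    have hv1 : v ≤ 1 := hvδ.trans (pow_le_one₀ hδ0 hδ)
    have := Real.abs_exp_sub_one_sub_id_le (x := -v / 2) (by rw [abs_le]; constructor <;> linarith)
    rw [abs_sub_comm]
    have h3 : Real.exp (-v / 2) - (1 - v / 2) = Real.exp (-v / 2) - 1 - -v / 2 := by ring
    rw [h3]
    refine this.trans ?_
    -- The quadratic remainder `(v/2)²` is at most `δ v / 4`.
    have : v ≤ δ := hvδ.trans (by nlinarith)
    nlinarith
  calc _ ≤ δ / 3 * v + δ / 4 * v := (norm_sub_le_norm_sub_add_norm_sub _ _ _).trans (add_le_add h1 h2)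
    _ ≤ δ * v := by nlinarith [mul_nonneg hδ0 hv0]

end CharacteristicFunction

/-! ### Asymptotic independence of separated blocks. -/

theorem measurable_sum_centered {E : Type*} [MeasurableSpace E] {μ : Measure E} {ξ : ℤ → E → ℝ}
    {h : ℝ → ℝ} (hξm : ∀ i, Measurable (ξ i))
    (hh : ∀ x y, |h x - h y| ≤ |x - y|) (J : Finset ℤ) (a : ℤ → ℝ) :
    Measurable fun e => ∑ i ∈ J, a i * centered μ ξ h i e :=
  Finset.measurable_fun_sum _ fun i _ =>
    (((measurable_of_abs_sub_le hh).comp (hξm i)).sub_const _).const_mul _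

theorem measurable_pastSigma_sum_centered {E : Type*} [MeasurableSpace E] {μ : Measure E}
    {ξ : ℤ → E → ℝ} {h : ℝ → ℝ} (hh : ∀ x y, |h x - h y| ≤ |x - y|) {J : Finset ℤ}
    {p : ℤ} (hJ : ∀ i ∈ J, i ≤ p) (a : ℤ → ℝ) :
    Measurable[pastSigma ξ p] fun e => ∑ i ∈ J, a i * centered μ ξ h i e :=
  Finset.measurable_fun_sum _ fun i hi =>
    (((measurable_of_abs_sub_le hh).comp (measurable_pastSigma (hJ i hi))).sub_const _).const_mul _

section Blocks

variable {E : Type*} [MeasurableSpace E] {μ : Measure E} [IsProbabilityMeasure μ]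
  {ξ : ℤ → E → ℝ} {C : ℝ} {h : ℝ → ℝ}

/-- Listed in increasing order, the sites of `J` turn the weighted sum into a functional of `J.card`
future coordinates. It is `m`-Lipschitz for the `ℓ¹` metric, since each weight is at most `m`; the
factor `J.card` is the price `l` in the definition of `θ₂`. -/
theorem WeaklyDependent.abs_cov_lipschitz_sum_le (hw : WeaklyDependent μ ξ C) (hC : 0 ≤ C)
    (hξm : ∀ i, Measurable (ξ i)) (hξ : ∀ i, MemLp (ξ i) 2 μ)
    (hh : ∀ x y, |h x - h y| ≤ |x - y|) {a : ℤ → ℝ} {m : ℝ} (hm : 0 < m)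
    {J : Finset ℤ} (ha : ∀ i ∈ J, |a i| ≤ m) {p : ℤ} {q : ℕ} (hq : 1 ≤ q)
    (hJ : ∀ i ∈ J, p + q ≤ i) {U : E → ℝ} (hU : Measurable[pastSigma ξ p] U)
    (hU1 : ∀ e, |U e| ≤ 1) {ψ : ℝ → ℝ} (hψ : ∀ x y, |ψ x - ψ y| ≤ |x - y|) :
    |∫ e, U e * ψ (∑ i ∈ J, a i * centered μ ξ h i e) ∂μ
      - (∫ e, U e ∂μ) * ∫ e, ψ (∑ i ∈ J, a i * centered μ ξ h i e) ∂μ|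
      ≤ m * (J.card * (C * (q : ℝ) ^ (-(3 / 2) : ℝ))) := by
  set j := J.orderEmbOfFin rfl
  have hsum : ∀ F : ℤ → ℝ, ∑ i ∈ J, F i = ∑ k, F (j k) := fun F => by
    conv_lhs => rw [← Finset.map_orderEmbOfFin_univ J rfl]
    rw [Finset.sum_map]
    rfl
  have hjmem : ∀ k, j k ∈ J := fun k => J.orderEmbOfFin_mem rfl k
  have hUm : Measurable U := hU.mono (pastSigma_le hξm p) le_rfl
  have hU2 : MemLp U 2 μ := MemLp.of_bound hUm.aestronglyMeasurable 1 (ae_of_all _ hU1)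
  have hU3 : √(∫ e, U e ^ 2 ∂μ) ≤ 1 := by
    rw [Real.sqrt_le_one]
    have := integral_mono (hU2.integrable_sq) (integrable_const (1 : ℝ)) (fun e => by
      have := hU1 e
      rw [← sq_abs]
      exact pow_le_one₀ (abs_nonneg _) this)
    simpa using this
  have key := hw.abs_cov_le hC hξm hξ hq hU hU2 j.strictMono (fun k => hJ _ (hjmem k))
    (φ := fun x => ψ (∑ k, a (j k) * (h (x k) - ∫ e', h (ξ (j k) e') ∂μ))) (L := m) hm
    (fun x y => by
      refine (hψ _ _).trans ?_
      rw [← Finset.sum_sub_distrib, Finset.mul_sum]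
      refine (Finset.abs_sum_le_sum_abs _ _).trans (Finset.sum_le_sum fun k _ => ?_)
      rw [← mul_sub, sub_sub_sub_cancel_right, abs_mul]
      exact mul_le_mul (ha _ (hjmem k)) (hh _ _) (abs_nonneg _) hm.le)
  simp_rw [hsum]
  refine key.trans (mul_le_of_le_one_left (by positivity) hU3)

/-- Induction peels off the rightmost block: all earlier blocks lie in its past at distance at least
`q`. Each peeling costs an amount proportional to the size of the block removed, so the total cost
is proportional to the number of sites and not to its product with the number of blocks. -/
theorem WeaklyDependent.norm_charFun_sub_prod_le (hw : WeaklyDependent μ ξ C) (hC : 0 ≤ C)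
    (hξm : ∀ i, Measurable (ξ i)) (hξ : ∀ i, MemLp (ξ i) 2 μ)
    (hh : ∀ x y, |h x - h y| ≤ |x - y|) {A : Finset ℤ} {a : ℤ → ℝ} {m : ℝ} (hm : 0 < m)
    (ha : ∀ i ∈ A, |a i| ≤ m) {β : ℤ → ℤ} {q : ℕ} (hq : 1 ≤ q)
    (hβ : ∀ i ∈ A, ∀ k ∈ A, β i < β k → i + q ≤ k) (S : Finset ℤ) :
    ‖∫ e, Complex.exp (((∑ i ∈ A with β i ∈ S, a i * centered μ ξ h i e : ℝ) : ℂ) * Complex.I) ∂μ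
      - ∏ b ∈ S, ∫ e, Complex.exp
        (((∑ i ∈ A with β i = b, a i * centered μ ξ h i e : ℝ) : ℂ) * Complex.I) ∂μ‖
      ≤ 4 * (m * ((A.filter (fun i => β i ∈ S)).card * (C * (q : ℝ) ^ (-(3 / 2) : ℝ)))) := by
  induction S using Finset.induction_on_max with
  | empty => simp
  | insert b S hb ih =>
    have hbS : b ∉ S := fun h => lt_irrefl _ (hb b h)
    set J := A.filter (fun i => β i = b) with hJ
    set P := A.filter (fun i => β i ∈ S) with hP
    have hdisj : Disjoint J P := by
      rw [Finset.disjoint_left]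
      intro i hi hi'
      rw [hJ, Finset.mem_filter] at hi
      rw [hP, Finset.mem_filter] at hi'
      exact hbS (hi.2 ▸ hi'.2)
    have hunion : A.filter (fun i => β i ∈ insert b S) = J ∪ P := by
      ext i
      simp only [hJ, hP, Finset.mem_filter, Finset.mem_insert, Finset.mem_union]
      tauto
    rw [hunion, Finset.prod_insert hbS, Finset.card_union_of_disjoint hdisj]
    simp_rw [Finset.sum_union hdisj]
    set X : E → ℝ := fun e => ∑ i ∈ P, a i * centered μ ξ h i e with hX
    set Z : E → ℝ := fun e => ∑ i ∈ J, a i * centered μ ξ h i e with hZ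
    have hXm : Measurable X := measurable_sum_centered hξm hh P a
    have hZm : Measurable Z := measurable_sum_centered hξm hh J a
    have h1 : ‖∫ e, Complex.exp (((X e + Z e : ℝ) : ℂ) * Complex.I) ∂μ
        - (∫ e, Complex.exp (X e * Complex.I) ∂μ) * ∫ e, Complex.exp (Z e * Complex.I) ∂μ‖
        ≤ 4 * (m * (J.card * (C * (q : ℝ) ^ (-(3 / 2) : ℝ)))) := by
      rcases J.eq_empty_or_nonempty with hJe | hJne
      · have : ∀ e, Z e = 0 := fun e => by simp [hZ, hJe]
        simp [this, hJe]
      -- The past ends exactly `q` sites before the first site of the new block; separation puts the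
      -- earlier blocks inside it.
      · set p := J.min' hJne - q
        have hPp : ∀ i ∈ P, i ≤ p := fun i hi => by
          have hmin := (Finset.mem_filter (p := fun i => β i = b)).1 (J.min'_mem hJne)
          rw [hP, Finset.mem_filter] at hi
          have := hβ i hi.1 _ hmin.1 (by rw [hmin.2]; exact hb _ hi.2)
          simp only [p]
          omega
        have hJp : ∀ i ∈ J, p + q ≤ i := fun i hi => by
          have := J.min'_le i hi
          simp only [p]
          omega
        have hXp : Measurable[pastSigma ξ p] X := measurable_pastSigma_sum_centered hh hPp a
        have lip : ∀ g ∈ ({Real.cos, Real.sin} : Set (ℝ → ℝ)), ∀ x y, |g x - g y| ≤ |x - y| := by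
          rintro g (rfl | rfl) x y
          · exact Real.abs_cos_sub_cos_le x y
          · exact Real.abs_sin_sub_sin_le x y
        refine norm_integral_cexp_add_sub_mul_le hXm hZm fun f hf g hg => ?_
        refine hw.abs_cov_lipschitz_sum_le hC hξm hξ hh hm
          (fun i hi => ha i (Finset.filter_subset _ _ hi)) hq hJp
          ((measurable_of_abs_sub_le (lip f hf)).comp hXp) (fun e => ?_) (lip g hg)
        rcases hf with rfl | rfl
        · exact Real.abs_cos_le_one _
        · exact Real.abs_sin_le_one _
    have h2 : ∀ e, Z e + X e = X e + Z e := fun e => add_comm _ _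
    have h3 : ∀ e, ∑ i ∈ J, a i * centered μ ξ h i e + ∑ i ∈ P, a i * centered μ ξ h i e
        = X e + Z e := fun e => add_comm _ _
    simp_rw [h3]
    set cX := ∫ e, Complex.exp (X e * Complex.I) ∂μ
    set cZ := ∫ e, Complex.exp (Z e * Complex.I) ∂μ
    set D := ∏ b ∈ S, ∫ e, Complex.exp
        (((∑ i ∈ A with β i = b, a i * centered μ ξ h i e : ℝ) : ℂ) * Complex.I) ∂μ
    have h4 : ‖cX * cZ - cZ * D‖ ≤ 4 * (m * (P.card * (C * (q : ℝ) ^ (-(3 / 2) : ℝ)))) := by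
      have : cX * cZ - cZ * D = cZ * (cX - D) := by ring
      rw [this, norm_mul]
      exact (mul_le_of_le_one_left (norm_nonneg _) norm_integral_cexp_mul_I_le).trans ih
    refine (norm_sub_le_norm_sub_add_norm_sub _ (cX * cZ) _).trans ((add_le_add h1 h4).trans ?_)
    push_cast
    linarith

/-- Non-asymptotic central limit theorem for a sum of well separated blocks. -/
theorem WeaklyDependent.norm_charFun_sub_exp_le (hw : WeaklyDependent μ ξ C) (hC : 0 ≤ C)
    (hξm : ∀ i, Measurable (ξ i)) (hξ : ∀ i, MemLp (ξ i) 2 μ)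
    (hh : ∀ x y, |h x - h y| ≤ |x - y|) {A : Finset ℤ} {a : ℤ → ℝ} {m : ℝ} (hm : 0 < m)
    (ha : ∀ i ∈ A, |a i| ≤ m) {β : ℤ → ℤ} {q : ℕ} (hq : 1 ≤ q)
    (hβ : ∀ i ∈ A, ∀ k ∈ A, β i < β k → i + q ≤ k) {δ : ℝ} (hδ : δ ≤ 1)
    (hb : ∀ b ∈ A.image β, ∀ e, |∑ i ∈ A with β i = b, a i * centered μ ξ h i e| ≤ δ) :
    ‖∫ e, Complex.exp (((∑ i ∈ A, a i * centered μ ξ h i e : ℝ) : ℂ) * Complex.I) ∂μ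
      - Complex.exp (((-(∑ b ∈ A.image β,
        ∫ e, (∑ i ∈ A with β i = b, a i * centered μ ξ h i e) ^ 2 ∂μ) / 2 : ℝ) : ℂ))‖
      ≤ 4 * (m * (A.card * (C * (q : ℝ) ^ (-(3 / 2) : ℝ)))) + δ * ∑ b ∈ A.image β,
        ∫ e, (∑ i ∈ A with β i = b, a i * centered μ ξ h i e) ^ 2 ∂μ := by
  have h1 := hw.norm_charFun_sub_prod_le hC hξm hξ hh hm ha hq hβ (A.image β)
  have hA : A.filter (fun i => β i ∈ A.image β) = A :=
    Finset.filter_true_of_mem fun i hi => Finset.mem_image_of_mem β hi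
  rw [hA] at h1
  refine (norm_sub_le_norm_sub_add_norm_sub _ _ _).trans (add_le_add h1 ?_)
  have h2 : Complex.exp (((-(∑ b ∈ A.image β,
        ∫ e, (∑ i ∈ A with β i = b, a i * centered μ ξ h i e) ^ 2 ∂μ) / 2 : ℝ) : ℂ))
      = ∏ b ∈ A.image β, Complex.exp (((-(
        ∫ e, (∑ i ∈ A with β i = b, a i * centered μ ξ h i e) ^ 2 ∂μ) / 2 : ℝ) : ℂ)) := by
    rw [← Complex.exp_sum, ← Complex.ofReal_sum, ← Finset.sum_neg_distrib, Finset.sum_div]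
  rw [h2, Finset.mul_sum]
  refine (norm_prod_sub_prod_le _ (fun b _ => norm_integral_cexp_mul_I_le) fun b _ => ?_).trans
    (Finset.sum_le_sum fun b hb' => ?_)
  · rw [← Complex.ofReal_exp, Complex.norm_real, Real.norm_eq_abs, Real.abs_exp]
    refine Real.exp_le_one_iff.2 ?_
    have : 0 ≤ ∫ e, (∑ i ∈ A with β i = b, a i * centered μ ξ h i e) ^ 2 ∂μ :=
      integral_nonneg fun e => sq_nonneg _
    linarith
  · refine norm_integral_cexp_sub_exp_le (measurable_sum_centered hξm hh _ a) hδ (hb b hb') ?_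
    rw [integral_finsetSum _ fun i _ =>
      ((memLp_centered hξm hξ hh i).integrable one_le_two).const_mul _]
    exact Finset.sum_eq_zero fun i _ => by
      rw [integral_const_mul, integral_centered hξm hξ hh, mul_zero]

end Blocks

/-! ### Periodic pattern of blocks and gaps. -/

/-- Averaging over the offset of a periodic pattern with gaps of proportion `q / (p + q)`. -/
theorem exists_offset_sum_gaps_le (A : Finset ℤ) {w : ℤ → ℝ} (hw : ∀ i, 0 ≤ w i) {p q : ℕ}
    (hp : 1 ≤ p) :
    ∃ u : ℤ, ∑ i ∈ A with ¬ (i + u) % ((p + q : ℕ) : ℤ) < p, w i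
      ≤ (q : ℝ) / ((p + q : ℕ) : ℝ) * ∑ i ∈ A, w i := by
  set L := p + q with hL
  have hL0 : 0 < L := by omega
  -- Among the `L` offsets, a given site falls in a gap for at most `q` of them, so some offset does
  -- no worse than the average.
  have hcount : ∀ i : ℤ,
      ((Finset.range L).filter (fun u : ℕ => ¬ (i + u) % (L : ℤ) < p)).card ≤ q := fun i => by
    have : (Finset.Ico (p : ℤ) L).card = q := by simp [hL]
    rw [← this]
    refine Finset.card_le_card_of_injOn (fun u : ℕ => (i + u) % (L : ℤ)) ?_ ?_
    · intro u hu
      simp only [Finset.coe_filter, Finset.mem_range, Set.mem_ofPred_eq] at hu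
      simp only [Finset.coe_Ico, Set.mem_Ico]
      exact ⟨not_lt.1 hu.2, Int.emod_lt_of_pos _ (by omega)⟩
    · intro u hu v hv huv
      simp only [Finset.coe_filter, Finset.mem_range, Set.mem_ofPred_eq] at hu hv huv
      have h1 : (L : ℤ) ∣ (i + u) - (i + v) := Int.ModEq.dvd (Eq.symm huv)
      have h2 : (L : ℤ) ∣ (u : ℤ) - v := by simpa using h1
      have h3 := Int.eq_zero_of_abs_lt_dvd h2 (by rw [abs_lt]; constructor <;> omega)
      omega
  have hsum : ∑ u ∈ Finset.range L, ∑ i ∈ A with ¬ (i + (u : ℤ)) % (L : ℤ) < p, w i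
      ≤ ∑ u ∈ Finset.range L, (q : ℝ) / (L : ℝ) * ∑ i ∈ A, w i := by
    simp_rw [Finset.sum_filter]
    rw [Finset.sum_comm, Finset.sum_const, Finset.card_range, nsmul_eq_mul, ← mul_assoc,
      mul_div_cancel₀ _ (by positivity), Finset.mul_sum]
    refine Finset.sum_le_sum fun i _ => ?_
    rw [← Finset.sum_filter, Finset.sum_const, nsmul_eq_mul]
    exact mul_le_mul_of_nonneg_right (by exact_mod_cast hcount i) (hw i)
  obtain ⟨u, -, hu⟩ := Finset.exists_le_of_sum_le ⟨0, Finset.mem_range.2 hL0⟩ hsum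
  exact ⟨u, hu⟩

/-- A kept site lies among the first `p` residues of its period, so the `q` residues ending that
period separate it from later periods. -/
theorem add_le_of_ediv_lt_ediv {i k u : ℤ} {p q : ℕ} (hi : (i + u) % ((p + q : ℕ) : ℤ) < p)
    (hik : (i + u) / ((p + q : ℕ) : ℤ) < (k + u) / ((p + q : ℕ) : ℤ)) : i + q ≤ k := by
  -- For period `0` integer division gives `0`, so the strict inequality between quotients is
  -- impossible.
  rcases Nat.eq_zero_or_pos (p + q) with h0 | h0
  · simp [h0] at hik
  have h1 := Int.mul_ediv_add_emod (i + u) ((p + q : ℕ) : ℤ)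
  have h2 := Int.mul_ediv_add_emod (k + u) ((p + q : ℕ) : ℤ)
  have h3 := Int.emod_nonneg (k + u) (b := ((p + q : ℕ) : ℤ)) (by omega)
  have h4 : ((p + q : ℕ) : ℤ) * ((i + u) / ((p + q : ℕ) : ℤ) + 1)
      ≤ ((p + q : ℕ) : ℤ) * ((k + u) / ((p + q : ℕ) : ℤ)) :=
    mul_le_mul_of_nonneg_left hik (by omega)
  rw [mul_add, mul_one] at h4
  push_cast at *
  linarith

theorem card_filter_ediv_eq_le {A : Finset ℤ} {u b : ℤ} {p q : ℕ}
    (hp : 1 ≤ p) (hA : ∀ i ∈ A, (i + u) % ((p + q : ℕ) : ℤ) < p) :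
    (A.filter (fun i => (i + u) / ((p + q : ℕ) : ℤ) = b)).card ≤ p := by
  have : (Finset.Ico (0 : ℤ) p).card = p := by simp
  refine le_of_le_of_eq ?_ this
  refine Finset.card_le_card_of_injOn (fun i => (i + u) % ((p + q : ℕ) : ℤ)) ?_ ?_
  · intro i hi
    simp only [Finset.coe_filter, Set.mem_ofPred_eq] at hi
    have h1 := hA i hi.1
    simp only [Finset.coe_Ico, Set.mem_Ico]
    exact ⟨Int.emod_nonneg _ (by omega), h1⟩
  · intro i hi k hk hik
    simp only [Finset.coe_filter, Set.mem_ofPred_eq] at hi hk hik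
    have h1 := Int.mul_ediv_add_emod (i + u) ((p + q : ℕ) : ℤ)
    have h2 := Int.mul_ediv_add_emod (k + u) ((p + q : ℕ) : ℤ)
    rw [hi.2, hik] at h1
    rw [hk.2] at h2
    linarith

/-! ### Truncation. -/

/-- Truncation at level `K`. -/
noncomputable def clip (K x : ℝ) : ℝ := max (-K) (min x K)

/-- This says that truncation and its remainder are both nondecreasing. Since they add up to the
identity, each is `1`-Lipschitz, so the variance bounds apply to both. -/
theorem clip_sub_clip_mem_Icc (K : ℝ) {x y : ℝ} (h : y ≤ x) :
    0 ≤ clip K x - clip K y ∧ clip K x - clip K y ≤ x - y := by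
  have h1 : clip K y ≤ clip K x := max_le_max le_rfl (min_le_min h le_rfl)
  have h2 : clip K x ≤ clip K y + (x - y) := by
    refine max_le ?_ ?_
    · have : -K ≤ clip K y := le_max_left _ _
      linarith
    · have h3 : min y K ≤ clip K y := le_max_right _ _
      have h4 : min x K ≤ min y K + (x - y) := by
        rw [← min_add_add_right]
        exact le_min ((min_le_left _ _).trans (by linarith)) ((min_le_right _ _).trans (by linarith))
      linarith
  constructor <;> linarith

theorem abs_clip_sub_clip_le (K x y : ℝ) : |clip K x - clip K y| ≤ |x - y| := by
  wlog h : y ≤ x generalizing x y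
  · rw [abs_sub_comm, abs_sub_comm x]
    exact this y x (le_of_not_ge h)
  obtain ⟨h1, h2⟩ := clip_sub_clip_mem_Icc K h
  rw [abs_of_nonneg h1, abs_of_nonneg (by linarith)]
  exact h2

theorem abs_sub_clip_sub_le (K x y : ℝ) : |(x - clip K x) - (y - clip K y)| ≤ |x - y| := by
  wlog h : y ≤ x generalizing x y
  · rw [abs_sub_comm, abs_sub_comm x]
    exact this y x (le_of_not_ge h)
  obtain ⟨h1, h2⟩ := clip_sub_clip_mem_Icc K h
  rw [abs_of_nonneg (by linarith : 0 ≤ x - clip K x - (y - clip K y)),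
    abs_of_nonneg (by linarith : 0 ≤ x - y)]
  linarith

theorem abs_clip_le {K : ℝ} (hK : 0 ≤ K) (x : ℝ) : |clip K x| ≤ K :=
  abs_le.2 ⟨le_max_left _ _, max_le (by linarith) (min_le_right _ _)⟩

theorem clip_zero {K : ℝ} (hK : 0 ≤ K) : clip K 0 = 0 := by simp [clip, hK]

theorem abs_clip_le_abs {K : ℝ} (hK : 0 ≤ K) (x : ℝ) : |clip K x| ≤ |x| := by
  simpa [clip_zero hK] using abs_clip_sub_clip_le K x 0

theorem abs_sub_clip_le_abs {K : ℝ} (hK : 0 ≤ K) (x : ℝ) : |x - clip K x| ≤ |x| := by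
  simpa [clip_zero hK] using abs_sub_clip_sub_le K x 0

theorem clip_eq_self {K x : ℝ} (h : |x| ≤ K) : clip K x = x := by
  rw [abs_le] at h
  rw [clip, min_eq_left h.2, max_eq_right h.1]

/-! ### Non-asymptotic Gaussian approximation for weighted sums. -/

/-- The constant `V + √V C ∑ |x|^{-3/2}` bounding the variance of weighted sums. -/
noncomputable def varianceConst (C V : ℝ) : ℝ :=
  V + √V * (C * ∑' x : ℤ, |(x : ℝ)| ^ (-(3 / 2) : ℝ))

theorem varianceConst_nonneg {C V : ℝ} (hC : 0 ≤ C) (hV : 0 ≤ V) : 0 ≤ varianceConst C V := by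
  have : 0 ≤ ∑' x : ℤ, |(x : ℝ)| ^ (-(3 / 2) : ℝ) := tsum_nonneg fun x => by positivity
  unfold varianceConst
  positivity

/-- The constant bounding the covariance between blocks separated by gaps of length `q`. -/
noncomputable def crossConst (C V : ℝ) (q : ℕ) : ℝ :=
  √V * (C * ((q : ℝ) ^ (-(1 / 4) : ℝ) * ∑' x : ℤ, |(x : ℝ)| ^ (-(5 / 4) : ℝ)))

theorem crossConst_nonneg {C V : ℝ} (hC : 0 ≤ C) (q : ℕ) : 0 ≤ crossConst C V q := by
  have : 0 ≤ ∑' x : ℤ, |(x : ℝ)| ^ (-(5 / 4) : ℝ) := tsum_nonneg fun x => by positivity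
  unfold crossConst
  positivity

theorem integral_add_sq_le {E : Type*} [MeasurableSpace E] {μ : Measure E} {f g : E → ℝ} (hf : MemLp f 2 μ) (hg : MemLp g 2 μ) :
    ∫ e, (f e + g e) ^ 2 ∂μ ≤ 2 * ∫ e, f e ^ 2 ∂μ + 2 * ∫ e, g e ^ 2 ∂μ := by
  rw [← integral_const_mul, ← integral_const_mul,
    ← integral_add (hf.integrable_sq.const_mul 2) (hg.integrable_sq.const_mul 2)]
  refine integral_mono (hf.add hg).integrable_sq
    ((hf.integrable_sq.const_mul 2).add (hg.integrable_sq.const_mul 2)) fun e => ?_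
  nlinarith [sq_nonneg (f e - g e)]

section Approximation

variable {E : Type*} [MeasurableSpace E] {μ : Measure E} [IsProbabilityMeasure μ]

theorem norm_integral_cexp_sub_le {f g : E → ℝ} (hfm : Measurable f) (hgm : Measurable g)
    (hf : MemLp f 2 μ) (hg : MemLp g 2 μ) :
    ‖∫ e, Complex.exp (f e * Complex.I) ∂μ - ∫ e, Complex.exp (g e * Complex.I) ∂μ‖
      ≤ √(∫ e, (f e - g e) ^ 2 ∂μ) := by
  rw [← integral_sub (integrable_cexp_mul_I hfm) (integrable_cexp_mul_I hgm)]
  have hd : MemLp (fun e => f e - g e) 2 μ := hf.sub hg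
  have h1 : ‖∫ e, (Complex.exp (f e * Complex.I) - Complex.exp (g e * Complex.I)) ∂μ‖
      ≤ ∫ e, |f e - g e| ∂μ := by
    refine norm_integral_le_of_norm_le (hd.integrable one_le_two).abs (ae_of_all _ fun e => ?_)
    have h2 : Complex.exp (f e * Complex.I) - Complex.exp (g e * Complex.I)
        = Complex.exp (g e * Complex.I) * (Complex.exp (Complex.I * ((f e - g e : ℝ) : ℂ)) - 1) := by
      rw [mul_sub, ← Complex.exp_add, mul_one]
      congr 2
      push_cast
      ring
    rw [h2, norm_mul, Complex.norm_exp_ofReal_mul_I, one_mul]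
    exact Real.norm_exp_I_mul_ofReal_sub_one_le
  refine h1.trans ?_
  have h3 := abs_integral_mul_le_sqrt_mul_sqrt (μ := μ) hd.abs (memLp_const (1 : ℝ))
  simp only [mul_one, one_pow, integral_const, probReal_univ, smul_eq_mul, Real.sqrt_one,
    Pi.abs_apply, sq_abs] at h3
  exact (le_abs_self _).trans h3

theorem abs_exp_neg_half_sub_le {v w : ℝ} (hv : 0 ≤ v) (hw : 0 ≤ w) :
    |Real.exp (-v / 2) - Real.exp (-w / 2)| ≤ |v - w| := by
  wlog h : v ≤ w generalizing v w
  · rw [abs_sub_comm, abs_sub_comm v]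
    exact this hw hv (le_of_not_ge h)
  have h1 : Real.exp (-w / 2) ≤ Real.exp (-v / 2) := Real.exp_le_exp.2 (by linarith)
  have h2 : Real.exp (-v / 2) ≤ 1 := Real.exp_le_one_iff.2 (by linarith)
  have h3 : Real.exp (-w / 2) = Real.exp (-v / 2) * Real.exp (-(w - v) / 2) := by
    rw [← Real.exp_add]; congr 1; ring
  have h4 := Real.add_one_le_exp (-(w - v) / 2)
  rw [abs_of_nonneg (by linarith), abs_of_nonpos (by linarith), h3]
  nlinarith [Real.exp_pos (-v / 2)]

variable {ξ : ℤ → E → ℝ} {C V : ℝ}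

/-- The sum splits as `Y = Yb + Yr + Ys`: truncated sum over big blocks, truncation remainder,
truncated sum over gaps. The number `η` bounds the second moment of `Yr + Ys`. The three groups of
the bound are the cost of replacing `Y` by `Yb` in the characteristic function, the block
approximation for `Yb`, and the cost of replacing the summed block variances by the variance of `Y`.
-/
theorem WeaklyDependent.norm_charFun_sum_sub_exp_variance_le (hw : WeaklyDependent μ ξ C)
    (hC : 0 ≤ C) (hξm : ∀ i, Measurable (ξ i)) (hξ : ∀ i, MemLp (ξ i) 2 μ)
    (hξ0 : ∀ i, ∫ e, ξ i e ∂μ = 0) (hV : ∀ i, ∫ e, ξ i e ^ 2 ∂μ ≤ V)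
    {K R : ℝ} (hK : 0 ≤ K) (hR : ∀ i, ∫ e, (ξ i e - clip K (ξ i e)) ^ 2 ∂μ ≤ R)
    {A : Finset ℤ} {a : ℤ → ℝ} {m : ℝ} (hm : 0 < m) (ha : ∀ i ∈ A, |a i| ≤ m) {p q : ℕ}
    (hp : 1 ≤ p) (hq : 1 ≤ q) (hδ : p * (m * (2 * K)) ≤ 1) {s : ℝ} (hs : ∑ i ∈ A, a i ^ 2 ≤ s)
    {η : ℝ} (hη : 2 * (s * varianceConst C R)
      + 2 * ((q : ℝ) / ((p + q : ℕ) : ℝ) * s * varianceConst C V) ≤ η) :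
    ‖∫ e, Complex.exp (((∑ i ∈ A, a i * ξ i e : ℝ) : ℂ) * Complex.I) ∂μ
      - Complex.exp (((-(∫ e, (∑ i ∈ A, a i * ξ i e) ^ 2 ∂μ) / 2 : ℝ) : ℂ))‖
      ≤ √η + (4 * (m * (A.card * (C * (q : ℝ) ^ (-(3 / 2) : ℝ))))
        + p * (m * (2 * K)) * (s * varianceConst C V + s * crossConst C V q))
        + (√η * √(4 * (s * varianceConst C V)) + s * crossConst C V q) := by
  have hV0 : 0 ≤ V := (integral_nonneg fun e => sq_nonneg _).trans (hV 0)
  have hR0 : 0 ≤ R := (integral_nonneg fun e => sq_nonneg _).trans (hR 0)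
  have hs0 : 0 ≤ s := (Finset.sum_nonneg fun i _ => sq_nonneg _).trans hs
  have hBV := varianceConst_nonneg hC hV0
  have hBR := varianceConst_nonneg hC hR0
  have hX := crossConst_nonneg (V := V) hC q
  have hlc := abs_clip_sub_clip_le K
  have hlr := abs_sub_clip_sub_le K
  have hVc : ∀ i, ∫ e, clip K (ξ i e) ^ 2 ∂μ ≤ V := fun i => by
    refine le_trans ?_ (hV i)
    refine integral_mono (memLp_comp_of_abs_sub_le hξm hξ hlc i).integrable_sq
      (hξ i).integrable_sq fun e => ?_
    exact sq_le_sq.2 (abs_clip_le_abs hK _)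
  -- The offset is adapted to the weights: the gaps then carry at most the fraction `q / (p + q)` of
  -- `∑ a_i²`, however uneven the weights are.
  obtain ⟨u, hu⟩ := exists_offset_sum_gaps_le A (w := fun i => a i ^ 2) (fun i => sq_nonneg _) (q := q) hp
  set Abig := A.filter (fun i => (i + u) % ((p + q : ℕ) : ℤ) < p) with hAbig
  set Asm := A.filter (fun i => ¬ (i + u) % ((p + q : ℕ) : ℤ) < p) with hAsm
  set β : ℤ → ℤ := fun i => (i + u) / ((p + q : ℕ) : ℤ) with hβdef
  have hbigA : ∀ i ∈ Abig, i ∈ A := fun i hi => (Finset.mem_filter.1 hi).1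
  have hbigp : ∀ i ∈ Abig, (i + u) % ((p + q : ℕ) : ℤ) < p := fun i hi =>
    (Finset.mem_filter.1 hi).2
  have hβ : ∀ i ∈ Abig, ∀ k ∈ Abig, β i < β k → i + q ≤ k := fun i hi k _ hik =>
    add_le_of_ediv_lt_ediv (hbigp i hi) hik
  have hsbig : ∑ i ∈ Abig, a i ^ 2 ≤ s :=
    (Finset.sum_le_sum_of_subset_of_nonneg (Finset.filter_subset _ _)
      fun i _ _ => sq_nonneg _).trans hs
  set Y : E → ℝ := fun e => ∑ i ∈ A, a i * ξ i e with hY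
  set Yb : E → ℝ := fun e => ∑ i ∈ Abig, a i * centered μ ξ (clip K) i e with hYb
  set Ys : E → ℝ := fun e => ∑ i ∈ Asm, a i * centered μ ξ (clip K) i e with hYs
  set Yr : E → ℝ := fun e => ∑ i ∈ A, a i * centered μ ξ (fun x => x - clip K x) i e with hYr
  have memsum : ∀ {h : ℝ → ℝ}, (∀ x y, |h x - h y| ≤ |x - y|) → ∀ J : Finset ℤ,
      MemLp (fun e => ∑ i ∈ J, a i * centered μ ξ h i e) 2 μ := fun {h} hh J =>
    memLp_finsetSum (f := fun i e => a i * centered μ ξ h i e) _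
      fun i _ => (memLp_centered hξm hξ hh i).const_mul _
  have hYm : Measurable Y := Finset.measurable_fun_sum _ fun i _ => (hξm i).const_mul _
  have hYb2 : MemLp Yb 2 μ := memsum hlc _
  have hYs2 : MemLp Ys 2 μ := memsum hlc _
  have hYr2 : MemLp Yr 2 μ := memsum hlr _
  have hYbm : Measurable Yb := measurable_sum_centered hξm hlc _ _
  have hξsplit : ∀ i e, ξ i e
      = centered μ ξ (clip K) i e + centered μ ξ (fun x => x - clip K x) i e := fun i e => by
    have h1 : ∫ e', (ξ i e' - clip K (ξ i e')) ∂μ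
        = ∫ e', ξ i e' ∂μ - ∫ e', clip K (ξ i e') ∂μ :=
      integral_sub ((hξ i).integrable one_le_two)
        ((memLp_comp_of_abs_sub_le hξm hξ hlc i).integrable one_le_two)
    unfold centered
    rw [h1, hξ0]
    ring
  have hYsplit : ∀ e, Y e = Yb e + (Yr e + Ys e) := fun e => by
    have h1 : Yb e + Ys e = ∑ i ∈ A, a i * centered μ ξ (clip K) i e :=
      Finset.sum_filter_add_sum_filter_not A _ _
    have h2 : Y e = ∑ i ∈ A, a i * centered μ ξ (clip K) i e + Yr e := by
      simp only [hY, hYr, ← Finset.sum_add_distrib, ← mul_add]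
      exact Finset.sum_congr rfl fun i _ => by rw [← hξsplit]
    rw [h2, ← h1]
    ring
  have hY2 : MemLp Y 2 μ := by
    have : Y = fun e => Yb e + (Yr e + Ys e) := funext hYsplit
    rw [this]
    exact hYb2.add (hYr2.add hYs2)
  have hvar : ∀ {h : ℝ → ℝ} {W : ℝ}, (∀ x y, |h x - h y| ≤ |x - y|) →
      (∀ i, ∫ e, h (ξ i e) ^ 2 ∂μ ≤ W) → ∀ (J : Finset ℤ) {r : ℝ}, ∑ i ∈ J, a i ^ 2 ≤ r →
      ∫ e, (∑ i ∈ J, a i * centered μ ξ h i e) ^ 2 ∂μ ≤ r * varianceConst C W :=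
    fun {h W} hh hW J r hr => by
      have hW0 : 0 ≤ W := (integral_nonneg fun e => sq_nonneg _).trans (hW 0)
      exact (hw.integral_sum_sq_le hC hξm hξ hh hW J a).trans
        (mul_le_mul_of_nonneg_right hr (varianceConst_nonneg hC hW0))
  have hYr3 : ∫ e, Yr e ^ 2 ∂μ ≤ s * varianceConst C R := hvar hlr hR A hs
  have hYs3 : ∫ e, Ys e ^ 2 ∂μ ≤ (q : ℝ) / ((p + q : ℕ) : ℝ) * s * varianceConst C V :=
    hvar hlc hVc Asm (hu.trans (mul_le_mul_of_nonneg_left hs (by positivity)))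
  have hYb3 : ∫ e, Yb e ^ 2 ∂μ ≤ s * varianceConst C V := hvar hlc hVc Abig hsbig
  have hY3 : ∫ e, Y e ^ 2 ∂μ ≤ s * varianceConst C V := by
    have h1 := hvar (h := fun x => x) (fun x y => le_rfl) hV A hs
    have h2 : ∀ e, ∑ i ∈ A, a i * centered μ ξ (fun x => x) i e = Y e := fun e =>
      Finset.sum_congr rfl fun i _ => by simp [centered, hξ0]
    simpa only [h2] using h1
  have hD : ∫ e, (Y e - Yb e) ^ 2 ∂μ ≤ η := by
    have h1 : ∀ e, Y e - Yb e = Yr e + Ys e := fun e => by rw [hYsplit]; ring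
    simp_rw [h1]
    refine (integral_add_sq_le hYr2 hYs2).trans (le_trans ?_ hη)
    gcongr
  have hDs : √(∫ e, (Y e - Yb e) ^ 2 ∂μ) ≤ √η := Real.sqrt_le_sqrt hD
  set v := ∑ b ∈ Abig.image β,
    ∫ e, (∑ i ∈ Abig with β i = b, a i * centered μ ξ (clip K) i e) ^ 2 ∂μ with hv
  have hv0 : 0 ≤ v := Finset.sum_nonneg fun b _ => integral_nonneg fun e => sq_nonneg _
  have hcross : |∫ e, Yb e ^ 2 ∂μ - v| ≤ s * crossConst C V q :=
    (hw.abs_integral_sum_sq_sub_blocks_le hC hξm hξ hlc hVc a hq hβ).trans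
      (mul_le_mul_of_nonneg_right hsbig hX)
  have hvle : v ≤ s * varianceConst C V + s * crossConst C V q := by
    have := (abs_le.1 hcross).1
    linarith
  have hblock : ∀ b ∈ Abig.image β, ∀ e,
      |∑ i ∈ Abig with β i = b, a i * centered μ ξ (clip K) i e| ≤ p * (m * (2 * K)) := by
    intro b _ e
    refine (Finset.abs_sum_le_sum_abs _ _).trans ?_
    refine (Finset.sum_le_card_nsmul _ _ (m * (2 * K)) fun i hi => ?_).trans ?_
    · rw [abs_mul]
      refine mul_le_mul (ha i (hbigA i (Finset.mem_filter.1 hi).1)) ?_ (abs_nonneg _) hm.le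
      -- The factor `2 * K` comes from the truncated variable and its mean, each bounded by `K`.
      have h1 : |∫ e', clip K (ξ i e') ∂μ| ≤ K := by
        have := norm_integral_le_of_norm_le_const (μ := μ) (f := fun e' => clip K (ξ i e'))
          (C := K) (ae_of_all _ fun e' => abs_clip_le hK _)
        simpa using this
      unfold centered
      refine (abs_sub _ _).trans ?_
      linarith [abs_clip_le hK (ξ i e)]
    · rw [nsmul_eq_mul]
      refine mul_le_mul_of_nonneg_right ?_ (by positivity)
      exact_mod_cast card_filter_ediv_eq_le hp hbigp
  have main := hw.norm_charFun_sub_exp_le hC hξm hξ hlc hm (fun i hi => ha i (hbigA i hi)) hq hβ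
    hδ hblock
  rw [← hv] at main
  have hcard : (Abig.card : ℝ) ≤ A.card := by
    exact_mod_cast Finset.card_le_card (Finset.filter_subset _ _)
  have hstep1 := norm_integral_cexp_sub_le hYm hYbm hY2 hYb2
  set w := ∫ e, Y e ^ 2 ∂μ with hwdef
  have hw0 : 0 ≤ w := integral_nonneg fun e => sq_nonneg _
  -- Write `Y² - Yb² = (Y - Yb)(Y + Yb)` and apply Cauchy–Schwarz.
  have hdiff : |∫ e, Y e ^ 2 ∂μ - ∫ e, Yb e ^ 2 ∂μ| ≤ √η * √(4 * (s * varianceConst C V)) := by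
    have h1 : ∫ e, Y e ^ 2 ∂μ - ∫ e, Yb e ^ 2 ∂μ = ∫ e, (Y e - Yb e) * (Y e + Yb e) ∂μ := by
      rw [← integral_sub hY2.integrable_sq hYb2.integrable_sq]
      exact integral_congr_ae (ae_of_all _ fun e => by ring)
    rw [h1]
    refine (abs_integral_mul_le_sqrt_mul_sqrt (hY2.sub hYb2) (hY2.add hYb2)).trans ?_
    refine mul_le_mul hDs (Real.sqrt_le_sqrt ?_) (Real.sqrt_nonneg _) (Real.sqrt_nonneg _)
    refine (integral_add_sq_le hY2 hYb2).trans ?_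
    linarith
  have hstep3 : ‖Complex.exp (((-v / 2 : ℝ) : ℂ)) - Complex.exp (((-w / 2 : ℝ) : ℂ))‖
      ≤ √η * √(4 * (s * varianceConst C V)) + s * crossConst C V q := by
    rw [← Complex.ofReal_exp, ← Complex.ofReal_exp, ← Complex.ofReal_sub, Complex.norm_real,
      Real.norm_eq_abs]
    refine (abs_exp_neg_half_sub_le hv0 hw0).trans ?_
    rw [abs_sub_comm]
    exact (abs_sub_le _ (∫ e, Yb e ^ 2 ∂μ) _).trans (add_le_add hdiff hcross)
  have hstep2 : ‖∫ e, Complex.exp (Yb e * Complex.I) ∂μ - Complex.exp (((-v / 2 : ℝ) : ℂ))‖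
      ≤ 4 * (m * (A.card * (C * (q : ℝ) ^ (-(3 / 2) : ℝ))))
        + p * (m * (2 * K)) * (s * varianceConst C V + s * crossConst C V q) := by
    refine main.trans ?_
    gcongr
  have t1 := norm_sub_le_norm_sub_add_norm_sub (∫ e, Complex.exp (Y e * Complex.I) ∂μ)
    (∫ e, Complex.exp (Yb e * Complex.I) ∂μ) (Complex.exp (((-w / 2 : ℝ) : ℂ)))
  have t2 := norm_sub_le_norm_sub_add_norm_sub (∫ e, Complex.exp (Yb e * Complex.I) ∂μ)
    (Complex.exp (((-v / 2 : ℝ) : ℂ))) (Complex.exp (((-w / 2 : ℝ) : ℂ)))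
  refine t1.trans ?_
  linarith

end Approximation

/-! ### Occupation counts and pair counts of a sequence. -/

/-- The number of visits of `z` by the sequence `s` up to time `n`. -/
def visits (s : ℕ → ℤ) (n : ℕ) (z : ℤ) : ℕ :=
  ((Finset.range (n + 1)).filter (fun k => s k = z)).card

/-- The number of pairs of times up to `n` at which `s` has difference `y`. -/
def pairCount (s : ℕ → ℤ) (n : ℕ) (y : ℤ) : ℕ :=
  ((Finset.range (n + 1) ×ˢ Finset.range (n + 1)).filter (fun x => s x.1 - s x.2 = y)).card

section Counting

variable (s : ℕ → ℤ) (n : ℕ)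

theorem sum_comp_eq_sum_visits (F : ℤ → ℝ) :
    ∑ k ∈ Finset.range (n + 1), F (s k)
      = ∑ z ∈ (Finset.range (n + 1)).image s, (visits s n z : ℝ) * F z := by
  rw [Finset.sum_comp F s]
  simp [visits]

theorem sum_sum_sub_eq_tsum_pairCount (c : ℤ → ℝ) :
    ∑ k ∈ Finset.range (n + 1), ∑ l ∈ Finset.range (n + 1), c (s k - s l)
      = ∑' y, c y * pairCount s n y := by
  rw [← Finset.sum_product' (f := fun k l => c (s k - s l)),
    Finset.sum_comp c (fun x : ℕ × ℕ => s x.1 - s x.2), tsum_eq_sum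
      (s := (Finset.range (n + 1) ×ˢ Finset.range (n + 1)).image (fun x => s x.1 - s x.2))]
  · refine Finset.sum_congr rfl fun y _ => ?_
    rw [nsmul_eq_mul, mul_comm]
    rfl
  · intro y hy
    have : pairCount s n y = 0 := by
      rw [pairCount, Finset.card_eq_zero, Finset.filter_eq_empty_iff]
      intro x hx hxy
      exact hy (Finset.mem_image.2 ⟨x, hx, hxy⟩)
    rw [this]
    simp

theorem pairCount_eq_sum (y : ℤ) :
    (pairCount s n y : ℝ) = ∑ z ∈ (Finset.range (n + 1)).image s,
      ∑ z' ∈ (Finset.range (n + 1)).image s,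
        (visits s n z : ℝ) * visits s n z' * (if z - z' = y then 1 else 0) := by
  have h1 : (pairCount s n y : ℝ) = ∑ k ∈ Finset.range (n + 1), ∑ l ∈ Finset.range (n + 1),
      (if s k - s l = y then (1 : ℝ) else 0) := by
    rw [pairCount, Finset.card_filter, Nat.cast_sum,
      Finset.sum_product' (f := fun k l => (((if s k - s l = y then 1 else 0 : ℕ)) : ℝ))]
    simp
  have h2 : ∀ k, ∑ l ∈ Finset.range (n + 1), (if s k - s l = y then (1 : ℝ) else 0)
      = ∑ z' ∈ (Finset.range (n + 1)).image s,
        (visits s n z' : ℝ) * (if s k - z' = y then 1 else 0) := fun k =>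
    sum_comp_eq_sum_visits s n (fun z' => if s k - z' = y then (1 : ℝ) else 0)
  rw [h1]
  simp_rw [h2]
  rw [sum_comp_eq_sum_visits s n (fun z => ∑ z' ∈ (Finset.range (n + 1)).image s,
        (visits s n z' : ℝ) * (if z - z' = y then 1 else 0))]
  refine Finset.sum_congr rfl fun z _ => ?_
  rw [Finset.mul_sum]
  exact Finset.sum_congr rfl fun z' _ => by ring

theorem sum_visits_sq : ∑ z ∈ (Finset.range (n + 1)).image s, (visits s n z : ℝ) ^ 2
    = pairCount s n 0 := by
  rw [pairCount_eq_sum]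
  refine Finset.sum_congr rfl fun z hz => ?_
  rw [Finset.sum_eq_single z (fun z' _ hz' => by
    rw [if_neg (fun h => hz' (sub_eq_zero.1 h).symm), mul_zero]) (fun h => absurd hz h)]
  simp [sq]

/-- The pair count is a correlation of the visit counts at lag `y`, so the Schur test with kernel
`1_{x=y}` bounds it by the sum of squared visits. This supplies the domination for the limit of the
variance. -/
theorem pairCount_le_pairCount_zero (y : ℤ) : (pairCount s n y : ℝ) ≤ pairCount s n 0 := by
  have h1 : HasSum (fun x : ℤ => if x = y then (1 : ℝ) else 0) 1 := hasSum_ite_eq y 1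
  have := abs_sum_sum_mul_le_of_abs_le (A := (Finset.range (n + 1)).image s)
    (a := fun z => (visits s n z : ℝ)) (d := fun z z' => if z - z' = y then 1 else 0)
    (fun x => by split_ifs <;> norm_num) h1.summable (fun i _ k _ => by split_ifs <;> simp)
  rw [h1.tsum_eq, mul_one, sum_visits_sq, ← pairCount_eq_sum] at this
  exact (le_abs_self _).trans this

end Counting

/-! ### Choice of block, gap and truncation sizes. -/

theorem tendsto_natCast_rpow_neg {b : ℝ} (hb : 0 < b) :
    Tendsto (fun n : ℕ => (n : ℝ) ^ (-b)) atTop (𝓝 0) :=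
  (tendsto_rpow_neg_atTop hb).comp tendsto_natCast_atTop_atTop

theorem natCeil_rpow_le {n : ℕ} (hn : 1 ≤ n) {b : ℝ} (hb : 0 ≤ b) :
    (⌈(n : ℝ) ^ b⌉₊ : ℝ) ≤ 2 * (n : ℝ) ^ b := by
  have h1 : (1 : ℝ) ≤ (n : ℝ) ^ b := Real.one_le_rpow (by exact_mod_cast hn) hb
  have := (Nat.ceil_lt_add_one (by positivity : 0 ≤ (n : ℝ) ^ b)).le
  linarith

theorem tendsto_zero_of_le_const_mul_rpow {f : ℕ → ℝ} {M b : ℝ} (hb : 0 < b) (h0 : ∀ n, 0 ≤ f n)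
    (h : ∀ n : ℕ, 1 ≤ n → f n ≤ M * (n : ℝ) ^ (-b)) : Tendsto f atTop (𝓝 0) := by
  refine squeeze_zero' (Eventually.of_forall h0)
    ((eventually_ge_atTop 1).mono h) ?_
  simpa using (tendsto_natCast_rpow_neg hb).const_mul M

section Parameters

/-- Length of the big blocks. -/
noncomputable def blockLength (n : ℕ) : ℕ := ⌈(n : ℝ) ^ (9 / 20 : ℝ)⌉₊

/-- Length of the gaps between big blocks. -/
noncomputable def gapLength (n : ℕ) : ℕ := ⌈(n : ℝ) ^ (2 / 5 : ℝ)⌉₊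

theorem one_le_blockLength {n : ℕ} (hn : 1 ≤ n) : 1 ≤ blockLength n :=
  Nat.one_le_ceil_iff.2 (Real.rpow_pos_of_pos (by exact_mod_cast hn) _)

theorem one_le_gapLength {n : ℕ} (hn : 1 ≤ n) : 1 ≤ gapLength n :=
  Nat.one_le_ceil_iff.2 (Real.rpow_pos_of_pos (by exact_mod_cast hn) _)

theorem gapLength_rpow_neg_le {n : ℕ} (hn : 1 ≤ n) {b : ℝ} (hb : 0 ≤ b) :
    (gapLength n : ℝ) ^ (-b) ≤ (n : ℝ) ^ (-(2 / 5 * b)) := by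
  have hn0 : (0 : ℝ) < n := by exact_mod_cast hn
  rw [← mul_neg, Real.rpow_mul hn0.le]
  exact Real.rpow_le_rpow_of_nonpos (Real.rpow_pos_of_pos hn0 _) (Nat.le_ceil _) (by linarith)

theorem inv_sqrt_eq_rpow (n : ℕ) : (√(n : ℝ))⁻¹ = (n : ℝ) ^ (-(1 / 2) : ℝ) := by
  rw [Real.sqrt_eq_rpow, Real.rpow_neg (Nat.cast_nonneg n)]

/-- Uniform bound on one block sum: length times weight times `2K`. The exponent is `9/20 + 1/100 -
1/2 + 1/100 = -3/100`, so the blocks must be shorter than `√n`. -/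
theorem tendsto_blockLength_mul {D : ℝ} (hD : 0 ≤ D) :
    Tendsto (fun n : ℕ => (blockLength n : ℝ) * ((D * (n : ℝ) ^ (1 / 100 : ℝ) * (√(n : ℝ))⁻¹)
      * (2 * (n : ℝ) ^ (1 / 100 : ℝ)))) atTop (𝓝 0) := by
  refine tendsto_zero_of_le_const_mul_rpow (M := 4 * D) (b := 3 / 100) (by norm_num)
    (fun n => by positivity) fun n hn => ?_
  have hn0 : (0 : ℝ) < n := by exact_mod_cast hn
  rw [inv_sqrt_eq_rpow]
  calc _ ≤ 2 * (n : ℝ) ^ (9 / 20 : ℝ) * ((D * (n : ℝ) ^ (1 / 100 : ℝ) * (n : ℝ) ^ (-(1 / 2) : ℝ))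
      * (2 * (n : ℝ) ^ (1 / 100 : ℝ))) := by
        gcongr
        exact natCeil_rpow_le hn (by norm_num)
    _ = 4 * D * ((n : ℝ) ^ (9 / 20 : ℝ) * (n : ℝ) ^ (1 / 100 : ℝ) * (n : ℝ) ^ (-(1 / 2) : ℝ)
      * (n : ℝ) ^ (1 / 100 : ℝ)) := by ring
    _ = 4 * D * (n : ℝ) ^ (-(3 / 100) : ℝ) := by
        rw [← Real.rpow_add hn0, ← Real.rpow_add hn0, ← Real.rpow_add hn0]
        norm_num

/-- The exponent is `1/100 - 1/2 + 1 - (3/2)(2/5) = -9/100`. With rate `q^{-3/2}` and about `n`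
sites, the gaps must be longer than `n^{1/3}`; the value `2/5` lies between this and the block
exponent. -/
theorem tendsto_factorization_error {C D : ℝ} (hC : 0 ≤ C) (hD : 0 ≤ D) {N : ℕ → ℕ}
    (hN : ∀ n, N n ≤ n + 1) :
    Tendsto (fun n : ℕ => (D * (n : ℝ) ^ (1 / 100 : ℝ) * (√(n : ℝ))⁻¹)
      * (N n * (C * (gapLength n : ℝ) ^ (-(3 / 2) : ℝ)))) atTop (𝓝 0) := by
  refine tendsto_zero_of_le_const_mul_rpow (M := 2 * D * C) (b := 9 / 100) (by norm_num)
    (fun n => by positivity) fun n hn => ?_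
  have hn0 : (0 : ℝ) < n := by exact_mod_cast hn
  have hN' : (N n : ℝ) ≤ 2 * (n : ℝ) ^ (1 : ℝ) := by
    have h1 : (N n : ℝ) ≤ n + 1 := by exact_mod_cast hN n
    have h2 : (1 : ℝ) ≤ n := by exact_mod_cast hn
    rw [Real.rpow_one]
    linarith
  have hg := gapLength_rpow_neg_le hn (b := 3 / 2) (by norm_num)
  rw [inv_sqrt_eq_rpow]
  calc _ ≤ (D * (n : ℝ) ^ (1 / 100 : ℝ) * (n : ℝ) ^ (-(1 / 2) : ℝ))
      * (2 * (n : ℝ) ^ (1 : ℝ) * (C * (n : ℝ) ^ (-(2 / 5 * (3 / 2)) : ℝ))) := by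
        gcongr
    _ = 2 * D * C * ((n : ℝ) ^ (1 / 100 : ℝ) * (n : ℝ) ^ (-(1 / 2) : ℝ) * (n : ℝ) ^ (1 : ℝ)
      * (n : ℝ) ^ (-(2 / 5 * (3 / 2)) : ℝ)) := by ring
    _ = 2 * D * C * (n : ℝ) ^ (-(9 / 100) : ℝ) := by
        rw [← Real.rpow_add hn0, ← Real.rpow_add hn0, ← Real.rpow_add hn0]
        norm_num

theorem tendsto_gapLength_div : Tendsto (fun n : ℕ => (gapLength n : ℝ)
    / ((blockLength n + gapLength n : ℕ) : ℝ)) atTop (𝓝 0) := by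
  refine tendsto_zero_of_le_const_mul_rpow (M := 2) (b := 1 / 20) (by norm_num)
    (fun n => by positivity) fun n hn => ?_
  have hn0 : (0 : ℝ) < n := by exact_mod_cast hn
  have hp : (0 : ℝ) < (n : ℝ) ^ (9 / 20 : ℝ) := Real.rpow_pos_of_pos hn0 _
  calc _ ≤ (2 * (n : ℝ) ^ (2 / 5 : ℝ)) / (n : ℝ) ^ (9 / 20 : ℝ) := by
        gcongr
        · exact natCeil_rpow_le hn (by norm_num)
        · push_cast
          have : (n : ℝ) ^ (9 / 20 : ℝ) ≤ blockLength n := Nat.le_ceil _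
          have : (0 : ℝ) ≤ gapLength n := by positivity
          linarith
    _ = _ := by
        rw [mul_div_assoc, ← Real.rpow_sub hn0]
        norm_num

theorem tendsto_crossConst {C V : ℝ} (hC : 0 ≤ C) :
    Tendsto (fun n => crossConst C V (gapLength n)) atTop (𝓝 0) := by
  set S := ∑' x : ℤ, |(x : ℝ)| ^ (-(5 / 4) : ℝ)
  have hS : 0 ≤ S := tsum_nonneg fun x => by positivity
  refine tendsto_zero_of_le_const_mul_rpow (M := √V * C * S) (b := 1 / 10) (by norm_num)
    (fun n => crossConst_nonneg hC _) fun n hn => ?_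
  have := gapLength_rpow_neg_le hn (b := 1 / 4) (by norm_num)
  unfold crossConst
  calc _ ≤ √V * (C * ((n : ℝ) ^ (-(2 / 5 * (1 / 4)) : ℝ) * S)) := by gcongr
    _ = _ := by norm_num; ring

end Parameters

/-! ### Central limit theorem along a deterministic sequence. -/

theorem integral_sum_sampled_sq {E : Type*} [MeasurableSpace E] {μ : Measure E} {ξ : ℤ → E → ℝ}
    {c : ℤ → ℝ} {s : ℕ → ℤ} (hξ : ∀ i, MemLp (ξ i) 2 μ)
    (hc : ∀ i k, ∫ e, ξ i e * ξ k e ∂μ = c (i - k)) (n : ℕ) :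
    ∫ e, (∑ k ∈ Finset.range (n + 1), ξ (s k) e) ^ 2 ∂μ = ∑' y, c y * pairCount s n y := by
  have hint : ∀ i k, Integrable (fun e => ξ i e * ξ k e) μ :=
    fun i k => (hξ i).integrable_mul (hξ k)
  rw [← sum_sum_sub_eq_tsum_pairCount]
  simp_rw [sq, Finset.sum_mul_sum]
  rw [integral_finsetSum _ fun i _ => integrable_finsetSum _ fun k _ => hint _ _]
  refine Finset.sum_congr rfl fun i _ => ?_
  rw [integral_finsetSum _ fun k _ => hint _ _]
  exact Finset.sum_congr rfl fun k _ => hc _ _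

theorem tendsto_integral_sub_clip_sq {E : Type*} [MeasurableSpace E] {μ : Measure E} {Z : E → ℝ} (hZm : Measurable Z) (hZ : MemLp Z 2 μ)
    {K : ℕ → ℝ} (hK0 : ∀ n, 0 ≤ K n) (hK : Tendsto K atTop atTop) :
    Tendsto (fun n => ∫ e, (Z e - clip (K n) (Z e)) ^ 2 ∂μ) atTop (𝓝 0) := by
  have h0 : (0 : ℝ) = ∫ _ : E, (0 : ℝ) ∂μ := by simp
  rw [h0]
  refine tendsto_integral_of_dominated_convergence (fun e => Z e ^ 2) (fun n => ?_)
    hZ.integrable_sq (fun n => ae_of_all _ fun e => ?_) (ae_of_all _ fun e => ?_)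
  · exact (((measurable_of_abs_sub_le (abs_sub_clip_sub_le (K n))).comp hZm).pow_const
      2).aestronglyMeasurable
  · rw [Real.norm_eq_abs, abs_of_nonneg (sq_nonneg _)]
    exact sq_le_sq.2 (abs_sub_clip_le_abs (hK0 n) _)
  · refine tendsto_const_nhds.congr' ?_
    filter_upwards [hK.eventually_ge_atTop |Z e|] with n hn
    rw [clip_eq_self hn]
    simp

theorem exists_pairCount_le {s : ℕ → ℤ} {γ : ℤ → ℝ} (hpair : Tendsto (fun n : ℕ => (pairCount s n 0 : ℝ) / n) atTop
    (𝓝 (γ 0))) : ∃ B : ℝ, ∀ n : ℕ, (pairCount s n 0 : ℝ) / n ≤ B :=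
  hpair.bddAbove_range.imp fun _ hB n => hB (Set.mem_range_self n)

/-- Dominated convergence: every normalised pair count is at most the one at `0`, which is bounded
because it converges. -/
theorem tendsto_tsum_autocov_pairCount {c γ : ℤ → ℝ} {s : ℕ → ℤ} (hcs : Summable fun x => |c x|)
    (hpair : ∀ y, Tendsto (fun n : ℕ => (pairCount s n y : ℝ) / n) atTop (𝓝 (γ y))) :
    Tendsto (fun n : ℕ => (∑' y, c y * pairCount s n y) / n) atTop (𝓝 (∑' y, c y * γ y)) := by
  obtain ⟨B, hB⟩ := exists_pairCount_le (hpair 0)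
  have h1 : ∀ n : ℕ, (∑' y, c y * pairCount s n y) / n = ∑' y, c y * ((pairCount s n y : ℝ) / n) :=
    fun n => by
      rw [← tsum_div_const]
      exact tsum_congr fun y => mul_div_assoc _ _ _
  simp_rw [h1]
  refine tendsto_tsum_of_dominated_convergence (bound := fun y => |c y| * B)
    (hcs.mul_right B) (fun y => (hpair y).const_mul _) (Eventually.of_forall fun n y => ?_)
  rw [norm_mul, Real.norm_eq_abs, Real.norm_eq_abs,
    abs_of_nonneg (by positivity : (0 : ℝ) ≤ (pairCount s n y : ℝ) / n)]
  gcongr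
  refine le_trans ?_ (hB n)
  gcongr
  exact_mod_cast pairCount_le_pairCount_zero s n y

section Sampled

variable {E : Type*} [MeasurableSpace E] {μ : Measure E} [IsProbabilityMeasure μ]
  {ξ : ℤ → E → ℝ} {C : ℝ} {c γ : ℤ → ℝ} {s : ℕ → ℤ}

theorem WeaklyDependent.summable_abs_autocov (hw : WeaklyDependent μ ξ C) (hC : 0 ≤ C)
    (hξm : ∀ i, Measurable (ξ i)) (hξ : ∀ i, MemLp (ξ i) 2 μ)
    (hξ0 : ∀ i, ∫ e, ξ i e ∂μ = 0) {V : ℝ} (hV : ∀ i, ∫ e, ξ i e ^ 2 ∂μ ≤ V)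
    (hc : ∀ i k, ∫ e, ξ i e * ξ k e ∂μ = c (i - k)) : Summable fun x => |c x| := by
  have hsum : Summable fun x : ℤ => (if x = 0 then |c 0| else 0)
      + √V * (C * |(x : ℝ)| ^ (-(3 / 2) : ℝ)) :=
    (hasSum_ite_eq 0 |c 0|).summable.add
      ((summable_abs_int_rpow_three_halves.mul_left C).mul_left _)
  refine hsum.of_nonneg_of_le (fun x => abs_nonneg _) fun x => ?_
  rcases eq_or_ne x 0 with rfl | hx
  · rw [if_pos rfl]
    exact le_add_of_nonneg_right (by positivity)
  · rw [if_neg hx, zero_add]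
    have := hw.abs_integral_centered_mul_le hC hξm hξ (h := fun x => x) (fun x y => le_rfl) hV hx
    simpa [centered, hξ0, hc] using this

/-- Convergence of the characteristic functions of a weakly dependent stationary process sampled
along a sequence with few self-intersections. -/
theorem WeaklyDependent.tendsto_charFun_sampled (hw : WeaklyDependent μ ξ C) (hC : 0 ≤ C)
    (hξm : ∀ i, Measurable (ξ i)) (hξ : MemLp (ξ 0) 2 μ)
    (hid : ∀ i, IdentDistrib (ξ i) (ξ 0) μ μ) (hξ0 : ∫ e, ξ 0 e ∂μ = 0)
    (hc : ∀ i k, ∫ e, ξ i e * ξ k e ∂μ = c (i - k))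
    (hpair : ∀ y, Tendsto (fun n : ℕ => (pairCount s n y : ℝ) / n) atTop (𝓝 (γ y)))
    {D : ℝ} (hD : 0 < D)
    (hvis : ∀ n : ℕ, 1 ≤ n → ∀ z, (visits s n z : ℝ) ≤ D * (n : ℝ) ^ (1 / 100 : ℝ)) (t : ℝ) :
    Tendsto (fun n : ℕ => ∫ e, Complex.exp (((t * ((√(n : ℝ))⁻¹
        * ∑ k ∈ Finset.range (n + 1), ξ (s k) e) : ℝ) : ℂ) * Complex.I) ∂μ) atTop
      (𝓝 (Complex.exp (((-(t ^ 2 * ∑' y, c y * γ y) / 2 : ℝ) : ℂ)))) := by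
  have hξ' : ∀ i, MemLp (ξ i) 2 μ := fun i => (hid i).memLp_iff.2 hξ
  have hξ0' : ∀ i, ∫ e, ξ i e ∂μ = 0 := fun i => (hid i).integral_eq.trans hξ0
  have hcomp : ∀ {F : ℝ → ℝ}, Measurable F → ∀ i, ∫ e, F (ξ i e) ∂μ = ∫ e, F (ξ 0 e) ∂μ :=
    fun hF i => ((hid i).comp hF).integral_eq
  set V := ∫ e, ξ 0 e ^ 2 ∂μ with hVdef
  have hV : ∀ i, ∫ e, ξ i e ^ 2 ∂μ ≤ V := fun i => (hcomp (F := fun x => x ^ 2) (by fun_prop) i).le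
  have hcs := hw.summable_abs_autocov hC hξm hξ' hξ0' hV hc
  set K : ℕ → ℝ := fun n => (n : ℝ) ^ (1 / 100 : ℝ) with hKdef
  have hK0 : ∀ n, 0 ≤ K n := fun n => by positivity
  have hK : Tendsto K atTop atTop :=
    (tendsto_rpow_atTop (by norm_num)).comp tendsto_natCast_atTop_atTop
  set R : ℕ → ℝ := fun n => ∫ e, (ξ 0 e - clip (K n) (ξ 0 e)) ^ 2 ∂μ with hRdef
  have hR0 : Tendsto R atTop (𝓝 0) := tendsto_integral_sub_clip_sq (hξm 0) hξ hK0 hK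
  have hR : ∀ n i, ∫ e, (ξ i e - clip (K n) (ξ i e)) ^ 2 ∂μ ≤ R n := fun n i =>
    (hcomp (F := fun x => (x - clip (K n) x) ^ 2)
      ((measurable_of_abs_sub_le (abs_sub_clip_sub_le (K n))).pow_const 2) i).le
  obtain ⟨B, hB⟩ := exists_pairCount_le (hpair 0)
  set A : ℕ → Finset ℤ := fun n => (Finset.range (n + 1)).image s with hA
  set a : ℕ → ℤ → ℝ := fun n z => t * ((√(n : ℝ))⁻¹ * visits s n z) with ha
  -- The added `1` keeps the bound on the weights positive when `t = 0`.
  set D' := (|t| + 1) * D with hD'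
  have hD'0 : 0 < D' := by positivity
  set m : ℕ → ℝ := fun n => D' * (n : ℝ) ^ (1 / 100 : ℝ) * (√(n : ℝ))⁻¹ with hmdef
  set S := t ^ 2 * B with hS
  have hsum : ∀ (n : ℕ) e, t * ((√(n : ℝ))⁻¹ * ∑ k ∈ Finset.range (n + 1), ξ (s k) e)
      = ∑ i ∈ A n, a n i * ξ i e := fun n e => by
    rw [sum_comp_eq_sum_visits s n (fun z => ξ z e), Finset.mul_sum, Finset.mul_sum]
    exact Finset.sum_congr rfl fun z _ => by ring
  -- The sum of squared visits is the pair count at `0`, of order `n`.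
  have haS : ∀ n, ∑ i ∈ A n, a n i ^ 2 ≤ S := fun n => by
    have h1 : ∑ i ∈ A n, a n i ^ 2 = t ^ 2 * ((pairCount s n 0 : ℝ) / n) := by
      rw [← sum_visits_sq, Finset.sum_div, Finset.mul_sum]
      refine Finset.sum_congr rfl fun z _ => ?_
      simp only [ha]
      rw [mul_pow, mul_pow, inv_pow, Real.sq_sqrt (Nat.cast_nonneg n)]
      ring
    rw [h1]
    exact mul_le_mul_of_nonneg_left (hB n) (sq_nonneg t)
  have hB0 : 0 ≤ B := le_trans (by positivity) (hB 0)
  have hS0 : 0 ≤ S := by positivity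
  have ham : ∀ n, 1 ≤ n → ∀ i ∈ A n, |a n i| ≤ m n := fun n hn i _ => by
    have h1 := hvis n hn i
    simp only [ha, hmdef, hD']
    rw [abs_mul, abs_of_nonneg (by positivity : 0 ≤ (√(n : ℝ))⁻¹ * (visits s n i : ℝ))]
    calc |t| * ((√(n : ℝ))⁻¹ * visits s n i)
        ≤ (|t| + 1) * ((√(n : ℝ))⁻¹ * (D * (n : ℝ) ^ (1 / 100 : ℝ))) := by gcongr; linarith
      _ = _ := by ring
  have hcard : ∀ n, (A n).card ≤ n + 1 := fun n =>
    Finset.card_image_le.trans (Finset.card_range _).le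
  have hBV := varianceConst_nonneg hC (integral_nonneg fun e => sq_nonneg _ : 0 ≤ V)
  have hvarR : Tendsto (fun n => varianceConst C (R n)) atTop (𝓝 0) := by
    have h1 : Continuous (varianceConst C) := by
      unfold varianceConst
      fun_prop
    have h2 : varianceConst C 0 = 0 := by simp [varianceConst]
    have := (h1.tendsto 0).comp hR0
    rwa [h2] at this
  set η : ℕ → ℝ := fun n => 2 * (S * varianceConst C (R n)) + 2 * ((gapLength n : ℝ)
    / ((blockLength n + gapLength n : ℕ) : ℝ) * S * varianceConst C V) with hη
  have hη0 : Tendsto η atTop (𝓝 0) := by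
    have := ((hvarR.const_mul S).const_mul 2).add
      (((tendsto_gapLength_div.mul_const S).mul_const (varianceConst C V)).const_mul 2)
    simpa [hη] using this
  have hsη : Tendsto (fun n => √(η n)) atTop (𝓝 0) := by
    have := (Real.continuous_sqrt.tendsto 0).comp hη0
    rw [Real.sqrt_zero] at this
    exact this
  have hδ := tendsto_blockLength_mul hD'0.le
  have hcr := tendsto_crossConst (V := V) hC
  have herr : Tendsto (fun n => √(η n) + (4 * (m n * ((A n).card
      * (C * (gapLength n : ℝ) ^ (-(3 / 2) : ℝ)))) + blockLength n * (m n * (2 * K n))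
      * (S * varianceConst C V + S * crossConst C V (gapLength n)))
      + (√(η n) * √(4 * (S * varianceConst C V)) + S * crossConst C V (gapLength n)))
      atTop (𝓝 0) := by
    have := (hsη.add (((tendsto_factorization_error hC hD'0.le hcard).const_mul 4).add
      (hδ.mul ((hcr.const_mul S).const_add (S * varianceConst C V))))).add
      ((hsη.mul_const √(4 * (S * varianceConst C V))).add (hcr.const_mul S))
    simp only [mul_zero, zero_mul, add_zero] at this
    exact this
  have hmain : Tendsto (fun n : ℕ =>
      ∫ e, Complex.exp (((∑ i ∈ A n, a n i * ξ i e : ℝ) : ℂ) * Complex.I) ∂μ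
      - Complex.exp (((-(∫ e, (∑ i ∈ A n, a n i * ξ i e) ^ 2 ∂μ) / 2 : ℝ) : ℂ))) atTop (𝓝 0) := by
    refine squeeze_zero_norm' ?_ herr
    -- The approximation requires block sums bounded by `1`, which holds for large `n`.
    filter_upwards [eventually_ge_atTop 1, hδ.eventually_le_const zero_lt_one] with n hn hδn
    have hn0 : (0 : ℝ) < n := by exact_mod_cast hn
    exact hw.norm_charFun_sum_sub_exp_variance_le hC hξm hξ' hξ0' hV (hK0 n) (hR n)
      (by positivity) (ham n hn) (one_le_blockLength hn) (one_le_gapLength hn) hδn (haS n) le_rfl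
  have hvar : ∀ n : ℕ, ∫ e, (∑ i ∈ A n, a n i * ξ i e) ^ 2 ∂μ
      = t ^ 2 * ((∑' y, c y * pairCount s n y) / n) := fun n => by
    simp_rw [← hsum, mul_pow]
    rw [integral_const_mul, integral_const_mul, integral_sum_sampled_sq hξ' hc, inv_pow,
      Real.sq_sqrt (Nat.cast_nonneg n)]
    ring
  have hexp : Tendsto (fun n : ℕ =>
      Complex.exp (((-(∫ e, (∑ i ∈ A n, a n i * ξ i e) ^ 2 ∂μ) / 2 : ℝ) : ℂ))) atTop
      (𝓝 (Complex.exp (((-(t ^ 2 * ∑' y, c y * γ y) / 2 : ℝ) : ℂ)))) := by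
    simp_rw [hvar]
    have h1 := ((tendsto_tsum_autocov_pairCount hcs hpair).const_mul (t ^ 2)).neg.div_const 2
    have h2 : Continuous fun x : ℝ => Complex.exp (x : ℂ) := by fun_prop
    exact (h2.tendsto _).comp h1
  simp_rw [hsum]
  simpa using hmain.add hexp

end Sampled

/-! ### Hitting counts of an i.i.d. walk on path space. -/

/-- The partial sum of the first `n` entries of a path. -/
def pathSum (x : ℕ → ℤ) (n : ℕ) : ℤ := ∑ i ∈ Finset.range n, x i

/-- The path with its first `k` entries removed. -/
def shiftBy (k : ℕ) (x : ℕ → ℤ) : ℕ → ℤ := fun i => x (i + k)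

/-- The number of times `1 ≤ m ≤ N` at which the partial sums equal `y`. -/
def hits (x : ℕ → ℤ) (N : ℕ) (y : ℤ) : ℕ :=
  ((Finset.Icc 1 N).filter (fun m => pathSum x m = y)).card

theorem pathSum_add (x : ℕ → ℤ) (k m : ℕ) :
    pathSum x (k + m) = pathSum x k + pathSum (shiftBy k x) m := by
  unfold pathSum shiftBy
  rw [Finset.sum_range_add]
  simp only [add_comm k]

theorem measurable_shiftBy (k : ℕ) : Measurable (shiftBy k) :=
  measurable_pi_lambda _ fun _ => measurable_pi_apply _

theorem shiftBy_shiftBy (j k : ℕ) (x : ℕ → ℤ) : shiftBy j (shiftBy k x) = shiftBy (j + k) x := by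
  funext i
  simp [shiftBy, add_assoc]

/-- `DependsOn` records the finite window of steps that a functional sees. A finite window gives
measurability, and disjoint windows give independence. -/
theorem dependsOn_pathSum (n : ℕ) :
    DependsOn (fun x : ℕ → ℤ => pathSum x n) (Finset.range n : Set ℕ) := fun _ _ h =>
  Finset.sum_congr rfl fun i hi => h i hi

theorem dependsOn_hits (N : ℕ) (y : ℤ) :
    DependsOn (fun x : ℕ → ℤ => hits x N y) (Finset.range N : Set ℕ) := fun x x' h => by
  have : ∀ m ∈ Finset.Icc 1 N, (pathSum x m = y ↔ pathSum x' m = y) := fun m hm => by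
    have h1 : pathSum x m = pathSum x' m := dependsOn_pathSum m fun i hi => h i (by
      have := (Finset.mem_Icc.1 hm).2
      simp only [Finset.coe_range, Set.mem_Iio] at hi ⊢
      omega)
    rw [h1]
  simp only [hits]
  rw [Finset.filter_congr this]

theorem DependsOn.comp_shiftBy {β : Type*} {f : (ℕ → ℤ) → β} {N : ℕ}
    (hf : DependsOn f (Finset.range N : Set ℕ)) (k : ℕ) :
    DependsOn (fun x => f (shiftBy k x)) (Finset.Ico k (k + N) : Set ℕ) := fun x x' h => by
  refine hf fun i hi => h (i + k) ?_
  simp only [Finset.coe_range, Set.mem_Iio] at hi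
  simp only [Finset.coe_Ico, Set.mem_Ico]
  omega

theorem hits_mono (x : ℕ → ℤ) {N N' : ℕ} (h : N ≤ N') (y : ℤ) : hits x N y ≤ hits x N' y :=
  Finset.card_le_card (Finset.filter_subset_filter _ (Finset.Icc_subset_Icc le_rfl h))

theorem hits_le (x : ℕ → ℤ) (N : ℕ) (y : ℤ) : hits x N y ≤ N := by
  refine (Finset.card_filter_le _ _).trans ?_
  simp

/-- Seen from the first hitting time `k`, later hits are returns to `0` of the shifted path; the `+
1` is the hit at `k` itself. -/
theorem hits_le_hits_shiftBy_add_one {x : ℕ → ℤ} {N k : ℕ} {y : ℤ}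
    (hfirst : ∀ m, 1 ≤ m → m < k → pathSum x m ≠ y) (hk : pathSum x k = y) :
    hits x N y ≤ hits (shiftBy k x) N 0 + 1 := by
  have : (Finset.Icc 1 N).filter (fun m => pathSum x m = y)
      ⊆ insert k (((Finset.Icc 1 N).filter (fun m => pathSum (shiftBy k x) m = 0)).image
        (fun m => k + m)) := by
    intro m hm
    simp only [Finset.mem_filter, Finset.mem_Icc] at hm
    rw [Finset.mem_insert]
    rcases lt_trichotomy m k with h | h | h
    · exact absurd hm.2 (hfirst m hm.1.1 h)
    · exact Or.inl h
    · refine Or.inr (Finset.mem_image.2 ⟨m - k, ?_, by omega⟩)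
      have h1 := pathSum_add x k (m - k)
      rw [show k + (m - k) = m by omega, hm.2, hk] at h1
      simp only [Finset.mem_filter, Finset.mem_Icc]
      omega
  exact (Finset.card_le_card this).trans ((Finset.card_insert_le _ _).trans
    (Nat.add_le_add_right Finset.card_image_le 1))

section PathSpace

variable (ν : Measure ℤ) [IsProbabilityMeasure ν]

/-- The law of an i.i.d. sequence of steps with law `ν`. -/
noncomputable abbrev pathLaw : Measure (ℕ → ℤ) := Measure.infinitePi fun _ : ℕ => ν

theorem measurePreserving_shiftBy (k : ℕ) :
    MeasurePreserving (shiftBy k) (pathLaw ν) (pathLaw ν) :=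
  ⟨measurable_shiftBy k, Measure.map_infinitePi_infinitePi_of_inj (P := fun _ : ℕ => ν)
    (f := fun i => i + k) (add_left_injective k)⟩

variable {ν}

theorem DependsOn.exists_factor {β : Type*} [MeasurableSpace β] {f : (ℕ → ℤ) → β} {S : Finset ℕ}
    (hf : DependsOn f (S : Set ℕ)) :
    ∃ g : (S → ℤ) → β, Measurable g ∧ ∀ x, f x = g fun i => x i := by
  classical
  refine ⟨fun z => f fun i => if h : i ∈ S then z ⟨i, h⟩ else 0, .of_discrete, fun x => ?_⟩
  refine hf fun i hi => ?_
  rw [dif_pos (Finset.mem_coe.1 hi)]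

theorem DependsOn.measurable_of_finset {β : Type*} [MeasurableSpace β] {f : (ℕ → ℤ) → β}
    {S : Finset ℕ} (hf : DependsOn f (S : Set ℕ)) : Measurable f := by
  obtain ⟨g, hg, hfg⟩ := hf.exists_factor
  rw [funext hfg]
  exact hg.comp (measurable_pi_lambda _ fun _ => measurable_pi_apply _)

theorem indepFun_of_dependsOn {β β' : Type*} [MeasurableSpace β] [MeasurableSpace β']
    {f : (ℕ → ℤ) → β} {f' : (ℕ → ℤ) → β'} {S S' : Finset ℕ} (hS : Disjoint S S')
    (hf : DependsOn f (S : Set ℕ)) (hf' : DependsOn f' (S' : Set ℕ)) :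
    IndepFun f f' (pathLaw ν) := by
  obtain ⟨g, hg, hfg⟩ := hf.exists_factor
  obtain ⟨g', hg', hfg'⟩ := hf'.exists_factor
  have h := (iIndepFun_infinitePi (P := fun _ : ℕ => ν) (X := fun _ z => z)
    (fun _ => measurable_id)).indepFun_finset S S' hS (fun i => measurable_pi_apply i)
  have := h.comp hg hg'
  rw [funext hfg, funext hfg']
  exact this

/-- The first hitting time of `y` is `k`. -/
def IsFirstHit (x : ℕ → ℤ) (y : ℤ) (k : ℕ) : Prop :=
  pathSum x k = y ∧ ∀ m, 1 ≤ m → m < k → pathSum x m ≠ y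

theorem dependsOn_isFirstHit (y : ℤ) (k : ℕ) :
    DependsOn (fun x : ℕ → ℤ => IsFirstHit x y k) (Finset.range k : Set ℕ) := fun x x' h => by
  have : ∀ m ≤ k, pathSum x m = pathSum x' m := fun m hm => dependsOn_pathSum m fun i hi => h i (by
    simp only [Finset.coe_range, Set.mem_Iio] at hi ⊢
    omega)
  simp only [IsFirstHit, this k le_rfl, eq_iff_iff]
  refine and_congr_right fun _ => forall_congr' fun m => forall_congr' fun _ =>
    forall_congr' fun hm => ?_
  rw [this m hm.le]

theorem exists_isFirstHit {x : ℕ → ℤ} {y : ℤ} {N : ℕ} (h : 1 ≤ hits x N y) :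
    ∃ k ∈ Finset.Icc 1 N, IsFirstHit x y k := by
  obtain ⟨m, hm⟩ := Finset.card_pos.1 h
  simp only [Finset.mem_filter, Finset.mem_Icc] at hm
  classical
  have hex : ∃ m, 1 ≤ m ∧ pathSum x m = y := ⟨m, hm.1.1, hm.2⟩
  have h1 := Nat.find_spec hex
  have h2 := Nat.find_min' hex ⟨hm.1.1, hm.2⟩
  refine ⟨Nat.find hex, Finset.mem_Icc.2 ⟨h1.1, h2.trans hm.1.2⟩, h1.2, fun l hl hlk hly => ?_⟩
  exact Nat.find_min hex hlk ⟨hl, hly⟩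

theorem measurableSet_le_hits (N : ℕ) (y : ℤ) (j : ℕ) :
    MeasurableSet {x : ℕ → ℤ | j ≤ hits x N y} :=
  measurableSet_le measurable_const (dependsOn_hits N y).measurable_of_finset

/-- Strong Markov property by hand. Decompose according to the first hitting time `k`: that event
sees only the first `k` steps, the later returns see only later ones, and the shifted path has the
same law. The first-hit events are disjoint, so their probabilities recombine. -/
theorem measure_le_hits_succ (N : ℕ) (y : ℤ) (j : ℕ) :
    pathLaw ν {x | j + 1 ≤ hits x N y}
      ≤ pathLaw ν {x | 1 ≤ hits x N y} * pathLaw ν {x | j ≤ hits x N 0} := by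
  have hmeas : ∀ k, MeasurableSet {x : ℕ → ℤ | IsFirstHit x y k} := fun k =>
    measurableSet_setOfPred.2 (dependsOn_isFirstHit y k).measurable_of_finset
  have hsub : {x | j + 1 ≤ hits x N y} ⊆ ⋃ k ∈ Finset.Icc 1 N,
      ({x | IsFirstHit x y k} ∩ {x | j ≤ hits (shiftBy k x) N 0}) := by
    intro x hx
    obtain ⟨k, hk, hfk⟩ := exists_isFirstHit (le_trans (by omega) hx)
    refine Set.mem_biUnion hk ⟨hfk, ?_⟩
    have h1 := hits_le_hits_shiftBy_add_one (N := N) hfk.2 hfk.1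
    have h2 : j + 1 ≤ hits x N y := hx
    change j ≤ hits (shiftBy k x) N 0
    omega
  have hind : ∀ k, pathLaw ν ({x | IsFirstHit x y k} ∩ {x | j ≤ hits (shiftBy k x) N 0})
      = pathLaw ν {x | IsFirstHit x y k} * pathLaw ν {x | j ≤ hits x N 0} := fun k => by
    have hdis : Disjoint (Finset.range k) (Finset.Ico k (k + N)) := by
      rw [Finset.disjoint_left]
      intro i hi hi'
      simp only [Finset.mem_range, Finset.mem_Ico] at hi hi'
      omega
    have h1 := indepFun_of_dependsOn (ν := ν) hdis (dependsOn_isFirstHit y k)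
      ((dependsOn_hits N 0).comp_shiftBy k)
    have h2 := h1.measure_inter_preimage_eq_mul {True} {i : ℕ | j ≤ i} .of_discrete .of_discrete
    have h3 : (fun x : ℕ → ℤ => IsFirstHit x y k) ⁻¹' {True} = {x | IsFirstHit x y k} := by
      ext x; simp
    rw [h3] at h2
    refine h2.trans ?_
    congr 1
    exact (measurePreserving_shiftBy ν k).measure_preimage
      (measurableSet_le_hits N 0 j).nullMeasurableSet
  have hdisj : Set.PairwiseDisjoint (Finset.Icc 1 N : Set ℕ)
      fun k => {x : ℕ → ℤ | IsFirstHit x y k} := by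
    intro k hk k' hk' hne
    rw [Function.onFun, Set.disjoint_left]
    intro x hx hx'
    simp only [Finset.coe_Icc, Set.mem_Icc] at hk hk'
    rcases lt_or_gt_of_ne hne with h | h
    · exact hx'.2 k hk.1 h hx.1
    · exact hx.2 k' hk'.1 h hx'.1
  calc pathLaw ν {x | j + 1 ≤ hits x N y}
      ≤ ∑ k ∈ Finset.Icc 1 N, pathLaw ν {x | IsFirstHit x y k} * pathLaw ν {x | j ≤ hits x N 0} := by
        refine (measure_mono hsub).trans ((measure_biUnion_finset_le _ _).trans ?_)
        exact Finset.sum_le_sum fun k _ => (hind k).le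
    _ = pathLaw ν (⋃ k ∈ Finset.Icc 1 N, {x | IsFirstHit x y k})
        * pathLaw ν {x | j ≤ hits x N 0} := by
        rw [← Finset.sum_mul, measure_biUnion_finset hdisj fun k _ => hmeas k]
    _ ≤ _ := by
        gcongr
        refine Set.iUnion₂_subset fun k hk x hx => ?_
        exact Finset.card_pos.2 ⟨k, Finset.mem_filter.2 ⟨hk, hx.1⟩⟩

/-- The probability of a return to the origin. -/
noncomputable def returnProb (ν : Measure ℤ) [IsProbabilityMeasure ν] : ℝ≥0∞ :=
  pathLaw ν {x | ∃ n, 1 ≤ n ∧ pathSum x n = 0}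

theorem measure_le_hits_zero (N j : ℕ) :
    pathLaw ν {x | j ≤ hits x N 0} ≤ returnProb ν ^ j := by
  induction j with
  | zero => simp
  | succ j ih =>
    refine (measure_le_hits_succ N 0 j).trans ?_
    rw [pow_succ']
    gcongr
    refine measure_mono fun x hx => ?_
    obtain ⟨k, hk, hfk⟩ := exists_isFirstHit hx
    exact ⟨k, (Finset.mem_Icc.1 hk).1, hfk.1⟩

theorem measure_exists_le_hits_zero (j : ℕ) :
    pathLaw ν {x | ∃ N, j ≤ hits x N 0} ≤ returnProb ν ^ j := by
  have : {x : ℕ → ℤ | ∃ N, j ≤ hits x N 0} = ⋃ N, {x | j ≤ hits x N 0} := by ext; simp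
  have hmono : Monotone fun N => {x : ℕ → ℤ | j ≤ hits x N 0} := fun N N' h x hx =>
    le_trans (show j ≤ hits x N 0 from hx) (hits_mono x h 0)
  rw [this, hmono.measure_iUnion]
  exact iSup_le fun N => measure_le_hits_zero N j

theorem natCast_hits_eq_sum (x : ℕ → ℤ) (N : ℕ) (y : ℤ) :
    (hits x N y : ℝ≥0∞) = ∑ j ∈ Finset.range N, {x | j + 1 ≤ hits x N y}.indicator 1 x := by
  have h1 : ∀ j, ({x : ℕ → ℤ | j + 1 ≤ hits x N y}.indicator 1 x : ℝ≥0∞)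
      = ((if j < hits x N y then 1 else 0 : ℕ) : ℝ≥0∞) := fun j => by
    simp only [Set.indicator, Set.mem_ofPred_eq, Pi.one_apply, Nat.succ_le_iff]
    split_ifs <;> simp
  simp_rw [h1]
  rw [← Nat.cast_sum, ← Finset.card_filter]
  congr 1
  have : (Finset.range N).filter (fun j => j < hits x N y) = Finset.range (hits x N y) := by
    ext j
    have := hits_le x N y
    simp only [Finset.mem_filter, Finset.mem_range]
    omega
  rw [this, Finset.card_range]

/-- The partial sums are expected hit counts, that is, sums of the tails `P(hits ≥ j + 1)`. The
tails are at most `returnProb ν ^ j`, so a geometric series gives a bound uniform in `y`. -/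
theorem tsum_measure_pathSum_eq_le (y : ℤ) :
    ∑' m, pathLaw ν {x | pathSum x (m + 1) = y} ≤ (1 - returnProb ν)⁻¹ := by
  refine ENNReal.tsum_le_of_sum_range_le fun N => ?_
  have h1 : ∑ m ∈ Finset.range N, pathLaw ν {x | pathSum x (m + 1) = y}
      = ∫⁻ x, (hits x N y : ℝ≥0∞) ∂pathLaw ν := by
    have hm : ∀ m, MeasurableSet {x : ℕ → ℤ | pathSum x (m + 1) = y} := fun m =>
      (dependsOn_pathSum (m + 1)).measurable_of_finset (measurableSet_singleton y)
    simp_rw [← fun m => lintegral_indicator_one (μ := pathLaw ν) (hm m)]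
    rw [← lintegral_finsetSum _ fun m _ => measurable_one.indicator (hm m)]
    refine lintegral_congr fun x => ?_
    simp only [Set.indicator, Set.mem_ofPred_eq, Pi.one_apply]
    rw [hits, Finset.card_filter, Nat.cast_sum, Finset.range_eq_Ico,
      Finset.sum_Ico_add' (fun m => if pathSum x m = y then (1 : ℝ≥0∞) else 0) 0 N 1]
    simp only [zero_add, Nat.cast_ite, Nat.cast_one, Nat.cast_zero]
    rfl
  have h2 : ∫⁻ x, (hits x N y : ℝ≥0∞) ∂pathLaw ν
      = ∑ j ∈ Finset.range N, pathLaw ν {x | j + 1 ≤ hits x N y} := by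
    simp_rw [natCast_hits_eq_sum _ N y]
    rw [lintegral_finsetSum _ fun j _ => measurable_one.indicator (measurableSet_le_hits N y _)]
    exact Finset.sum_congr rfl fun j _ => lintegral_indicator_one (measurableSet_le_hits N y _)
  rw [h1, h2, ← ENNReal.tsum_geometric]
  refine le_trans (Finset.sum_le_sum fun j _ => ?_) (ENNReal.sum_le_tsum _)
  refine (measure_le_hits_succ N y j).trans ?_
  exact (mul_le_of_le_one_left zero_le prob_le_one).trans (measure_le_hits_zero N j)

end PathSpace

/-! ### Almost sure bound on visit counts. -/

theorem summable_pow_natCeil_rpow {r : ℝ} (hr0 : 0 ≤ r) (hr1 : r < 1) :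
    Summable fun k : ℕ => r ^ ⌈(k : ℝ) ^ (1 / 100 : ℝ)⌉₊ := by
  set b := 1 - r with hb
  have hb0 : 0 < b := by linarith
  have h1 : Summable fun k : ℕ => Real.exp (-b * (k : ℝ) ^ (1 / 100 : ℝ)) := by
    -- A stretched exponential beats every power of `k ^ (1/100)`; the power `-200` leaves `k ^
    -- (-2)`.
    have h2 : (fun k : ℕ => Real.exp (-b * (k : ℝ) ^ (1 / 100 : ℝ)))
        =O[atTop] fun k : ℕ => ((k : ℝ) ^ (1 / 100 : ℝ)) ^ (-200 : ℝ) :=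
      ((isLittleO_exp_neg_mul_rpow_atTop hb0 (-200)).comp_tendsto
        ((tendsto_rpow_atTop (by norm_num)).comp tendsto_natCast_atTop_atTop)).isBigO
    refine summable_of_isBigO_nat ?_ h2
    refine (Real.summable_nat_rpow.2 (by norm_num : (-2 : ℝ) < -1)).congr fun k => ?_
    rw [← Real.rpow_mul (Nat.cast_nonneg k)]
    norm_num
  refine h1.of_nonneg_of_le (fun k => by positivity) fun k => ?_
  have h3 : r ≤ Real.exp (-b) := by
    have := Real.add_one_le_exp (-b)
    linarith
  calc r ^ ⌈(k : ℝ) ^ (1 / 100 : ℝ)⌉₊ ≤ Real.exp (-b) ^ ⌈(k : ℝ) ^ (1 / 100 : ℝ)⌉₊ := by gcongr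
    _ = Real.exp (-b * (⌈(k : ℝ) ^ (1 / 100 : ℝ)⌉₊ : ℝ)) := by
        rw [← Real.exp_nat_mul]
        congr 1
        ring
    _ ≤ _ := by
        refine Real.exp_le_exp.2 (mul_le_mul_of_nonpos_left (Nat.le_ceil _) (by linarith))

section Returns

variable {ν : Measure ℤ} [IsProbabilityMeasure ν]

/-- Borel–Cantelli over the starting time `k`, with threshold `k ^ (1/100)`. The finitely many
exceptional `k` are absorbed in `D`, since each shifted path returns only finitely often almost
surely. -/
theorem ae_exists_hits_le (hν : returnProb ν < 1) :
    ∀ᵐ x ∂pathLaw ν, ∃ D : ℝ, 0 < D ∧ ∀ k N : ℕ,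
      (hits (shiftBy k x) N 0 : ℝ) ≤ D + (k : ℝ) ^ (1 / 100 : ℝ) := by
  have hrtop : returnProb ν ≠ ⊤ := (hν.trans ENNReal.one_lt_top).ne
  have hmeas : ∀ j, MeasurableSet {x : ℕ → ℤ | ∃ N, j ≤ hits x N 0} := fun j => by
    have : {x : ℕ → ℤ | ∃ N, j ≤ hits x N 0} = ⋃ N, {x | j ≤ hits x N 0} := by ext; simp
    rw [this]
    exact MeasurableSet.iUnion fun N => measurableSet_le_hits N 0 j
  have hbc : ∀ᵐ x ∂pathLaw ν, ∀ᶠ k : ℕ in atTop,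
      x ∉ {x | ∃ N, ⌈(k : ℝ) ^ (1 / 100 : ℝ)⌉₊ ≤ hits (shiftBy k x) N 0} := by
    refine ae_eventually_notMem (ne_top_of_le_ne_top
      (b := ∑' k : ℕ, returnProb ν ^ ⌈(k : ℝ) ^ (1 / 100 : ℝ)⌉₊) ?_
      (ENNReal.tsum_le_tsum fun k => ?_))
    · have hr1 : (returnProb ν).toReal < 1 := by
        rw [← ENNReal.toReal_one]
        exact (ENNReal.toReal_lt_toReal hrtop ENNReal.one_ne_top).2 hν
      have := (summable_pow_natCeil_rpow ENNReal.toReal_nonneg hr1).tsum_ofReal_ne_top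
      simpa only [ENNReal.ofReal_pow ENNReal.toReal_nonneg, ENNReal.ofReal_toReal hrtop] using this
    · exact ((measurePreserving_shiftBy ν k).measure_preimage
        (hmeas ⌈(k : ℝ) ^ (1 / 100 : ℝ)⌉₊).nullMeasurableSet).le.trans
        (measure_exists_le_hits_zero _)
  have hfin : ∀ᵐ x ∂pathLaw ν, ∃ j, ¬ ∃ N, j ≤ hits x N 0 := by
    have : pathLaw ν {x | ∀ j, ∃ N, j ≤ hits x N 0} = 0 := by
      refine le_antisymm ?_ zero_le
      refine ge_of_tendsto' (ENNReal.tendsto_pow_atTop_nhds_zero_of_lt_one hν) fun j => ?_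
      have hsub : {x : ℕ → ℤ | ∀ j, ∃ N, j ≤ hits x N 0} ⊆ {x | ∃ N, j ≤ hits x N 0} :=
        Set.ofPred_subset_ofPred.2 fun x hx => hx j
      exact (measure_mono hsub).trans (measure_exists_le_hits_zero j)
    rw [ae_iff]
    simp only [not_exists_not]
    exact this
  have hfin' : ∀ᵐ x ∂pathLaw ν, ∀ k, ∃ j, ¬ ∃ N, j ≤ hits (shiftBy k x) N 0 :=
    ae_all_iff.2 fun k => (measurePreserving_shiftBy ν k).quasiMeasurePreserving.ae hfin
  filter_upwards [hbc, hfin'] with x hx hx'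
  obtain ⟨k₀, hk₀⟩ := eventually_atTop.1 hx
  choose J hJ using hx'
  refine ⟨1 + ∑ k ∈ Finset.range k₀, (J k : ℝ), by positivity, fun k N => ?_⟩
  rcases lt_or_ge k k₀ with h | h
  · have h1 : hits (shiftBy k x) N 0 ≤ J k := by
      by_contra hcon
      exact hJ k ⟨N, by omega⟩
    have h2 : (J k : ℝ) ≤ ∑ k ∈ Finset.range k₀, (J k : ℝ) :=
      Finset.single_le_sum (f := fun k => (J k : ℝ)) (fun i _ => Nat.cast_nonneg _)
        (Finset.mem_range.2 h)
    have h3 : (0 : ℝ) ≤ (k : ℝ) ^ (1 / 100 : ℝ) := by positivity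
    have h4 : (hits (shiftBy k x) N 0 : ℝ) ≤ J k := by exact_mod_cast h1
    linarith
  · have h1 : hits (shiftBy k x) N 0 < ⌈(k : ℝ) ^ (1 / 100 : ℝ)⌉₊ := by
      by_contra hcon
      exact hk₀ k h ⟨N, not_lt.1 hcon⟩
    have h2 := Nat.lt_ceil.1 h1
    have h3 : (0 : ℝ) ≤ ∑ k ∈ Finset.range k₀, (J k : ℝ) := by positivity
    linarith

theorem visits_le_hits_add_one {x : ℕ → ℤ} {n k : ℕ} {z : ℤ} (hk : pathSum x k = z)
    (hfirst : ∀ m < k, pathSum x m ≠ z) :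
    visits (pathSum x) n z ≤ hits (shiftBy k x) n 0 + 1 := by
  have : (Finset.range (n + 1)).filter (fun m => pathSum x m = z)
      ⊆ insert k (((Finset.Icc 1 n).filter (fun m => pathSum (shiftBy k x) m = 0)).image
        (fun m => k + m)) := by
    intro m hm
    simp only [Finset.mem_filter, Finset.mem_range] at hm
    rw [Finset.mem_insert]
    rcases lt_trichotomy m k with h | h | h
    · exact absurd hm.2 (hfirst m h)
    · exact Or.inl h
    · refine Or.inr (Finset.mem_image.2 ⟨m - k, ?_, by omega⟩)
      have h1 := pathSum_add x k (m - k)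
      rw [show k + (m - k) = m by omega, hm.2, hk] at h1
      simp only [Finset.mem_filter, Finset.mem_Icc]
      omega
  exact (Finset.card_le_card this).trans ((Finset.card_insert_le _ _).trans
    (Nat.add_le_add_right Finset.card_image_le 1))

theorem ae_exists_visits_le (hν : returnProb ν < 1) :
    ∀ᵐ x ∂pathLaw ν, ∃ D : ℝ, 0 < D ∧ ∀ n : ℕ, 1 ≤ n → ∀ z,
      (visits (pathSum x) n z : ℝ) ≤ D * (n : ℝ) ^ (1 / 100 : ℝ) := by
  filter_upwards [ae_exists_hits_le hν] with x hx
  obtain ⟨D, hD, hx⟩ := hx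
  -- The first visit occurs at some `k ≤ n`, so the count is at most `D + n ^ (1/100) + 1`, and `n ^
  -- (1/100) ≥ 1`.
  refine ⟨D + 2, by linarith, fun n hn z => ?_⟩
  have hn1 : (1 : ℝ) ≤ (n : ℝ) ^ (1 / 100 : ℝ) :=
    Real.one_le_rpow (by exact_mod_cast hn) (by norm_num)
  rcases Nat.eq_zero_or_pos (visits (pathSum x) n z) with h0 | hpos
  · rw [h0, Nat.cast_zero]
    positivity
  · obtain ⟨m, hm⟩ := Finset.card_pos.1 hpos
    simp only [Finset.mem_filter, Finset.mem_range] at hm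
    classical
    have hex : ∃ m, pathSum x m = z := ⟨m, hm.2⟩
    have hkn : Nat.find hex ≤ n := (Nat.find_min' hex hm.2).trans (by omega)
    have h1 := visits_le_hits_add_one (n := n) (Nat.find_spec hex)
      (fun m hm => Nat.find_min hex hm)
    have h2 := hx (Nat.find hex) n
    have h3 : ((Nat.find hex : ℕ) : ℝ) ^ (1 / 100 : ℝ) ≤ (n : ℝ) ^ (1 / 100 : ℝ) :=
      Real.rpow_le_rpow (Nat.cast_nonneg _) (by exact_mod_cast hkn) (by norm_num)
    have h4 : (visits (pathSum x) n z : ℝ) ≤ hits (shiftBy (Nat.find hex) x) n 0 + 1 := by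
      exact_mod_cast h1
    nlinarith

end Returns

/-! ### Maximal ergodic theorem. -/

section Maximal

variable {α : Type*} {τ : α → α}

/-- The maximum of `0` and the first `N` Birkhoff sums of `f`. -/
noncomputable def maxBirkhoffSum (τ : α → α) (f : α → ℝ) : ℕ → α → ℝ
  | 0, _ => 0
  | N + 1, x => max 0 (f x + maxBirkhoffSum τ f N (τ x))

theorem maxBirkhoffSum_nonneg (f : α → ℝ) (N : ℕ) (x : α) : 0 ≤ maxBirkhoffSum τ f N x := by
  cases N with
  | zero => exact le_rfl
  | succ N => exact le_max_left _ _

theorem maxBirkhoffSum_le_succ (f : α → ℝ) (N : ℕ) (x : α) :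
    maxBirkhoffSum τ f N x ≤ maxBirkhoffSum τ f (N + 1) x := by
  induction N generalizing x with
  | zero => exact maxBirkhoffSum_nonneg f 1 x
  | succ N ih => exact max_le_max le_rfl (add_le_add le_rfl (ih _))

theorem birkhoffSum_le_maxBirkhoffSum (f : α → ℝ) {n N : ℕ} (h : n ≤ N) (x : α) :
    birkhoffSum τ f n x ≤ maxBirkhoffSum τ f N x := by
  induction N generalizing n x with
  | zero =>
    obtain rfl : n = 0 := by omega
    simp [maxBirkhoffSum]
  | succ N ih =>
    cases n with
    | zero =>
      rw [birkhoffSum_zero]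
      exact maxBirkhoffSum_nonneg f _ x
    | succ n =>
      rw [birkhoffSum_succ']
      exact le_max_of_le_right (add_le_add le_rfl (ih (by omega) _))

variable [MeasurableSpace α] {P : Measure α}

theorem integrable_maxBirkhoffSum (hτ : MeasurePreserving τ P P) {f : α → ℝ} (hf : Integrable f P)
    (N : ℕ) : Integrable (maxBirkhoffSum τ f N) P := by
  induction N with
  | zero => exact integrable_zero _ _ _
  | succ N ih =>
    have h1 : Integrable (fun x => f x + maxBirkhoffSum τ f N (τ x)) P :=
      hf.add ((hτ.integrable_comp ih.aestronglyMeasurable).2 ih)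
    exact (integrable_zero _ _ _).sup h1

theorem measurable_maxBirkhoffSum (hτ : Measurable τ) {f : α → ℝ} (hf : Measurable f) (N : ℕ) :
    Measurable (maxBirkhoffSum τ f N) := by
  induction N with
  | zero => exact measurable_const
  | succ N ih => exact measurable_const.max (hf.add (ih.comp hτ))

/-- Hopf's maximal ergodic theorem. -/
theorem setIntegral_maxBirkhoffSum_pos_nonneg (hτ : MeasurePreserving τ P P) {f : α → ℝ}
    (hfm : Measurable f) (hf : Integrable f P) (N : ℕ) :
    0 ≤ ∫ x in {x | 0 < maxBirkhoffSum τ f (N + 1) x}, f x ∂P := by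
  set F := maxBirkhoffSum τ f (N + 1) with hF
  have hFi : Integrable F P := integrable_maxBirkhoffSum hτ hf _
  have hFm : Measurable F := measurable_maxBirkhoffSum hτ.measurable hfm _
  have hFτ : Integrable (fun x => F (τ x)) P := (hτ.integrable_comp hFi.aestronglyMeasurable).2 hFi
  have hset : MeasurableSet {x | 0 < F x} := measurableSet_lt measurable_const hFm
  -- The coboundary `F - F ∘ τ` has zero mean and lies below `f` times the indicator of `{F > 0}`:
  -- where `F > 0` the recursion gives `F ≤ f + F ∘ τ`, and elsewhere `F = 0 ≤ F ∘ τ`.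
  have h0 : ∫ x, (F x - F (τ x)) ∂P = 0 := by
    have h1 : ∫ x, F (τ x) ∂P = ∫ x, F x ∂P := by
      conv_rhs => rw [← hτ.map_eq]
      exact (integral_map hτ.measurable.aemeasurable hFm.aestronglyMeasurable).symm
    rw [integral_sub hFi hFτ, h1, sub_self]
  rw [← integral_indicator hset]
  refine h0.symm.le.trans ?_
  refine integral_mono (hFi.sub hFτ) (hf.indicator hset) fun x => ?_
  by_cases hx : 0 < F x
  · rw [Set.indicator_of_mem (show x ∈ {x | 0 < F x} from hx)]
    have h1 : F x = f x + maxBirkhoffSum τ f N (τ x) := by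
      rcases max_choice 0 (f x + maxBirkhoffSum τ f N (τ x)) with h | h
      · exact absurd h hx.ne'
      · exact h
    have h2 : maxBirkhoffSum τ f N (τ x) ≤ F (τ x) := maxBirkhoffSum_le_succ f N (τ x)
    simp only
    linarith
  · rw [Set.indicator_of_notMem (show x ∉ {x | 0 < F x} from hx)]
    have h1 : 0 ≤ F (τ x) := maxBirkhoffSum_nonneg f _ _
    simp only
    linarith

variable [IsProbabilityMeasure P]

/-- Weak-type maximal inequality for Birkhoff averages of a nonnegative function. -/
theorem measure_exists_lt_birkhoffSum_le (hτ : MeasurePreserving τ P P) {h : α → ℝ}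
    (hm : Measurable h) (hi : Integrable h P) (h0 : ∀ x, 0 ≤ h x) {r : ℝ} (hr : 0 < r) (N : ℕ) :
    P {x | ∃ n ≤ N, r * n < birkhoffSum τ h n x} ≤ ENNReal.ofReal ((∫ x, h x ∂P) / r) := by
  -- Birkhoff averages of `h` exceed `r` exactly when Birkhoff sums of `h - r` are positive.
  set f : α → ℝ := fun x => h x - r with hf
  have hfm : Measurable f := hm.sub_const r
  have hfi : Integrable f P := hi.sub (integrable_const r)
  set F := maxBirkhoffSum τ f (N + 1) with hF
  have hset : MeasurableSet {x | 0 < F x} :=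
    measurableSet_lt measurable_const (measurable_maxBirkhoffSum hτ.measurable hfm _)
  have hsub : {x | ∃ n ≤ N, r * n < birkhoffSum τ h n x} ⊆ {x | 0 < F x} := by
    rintro x ⟨n, hn, hx⟩
    have h1 : birkhoffSum τ f n x = birkhoffSum τ h n x - r * n := by
      simp only [birkhoffSum, hf, Finset.sum_sub_distrib, Finset.sum_const, Finset.card_range,
        nsmul_eq_mul]
      ring
    have h2 : birkhoffSum τ f n x ≤ F x := birkhoffSum_le_maxBirkhoffSum f (by omega) x
    change 0 < F x
    linarith
  have h1 := setIntegral_maxBirkhoffSum_pos_nonneg hτ hfm hfi N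
  rw [← hF] at h1
  have h2 : ∫ x in {x | 0 < F x}, f x ∂P = ∫ x in {x | 0 < F x}, h x ∂P - r * P.real {x | 0 < F x} := by
    rw [hf, integral_sub hi.integrableOn (integrable_const r).integrableOn, setIntegral_const,
      smul_eq_mul, mul_comm r]
  have h3 : ∫ x in {x | 0 < F x}, h x ∂P ≤ ∫ x, h x ∂P :=
    setIntegral_le_integral hi (ae_of_all _ h0)
  refine (measure_mono hsub).trans ?_
  rw [← ofReal_measureReal (measure_ne_top P _)]
  refine ENNReal.ofReal_le_ofReal ?_
  rw [le_div_iff₀ hr]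
  linarith

end Maximal

/-! ### Averages along residue classes and truncation of limits. -/

theorem sum_range_mul_eq_sum_residues (u : ℕ → ℝ) (m J : ℕ) :
    ∑ k ∈ Finset.range (J * m), u k
      = ∑ r ∈ Finset.range m, ∑ j ∈ Finset.range J, u (r + j * m) := by
  induction J with
  | zero => simp
  | succ J ih =>
    rw [Nat.succ_mul, Finset.sum_range_add, ih]
    simp_rw [Finset.sum_range_succ]
    rw [Finset.sum_add_distrib]
    congr 1
    exact Finset.sum_congr rfl fun r _ => by rw [add_comm]

/-- Cesàro convergence of a bounded sequence along all residue classes modulo `m`. -/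
theorem tendsto_average_of_residues {u : ℕ → ℝ} (hu : ∀ k, |u k| ≤ 1) {m : ℕ} (hm : 1 ≤ m) {v : ℝ}
    (h : ∀ r < m, Tendsto (fun J : ℕ => (∑ j ∈ Finset.range J, u (r + j * m)) / J) atTop (𝓝 v)) :
    Tendsto (fun n : ℕ => (∑ k ∈ Finset.range n, u k) / n) atTop (𝓝 v) := by
  have hJ : Tendsto (fun n : ℕ => n / m) atTop atTop := Nat.tendsto_div_const_atTop (by omega)
  have h1 : ∀ r ∈ Finset.range m, Tendsto (fun n : ℕ =>
      ((∑ j ∈ Finset.range (n / m), u (r + j * m)) / ((n / m : ℕ) : ℝ) - v)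
        * (((n / m : ℕ) : ℝ) / n)) atTop (𝓝 0) := fun r hr => by
    have h2 : Tendsto (fun n : ℕ =>
        (∑ j ∈ Finset.range (n / m), u (r + j * m)) / ((n / m : ℕ) : ℝ) - v) atTop (𝓝 0) := by
      simpa using ((h r (Finset.mem_range.1 hr)).comp hJ).sub_const v
    refine squeeze_zero_norm (fun n => ?_) (tendsto_zero_iff_norm_tendsto_zero.1 h2)
    rw [norm_mul]
    refine mul_le_of_le_one_right (norm_nonneg _) ?_
    rw [Real.norm_eq_abs, abs_of_nonneg (by positivity)]
    exact div_le_one_of_le₀ (by exact_mod_cast Nat.div_le_self n m) (Nat.cast_nonneg n)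
  have h3 := tendsto_finsetSum _ h1
  rw [Finset.sum_const_zero] at h3
  have h4 : Tendsto (fun n : ℕ => (1 + |v|) * m * ((n : ℝ))⁻¹) atTop (𝓝 0) := by
    simpa using (tendsto_inv_atTop_zero.comp tendsto_natCast_atTop_atTop).const_mul
      ((1 + |v|) * (m : ℝ))
  -- Only the incomplete last period is left over: fewer than `m` bounded terms, divided by `n`.
  have h5 : Tendsto (fun n : ℕ => (∑ k ∈ Finset.range n, u k) / n - v
      - ∑ r ∈ Finset.range m, ((∑ j ∈ Finset.range (n / m), u (r + j * m)) / ((n / m : ℕ) : ℝ) - v)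
        * (((n / m : ℕ) : ℝ) / n)) atTop (𝓝 0) := by
    refine squeeze_zero_norm' ?_ h4
    filter_upwards [eventually_ge_atTop m] with n hn
    have hn0 : (0 : ℝ) < n := by exact_mod_cast (by omega : 0 < n)
    set J := n / m with hJdef
    have hJ0 : (0 : ℝ) < (J : ℝ) := by exact_mod_cast Nat.div_pos hn (by omega)
    have hsplit : n = J * m + n % m := by
      rw [hJdef, mul_comm]; exact (Nat.div_add_mod n m).symm
    have hmod : n % m ≤ m := (Nat.mod_lt n (by omega)).le
    have e1 : ∑ r ∈ Finset.range m, ((∑ j ∈ Finset.range J, u (r + j * m)) / (J : ℝ) - v)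
        * ((J : ℝ) / n) = (∑ k ∈ Finset.range (J * m), u k - v * (J * m)) / n := by
      rw [sum_range_mul_eq_sum_residues, ← Finset.sum_mul, Finset.sum_sub_distrib,
        Finset.sum_const, Finset.card_range, ← Finset.sum_div, nsmul_eq_mul]
      field_simp
    have e2 : ∑ k ∈ Finset.range n, u k = ∑ k ∈ Finset.range (J * m), u k
        + ∑ i ∈ Finset.range (n % m), u (J * m + i) := by
      conv_lhs => rw [hsplit, Finset.sum_range_add]
    have e3 : (n : ℝ) = J * m + (n % m : ℕ) := by exact_mod_cast hsplit
    have e4 : (∑ k ∈ Finset.range n, u k) / n - v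
        - (∑ k ∈ Finset.range (J * m), u k - v * (J * m)) / n
        = (∑ i ∈ Finset.range (n % m), u (J * m + i) - v * (n % m : ℕ)) * (n : ℝ)⁻¹ := by
      rw [e2]
      field_simp
      linear_combination (-v) * e3
    rw [e1, e4, norm_mul, norm_inv, Real.norm_natCast]
    refine mul_le_mul_of_nonneg_right ?_ (by positivity)
    have b1 : |∑ i ∈ Finset.range (n % m), u (J * m + i)| ≤ m := by
      refine (Finset.abs_sum_le_sum_abs _ _).trans
        ((Finset.sum_le_card_nsmul _ _ 1 fun i _ => hu _).trans ?_)
      simpa using (by exact_mod_cast hmod : ((n % m : ℕ) : ℝ) ≤ m)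
    have b2 : |v * ((n % m : ℕ) : ℝ)| ≤ |v| * m := by
      rw [abs_mul, Nat.abs_cast]
      gcongr
    rw [Real.norm_eq_abs]
    refine (abs_sub _ _).trans ?_
    linarith
  have h6 := (h5.add h3).add_const v
  simpa using h6

/-- Convergence of averages from truncated lower bounds and approximate upper bounds. -/
theorem tendsto_div_of_truncation {o : ℕ → ℝ} {a : ℕ → ℕ → ℝ} {g : ℕ → ℝ} {G : ℝ}
    (hg : Tendsto g atTop (𝓝 G))
    (ha : ∀ M, Tendsto (fun n : ℕ => a M n / ((n : ℝ) + 1)) atTop (𝓝 (g M)))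
    (hlow : ∀ M n, a M n - (M : ℝ) * M ≤ o n)
    (hup : ∀ r > 0, ∀ M₀, ∃ M ≥ M₀, ∀ n : ℕ, o n ≤ a M n + r * ((n : ℝ) + 1)) :
    Tendsto (fun n : ℕ => o n / ((n : ℝ) + 1)) atTop (𝓝 G) := by
  have hinv : Tendsto (fun n : ℕ => ((n : ℝ) + 1)⁻¹) atTop (𝓝 0) := by
    simpa [one_div] using tendsto_one_div_add_atTop_nhds_zero_nat (𝕜 := ℝ)
  refine tendsto_order.2 ⟨fun b hb => ?_, fun b hb => ?_⟩
  · obtain ⟨M, hM⟩ := ((tendsto_order.1 hg).1 b hb).exists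
    have h1 : Tendsto (fun n : ℕ => a M n / ((n : ℝ) + 1) - (M : ℝ) * M * ((n : ℝ) + 1)⁻¹) atTop
        (𝓝 (g M)) := by simpa using (ha M).sub (hinv.const_mul ((M : ℝ) * M))
    filter_upwards [(tendsto_order.1 h1).1 b hM] with n hn
    refine hn.trans_le ?_
    rw [← div_eq_mul_inv, ← sub_div]
    exact div_le_div_of_nonneg_right (hlow M n) (by positivity)
  · set r := (b - G) / 2 with hr
    have hr0 : 0 < r := by linarith
    obtain ⟨M₀, hM₀⟩ := eventually_atTop.1 ((tendsto_order.1 hg).2 (G + r) (by linarith))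
    obtain ⟨M, hM, hMup⟩ := hup r hr0 M₀
    have h1 : g M < b - r := (hM₀ M hM).trans_le (by linarith)
    filter_upwards [(tendsto_order.1 (ha M)).2 (b - r) h1] with n hn
    have hn0 : (0 : ℝ) < (n : ℝ) + 1 := by positivity
    have h2 : o n / ((n : ℝ) + 1) ≤ a M n / ((n : ℝ) + 1) + r := by
      rw [div_le_iff₀ hn0, add_mul, div_mul_cancel₀ _ hn0.ne']
      exact hMup n
    linarith

/-! ### Almost sure limit of the pair counts of a transient walk. -/

/-- The number of pairs `k < l ≤ n` at which the partial sums of `x` increase by `y`. -/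
def orderedPairs (x : ℕ → ℤ) (n : ℕ) (y : ℤ) : ℕ :=
  ∑ k ∈ Finset.range (n + 1), hits (shiftBy k x) (n - k) y

theorem hits_shiftBy_eq_card {x : ℕ → ℤ} {n k : ℕ} (y : ℤ) :
    hits (shiftBy k x) (n - k) y = ((Finset.range (n + 1)).filter
      (fun l => k < l ∧ pathSum x l - pathSum x k = y)).card := by
  rw [hits, ← Finset.card_image_of_injective _ (add_right_injective k)]
  congr 1
  ext l
  simp only [Finset.mem_image, Finset.mem_filter, Finset.mem_Icc, Finset.mem_range]
  constructor
  · rintro ⟨m, ⟨hm, rfl⟩, rfl⟩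
    rw [pathSum_add]
    omega
  · rintro ⟨hl, hkl, rfl⟩
    refine ⟨l - k, ⟨by omega, ?_⟩, by omega⟩
    have := pathSum_add x k (l - k)
    rw [show k + (l - k) = l by omega] at this
    omega

theorem pairCount_pathSum_eq (x : ℕ → ℤ) (n : ℕ) (y : ℤ) :
    pairCount (pathSum x) n y = orderedPairs x n y + orderedPairs x n (-y)
      + (if y = 0 then n + 1 else 0) := by
  have h1 : ∀ z, orderedPairs x n z = ∑ k ∈ Finset.range (n + 1), ∑ l ∈ Finset.range (n + 1),
      (if k < l ∧ pathSum x l - pathSum x k = z then 1 else 0) := fun z => by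
    simp_rw [orderedPairs, hits_shiftBy_eq_card, Finset.card_filter]
  have h2 : (if y = 0 then n + 1 else 0) = ∑ k ∈ Finset.range (n + 1), ∑ l ∈ Finset.range (n + 1),
      (if k = l ∧ y = 0 then 1 else 0) := by
    by_cases hy : y = 0
    · simp only [hy, and_true, if_true]
      rw [Finset.sum_congr rfl fun k hk => by rw [Finset.sum_ite_eq, if_pos hk]]
      simp
    · simp [hy]
  rw [h1 y, h1 (-y), h2, Finset.sum_comm, pairCount, Finset.card_filter,
    Finset.sum_product' (f := fun k l => if pathSum x k - pathSum x l = y then 1 else 0)]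
  simp_rw [← Finset.sum_add_distrib]
  refine Finset.sum_congr rfl fun k _ => Finset.sum_congr rfl fun l _ => ?_
  rcases lt_trichotomy k l with h | rfl | h
  · have e1 : pathSum x l - pathSum x k = -y ↔ pathSum x k - pathSum x l = y := by omega
    simp [h, h.ne, h.le.not_gt, e1]
  · have e1 : (0 : ℤ) = y ↔ y = 0 := eq_comm
    simp [e1]
  · simp [h, h.ne', h.le.not_gt]

theorem natCast_hits_eq_sum_ite (x : ℕ → ℤ) (N : ℕ) (y : ℤ) :
    (hits x N y : ℝ) = ∑ m ∈ Finset.range N, if pathSum x (m + 1) = y then (1 : ℝ) else 0 := by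
  rw [hits, Finset.card_filter, Nat.cast_sum, Finset.range_eq_Ico,
    Finset.sum_Ico_add' (fun m => if pathSum x m = y then (1 : ℝ) else 0) 0 N 1]
  simp only [zero_add, Nat.cast_ite, Nat.cast_one, Nat.cast_zero]
  rfl

/-- Only the last `M` starting times have a window of length `M` running past `n`, and each loses at
most `M` hits. -/
theorem sum_hits_sub_le_orderedPairs (x : ℕ → ℤ) (M n : ℕ) (y : ℤ) :
    (∑ k ∈ Finset.range (n + 1), (hits (shiftBy k x) M y : ℝ)) - (M : ℝ) * M
      ≤ orderedPairs x n y := by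
  have h1 : ∑ k ∈ Finset.range (n + 1), hits (shiftBy k x) M y
      ≤ orderedPairs x n y + ∑ k ∈ Finset.range (n + 1), (if n < k + M then M else 0) := by
    rw [orderedPairs, ← Finset.sum_add_distrib]
    refine Finset.sum_le_sum fun k _ => ?_
    split_ifs with h
    · exact (hits_le _ _ _).trans (Nat.le_add_left _ _)
    · exact (hits_mono _ (by omega) y).trans (Nat.le_add_right _ _)
  have h2 : ∑ k ∈ Finset.range (n + 1), (if n < k + M then M else 0) ≤ M * M := by
    rw [← Finset.sum_filter, Finset.sum_const, smul_eq_mul]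
    refine Nat.mul_le_mul_right M ?_
    have : (Finset.range (n + 1)).filter (fun k => n < k + M) ⊆ Finset.Ico (n + 1 - M) (n + 1) := by
      intro k hk
      simp only [Finset.mem_filter, Finset.mem_range, Finset.mem_Ico] at hk ⊢
      omega
    refine (Finset.card_le_card this).trans ?_
    rw [Nat.card_Ico]
    omega
  have h3 := h1.trans (Nat.add_le_add_left h2 _)
  have h4 : (∑ k ∈ Finset.range (n + 1), (hits (shiftBy k x) M y : ℝ))
      ≤ orderedPairs x n y + (M : ℝ) * M := by exact_mod_cast h3
  linarith

theorem iterate_shiftBy_one (k : ℕ) (x : ℕ → ℤ) : (shiftBy 1)^[k] x = shiftBy k x := by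
  induction k generalizing x with
  | zero => rfl
  | succ k ih => rw [Function.iterate_succ_apply, ih, shiftBy_shiftBy]

theorem integral_ite_pathSum_eq {ν : Measure ℤ} (m : ℕ) (y : ℤ) :
    ∫ x, (if pathSum x m = y then (1 : ℝ) else 0) ∂pathLaw ν
      = (pathLaw ν).real {x | pathSum x m = y} := by
  have hset : MeasurableSet {x : ℕ → ℤ | pathSum x m = y} :=
    (dependsOn_pathSum m).measurable_of_finset (measurableSet_singleton y)
  rw [← integral_indicator_one hset]
  exact integral_congr_ae (ae_of_all _ fun x => by simp [Set.indicator])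

section Ergodic

variable {ν : Measure ℤ} [IsProbabilityMeasure ν]

theorem integrable_ite_pathSum_eq (m : ℕ) (y : ℤ) :
    Integrable (fun x => if pathSum x m = y then (1 : ℝ) else 0) (pathLaw ν) := by
  have h := (integrable_const (μ := pathLaw ν) (1 : ℝ)).indicator
    ((dependsOn_pathSum m).measurable_of_finset (measurableSet_singleton y))
  refine h.congr (ae_of_all _ fun x => ?_)
  simp [Set.indicator]

/-- Along one residue class modulo `m` the windows `[k, k + m)` are disjoint, so the indicators are
i.i.d. and the strong law applies. The `m` classes are then recombined. -/
theorem ae_tendsto_average_indicator (m : ℕ) (hm : 1 ≤ m) (y : ℤ) :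
    ∀ᵐ x ∂pathLaw ν, Tendsto (fun n : ℕ => (∑ k ∈ Finset.range n,
      if pathSum (shiftBy k x) m = y then (1 : ℝ) else 0) / n) atTop
      (𝓝 ((pathLaw ν).real {x | pathSum x m = y})) := by
  set f : (ℕ → ℤ) → ℝ := fun x => if pathSum x m = y then (1 : ℝ) else 0 with hf
  have hdep : DependsOn f (Finset.range m : Set ℕ) := fun x x' h => by
    have : pathSum x m = pathSum x' m := dependsOn_pathSum m h
    simp only [hf, this]
  have hfm : Measurable f := hdep.measurable_of_finset
  have hint : ∫ x, f x ∂pathLaw ν = (pathLaw ν).real {x | pathSum x m = y} :=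
    integral_ite_pathSum_eq m y
  have hfi : Integrable f (pathLaw ν) := integrable_ite_pathSum_eq m y
  have hid : ∀ k, IdentDistrib (fun x => f (shiftBy k x)) f (pathLaw ν) (pathLaw ν) := fun k =>
    ⟨(hfm.comp (measurable_shiftBy k)).aemeasurable, hfm.aemeasurable, by
      have h1 := Measure.map_map (μ := pathLaw ν) hfm (measurable_shiftBy k)
      rw [(measurePreserving_shiftBy ν k).map_eq] at h1
      exact h1.symm⟩
  have hres : ∀ r : ℕ, ∀ᵐ x ∂pathLaw ν, Tendsto (fun J : ℕ =>
      (∑ j ∈ Finset.range J, f (shiftBy (r + j * m) x)) / J) atTop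
      (𝓝 ((pathLaw ν).real {x | pathSum x m = y})) := fun r => by
    have h1 := strong_law_ae_real (μ := pathLaw ν) (fun j x => f (shiftBy (r + j * m) x))
      ((hid _).integrable_iff.2 hfi) (fun i j hij => by
        refine indepFun_of_dependsOn ?_ (hdep.comp_shiftBy (r + i * m))
          (hdep.comp_shiftBy (r + j * m))
        rw [Finset.disjoint_left]
        intro k hk hk'
        simp only [Finset.mem_Ico] at hk hk'
        rcases lt_or_gt_of_ne hij with h | h
        · have : (i + 1) * m ≤ j * m := Nat.mul_le_mul_right m h
          rw [add_mul] at this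
          omega
        · have : (j + 1) * m ≤ i * m := Nat.mul_le_mul_right m h
          rw [add_mul] at this
          omega) (fun j => (hid _).trans (hid _).symm)
    rw [(hid _).integral_eq, hint] at h1
    exact h1
  filter_upwards [ae_all_iff.2 hres] with x hx
  exact tendsto_average_of_residues (u := fun k => f (shiftBy k x))
    (fun k => by simp only [hf]; split_ifs <;> simp) hm fun r _ => hx r

theorem ae_tendsto_sum_hits (M : ℕ) (y : ℤ) :
    ∀ᵐ x ∂pathLaw ν, Tendsto (fun n : ℕ => (∑ k ∈ Finset.range (n + 1),
      (hits (shiftBy k x) M y : ℝ)) / ((n : ℝ) + 1)) atTop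
      (𝓝 (∑ m ∈ Finset.range M, (pathLaw ν).real {x | pathSum x (m + 1) = y})) := by
  have h := ae_all_iff.2 fun m => ae_tendsto_average_indicator (ν := ν) (m + 1) (by omega) y
  filter_upwards [h] with x hx
  have h1 := (tendsto_finsetSum (Finset.range M) fun m _ => hx m).comp (tendsto_add_atTop_nat 1)
  refine h1.congr fun n => ?_
  simp only [Function.comp_apply]
  simp_rw [natCast_hits_eq_sum_ite]
  rw [Finset.sum_comm, Finset.sum_div]
  push_cast
  rfl

theorem summable_measureReal_pathSum_eq (hν : returnProb ν < 1) (y : ℤ) :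
    Summable fun m => (pathLaw ν).real {x | pathSum x (m + 1) = y} := by
  refine ENNReal.summable_toReal (ne_top_of_le_ne_top ?_ (tsum_measure_pathSum_eq_le y))
  exact ENNReal.inv_ne_top.2 (tsub_pos_of_lt hν).ne'

theorem integral_hits (N : ℕ) (y : ℤ) : ∫ x, (hits x N y : ℝ) ∂pathLaw ν
    = ∑ m ∈ Finset.range N, (pathLaw ν).real {x | pathSum x (m + 1) = y} := by
  simp_rw [natCast_hits_eq_sum_ite]
  rw [integral_finsetSum _ fun m _ => integrable_ite_pathSum_eq (m + 1) y]
  simp_rw [integral_ite_pathSum_eq]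

theorem integrable_hits (N : ℕ) (y : ℤ) : Integrable (fun x => (hits x N y : ℝ)) (pathLaw ν) :=
  Integrable.of_bound
    ((measurable_of_countable (fun n : ℕ => (n : ℝ))).comp
      (dependsOn_hits N y).measurable_of_finset).aestronglyMeasurable N
    (ae_of_all _ fun x => by
      rw [Real.norm_natCast]
      exact_mod_cast hits_le x N y)

/-- Hits at time distance in `(M, M + N]` form a nonnegative functional whose mean is at most the
tail of the Green series. The maximal inequality is thus uniform in `N`, and the events increase
with `N`. -/
theorem measure_exists_lt_sum_late_hits_le (hν : returnProb ν < 1) (y : ℤ) (M : ℕ) {r : ℝ}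
    (hr : 0 < r) :
    pathLaw ν {x | ∃ N, ∃ n ≤ N, r * n < ∑ k ∈ Finset.range n,
      ((hits (shiftBy k x) (M + N) y : ℝ) - hits (shiftBy k x) M y)}
      ≤ ENNReal.ofReal ((∑' m, (pathLaw ν).real {x | pathSum x (m + M + 1) = y}) / r) := by
  set h : ℕ → (ℕ → ℤ) → ℝ := fun N x => (hits x (M + N) y : ℝ) - hits x M y with hh
  have hsm := summable_measureReal_pathSum_eq hν y
  have hset : {x | ∃ N, ∃ n ≤ N, r * n < ∑ k ∈ Finset.range n,
      ((hits (shiftBy k x) (M + N) y : ℝ) - hits (shiftBy k x) M y)}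
      = ⋃ N, {x | ∃ n ≤ N, r * n < birkhoffSum (shiftBy 1) (h N) n x} := by
    ext x
    simp [birkhoffSum, iterate_shiftBy_one, hh]
  have hmono : Monotone fun N => {x | ∃ n ≤ N, r * n < birkhoffSum (shiftBy 1) (h N) n x} := by
    intro N N' hN x hx
    obtain ⟨n, hn, hx⟩ := hx
    refine ⟨n, hn.trans hN, hx.trans_le (Finset.sum_le_sum fun k _ => ?_)⟩
    have : (hits ((shiftBy 1)^[k] x) (M + N) y : ℝ) ≤ hits ((shiftBy 1)^[k] x) (M + N') y := by
      exact_mod_cast hits_mono _ (by omega) y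
    simp only [hh]
    linarith
  rw [hset, hmono.measure_iUnion]
  refine iSup_le fun N => ?_
  have hi : Integrable (h N) (pathLaw ν) := (integrable_hits _ y).sub (integrable_hits _ y)
  have hcast : Measurable fun n : ℕ => (n : ℝ) := measurable_of_countable _
  refine (measure_exists_lt_birkhoffSum_le (measurePreserving_shiftBy ν 1)
    ((hcast.comp (dependsOn_hits _ y).measurable_of_finset).sub
      (hcast.comp (dependsOn_hits _ y).measurable_of_finset)) hi (fun x => ?_) hr N).trans ?_
  · have : (hits x M y : ℝ) ≤ hits x (M + N) y := by exact_mod_cast hits_mono _ (by omega) y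
    exact sub_nonneg.2 this
  · refine ENNReal.ofReal_le_ofReal (div_le_div_of_nonneg_right ?_ hr.le)
    change ∫ x, ((hits x (M + N) y : ℝ) - hits x M y) ∂pathLaw ν ≤ _
    rw [integral_sub (integrable_hits _ y) (integrable_hits _ y), integral_hits, integral_hits,
      Finset.sum_range_add, add_sub_cancel_left]
    simp_rw [add_comm M]
    exact ((summable_nat_add_iff M).2 hsm).sum_le_tsum _ fun _ _ => measureReal_nonneg

/-- Windows of length `M` give the lower bound by the law of large numbers. For the upper bound,
late pairs exceed a small multiple of `n` for some `n` with probability tending to `0` as `M → ∞`.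
Hence almost surely arbitrarily large `M` avoid this event, which is all the truncation argument
needs. -/
theorem ae_tendsto_orderedPairs (hν : returnProb ν < 1) (y : ℤ) :
    ∀ᵐ x ∂pathLaw ν, Tendsto (fun n : ℕ => (orderedPairs x n y : ℝ) / ((n : ℝ) + 1)) atTop
      (𝓝 (∑' m, (pathLaw ν).real {x | pathSum x (m + 1) = y})) := by
  have hsm := summable_measureReal_pathSum_eq hν y
  set B : ℝ → ℕ → Set (ℕ → ℤ) := fun r M => {x | ∃ N, ∃ n ≤ N, r * n < ∑ k ∈ Finset.range n,
      ((hits (shiftBy k x) (M + N) y : ℝ) - hits (shiftBy k x) M y)} with hB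
  have hnull : ∀ i M₀ : ℕ, ∀ᵐ x ∂pathLaw ν, ∃ M ≥ M₀, x ∉ B (1 / ((i : ℝ) + 1)) M := by
    intro i M₀
    have hr : (0 : ℝ) < 1 / ((i : ℝ) + 1) := by positivity
    have hlim : Tendsto (fun M => ENNReal.ofReal
        ((∑' m, (pathLaw ν).real {x | pathSum x (m + M + 1) = y}) / (1 / ((i : ℝ) + 1))))
        atTop (𝓝 0) := by
      have h1 := (tendsto_sum_nat_add
        (fun m => (pathLaw ν).real {x | pathSum x (m + 1) = y})).div_const (1 / ((i : ℝ) + 1))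
      rw [zero_div] at h1
      simpa using ENNReal.tendsto_ofReal h1
    have : pathLaw ν {x | ∀ M ≥ M₀, x ∈ B (1 / ((i : ℝ) + 1)) M} = 0 := by
      refine le_antisymm ?_ zero_le
      refine ge_of_tendsto hlim ((eventually_ge_atTop M₀).mono fun M hM => ?_)
      refine le_trans (measure_mono ?_) (measure_exists_lt_sum_late_hits_le hν y M hr)
      exact Set.ofPred_subset_ofPred.2 fun x hx => hx M hM
    rw [ae_iff]
    simpa only [not_exists, not_and, not_not] using this
  filter_upwards [ae_all_iff.2 fun M => ae_tendsto_sum_hits (ν := ν) M y,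
    ae_all_iff.2 fun i => ae_all_iff.2 (hnull i)] with x hx hxB
  refine tendsto_div_of_truncation hsm.hasSum.tendsto_sum_nat hx
    (fun M n => sum_hits_sub_le_orderedPairs x M n y) fun r hr M₀ => ?_
  obtain ⟨i, hi⟩ := exists_nat_one_div_lt hr
  obtain ⟨M, hM, hxM⟩ := hxB i M₀
  refine ⟨M, hM, fun n => ?_⟩
  -- With `N = n + 1` the window `M + N` is longer than `n - k` for every `k`, so it covers all the
  -- pairs counted up to time `n`.
  have h1 : ∑ k ∈ Finset.range (n + 1),
      ((hits (shiftBy k x) (M + (n + 1)) y : ℝ) - hits (shiftBy k x) M y)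
      ≤ 1 / ((i : ℝ) + 1) * ((n + 1 : ℕ) : ℝ) := by
    by_contra hcon
    exact hxM ⟨n + 1, n + 1, le_rfl, not_le.1 hcon⟩
  have h2 : (orderedPairs x n y : ℝ)
      ≤ ∑ k ∈ Finset.range (n + 1), (hits (shiftBy k x) (M + (n + 1)) y : ℝ) := by
    rw [orderedPairs, Nat.cast_sum]
    exact Finset.sum_le_sum fun k _ => by exact_mod_cast hits_mono _ (by omega) y
  rw [Finset.sum_sub_distrib] at h1
  have h3 : 1 / ((i : ℝ) + 1) * ((n + 1 : ℕ) : ℝ) ≤ r * ((n : ℝ) + 1) := by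
    push_cast
    gcongr
  linarith

/-- Almost sure convergence of the normalised pair counts of a transient walk. -/
theorem ae_tendsto_pairCount (hν : returnProb ν < 1) (y : ℤ) :
    ∀ᵐ x ∂pathLaw ν, Tendsto (fun n : ℕ => (pairCount (pathSum x) n y : ℝ) / n) atTop
      (𝓝 (∑' m, (pathLaw ν).real {x | pathSum x (m + 1) = y}
        + ∑' m, (pathLaw ν).real {x | pathSum x (m + 1) = -y} + if y = 0 then 1 else 0)) := by
  filter_upwards [ae_tendsto_orderedPairs hν y, ae_tendsto_orderedPairs hν (-y)] with x h1 h2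
  have h3 : Tendsto (fun n : ℕ => ((n : ℝ) + 1) / n) atTop (𝓝 1) := by
    have h4 : Tendsto (fun n : ℕ => 1 + (n : ℝ)⁻¹) atTop (𝓝 1) := by
      simpa using (tendsto_inv_atTop_zero.comp (tendsto_natCast_atTop_atTop (R := ℝ))).const_add 1
    refine h4.congr' ?_
    filter_upwards [eventually_ge_atTop 1] with n hn
    have : (n : ℝ) ≠ 0 := by positivity
    field_simp
  have h5 := ((h1.add h2).add_const (if y = 0 then (1 : ℝ) else 0)).mul h3
  rw [mul_one] at h5
  refine h5.congr fun n => ?_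
  have hn1 : ((n : ℝ) + 1) ≠ 0 := by positivity
  rw [pairCount_pathSum_eq]
  push_cast
  rw [← mul_div_assoc]
  congr 1
  split_ifs <;> field_simp
  ring

end Ergodic

/-! ### Stationarity under the iterates of `T`. -/

section Iterates

variable {E : Type*} [MeasurableSpace E] {μ : Measure E} {T : E ≃ᵐ E}

theorem iterZ_add (T : E ≃ᵐ E) (a b : ℤ) (e : E) :
    iterZ T (a + b) e = iterZ T a (iterZ T b e) := by
  simp only [iterZ, zpow_add, Equiv.Perm.mul_apply]

theorem iterZ_zero (T : E ≃ᵐ E) (e : E) : iterZ T 0 e = e := by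
  simp [iterZ]

theorem measurePreserving_iterZ (hT : MeasurePreserving T μ μ) (x : ℤ) :
    MeasurePreserving (iterZ T x) μ μ := by
  induction x with
  | zero =>
    rw [show iterZ T 0 = id from funext (iterZ_zero T)]
    exact MeasurePreserving.id μ
  | succ n ih =>
    have h : iterZ T ((n : ℤ) + 1) = T ∘ iterZ T n := by
      funext e
      rw [add_comm, iterZ_add]
      simp [iterZ]
    rw [h]
    exact hT.comp ih
  | pred n ih =>
    have h : iterZ T (-(n : ℤ) - 1) = T.symm ∘ iterZ T (-n) := by
      funext e
      rw [sub_eq_add_neg, add_comm, iterZ_add]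
      simp only [iterZ, zpow_neg_one]
      rfl
    rw [h]
    exact (MeasurePreserving.symm T hT).comp ih

theorem identDistrib_comp_iterZ (hT : MeasurePreserving T μ μ) {f : E → ℝ} (hf : Measurable f)
    (x y : ℤ) :
    IdentDistrib (fun e => f (iterZ T x e)) (fun e => f (iterZ T y e)) μ μ := by
  have hmap : ∀ z, μ.map (fun e => f (iterZ T z e)) = μ.map f := fun z => by
    have h := Measure.map_map (μ := μ) hf (measurePreserving_iterZ hT z).measurable
    rw [(measurePreserving_iterZ hT z).map_eq] at h
    exact h.symm
  exact ⟨(hf.comp (measurePreserving_iterZ hT x).measurable).aemeasurable,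
    (hf.comp (measurePreserving_iterZ hT y).measurable).aemeasurable, by rw [hmap, hmap]⟩

theorem integral_mul_comp_iterZ (hT : MeasurePreserving T μ μ) {f : E → ℝ} (hf : Measurable f)
    (i k : ℤ) :
    ∫ e, f (iterZ T i e) * f (iterZ T k e) ∂μ = ∫ e, f e * f (iterZ T (i - k) e) ∂μ := by
  have hk := measurePreserving_iterZ hT k
  have hm : Measurable fun e => f e * f (iterZ T (i - k) e) :=
    hf.mul (hf.comp (measurePreserving_iterZ hT (i - k)).measurable)
  have h : ∫ e, f e * f (iterZ T (i - k) e) ∂μ.map (iterZ T k)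
      = ∫ e, f (iterZ T k e) * f (iterZ T (i - k) (iterZ T k e)) ∂μ :=
    integral_map hk.measurable.aemeasurable hm.aestronglyMeasurable
  rw [hk.map_eq] at h
  rw [h]
  refine integral_congr_ae (ae_of_all _ fun e => ?_)
  simp only [← iterZ_add, sub_add_cancel]
  exact mul_comm _ _

theorem integral_mul_comp_iterZ_neg (hT : MeasurePreserving T μ μ) {f : E → ℝ}
    (hf : Measurable f) (x : ℤ) :
    ∫ e, f e * f (iterZ T (-x) e) ∂μ = ∫ e, f e * f (iterZ T x e) ∂μ := by
  have h := integral_mul_comp_iterZ hT hf 0 x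
  simp only [iterZ_zero, zero_sub] at h
  exact h.symm

end Iterates

/-! ### Transfer to path space and the Green function. -/

section Steps

variable {Ω : Type*} [MeasurableSpace Ω] {P : Measure Ω}
  {X : ℕ → Ω → ℤ}

theorem IsIIDSteps.map_eq_pathLaw (hX : IsIIDSteps P X) :
    P.map (fun ω i => X i ω) = pathLaw (P.map (X 0)) := by
  have h := hX.indep.map_fun_eq_infinitePi_map₀
    (measurable_pi_lambda _ hX.measurable).aemeasurable
  simp_rw [fun i => (hX.ident i).map_eq] at h
  exact h

theorem IsIIDSteps.measure_walk_eq (hX : IsIIDSteps P X) (k : ℕ) (y : ℤ) :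
    P {ω | walk X k ω = y} = pathLaw (P.map (X 0)) {x | pathSum x k = y} := by
  have hset : MeasurableSet {x : ℕ → ℤ | pathSum x k = y} :=
    (dependsOn_pathSum k).measurable_of_finset (measurableSet_singleton y)
  rw [← hX.map_eq_pathLaw, Measure.map_apply (measurable_pi_lambda _ hX.measurable) hset]
  rfl

theorem IsIIDSteps.returnProb_lt_one [IsProbabilityMeasure (P.map (X 0))] (hX : IsIIDSteps P X)
    (h : IsTransientWalk P X) : returnProb (P.map (X 0)) < 1 := by
  have hset : MeasurableSet {x : ℕ → ℤ | ∃ n, 1 ≤ n ∧ pathSum x n = 0} := by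
    have : {x : ℕ → ℤ | ∃ n, 1 ≤ n ∧ pathSum x n = 0}
        = ⋃ (n : ℕ) (_ : 1 ≤ n), {x | pathSum x n = 0} := by
      ext x
      simp
    rw [this]
    exact MeasurableSet.iUnion fun n => MeasurableSet.iUnion fun _ =>
      (dependsOn_pathSum n).measurable_of_finset (measurableSet_singleton 0)
  rw [returnProb, ← hX.map_eq_pathLaw,
    Measure.map_apply (measurable_pi_lambda _ hX.measurable) hset]
  exact h

/-- The Kronecker term is the time-`0` contribution, where the walk sits at `0`; the series collects
the positive times. -/
theorem IsIIDSteps.toReal_greenFunction [IsProbabilityMeasure (P.map (X 0))]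
    (hX : IsIIDSteps P X) (h : IsTransientWalk P X) (y : ℤ) :
    (greenFunction P X y).toReal = (if y = 0 then 1 else 0)
      + ∑' m, (pathLaw (P.map (X 0))).real {x | pathSum x (m + 1) = y} := by
  have hfin : ∑' m, pathLaw (P.map (X 0)) {x | pathSum x (m + 1) = y} ≠ ∞ :=
    ne_top_of_le_ne_top (ENNReal.inv_ne_top.2 (tsub_pos_of_lt (hX.returnProb_lt_one h)).ne')
      (tsum_measure_pathSum_eq_le y)
  unfold greenFunction
  simp_rw [hX.measure_walk_eq]
  rw [tsum_eq_zero_add' ENNReal.summable, ENNReal.toReal_add (measure_ne_top _ _) hfin,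
    ENNReal.tsum_toReal_eq fun m => measure_ne_top _ _]
  congr 1
  by_cases hy : y = 0
  · simp [pathSum, hy]
  · simp [pathSum, hy, Ne.symm hy]

theorem tsum_measureReal_pathSum_eq_le {ν : Measure ℤ} [IsProbabilityMeasure ν] (y : ℤ)
    (hν : returnProb ν < 1) :
    ∑' m, (pathLaw ν).real {x | pathSum x (m + 1) = y} ≤ ((1 - returnProb ν)⁻¹).toReal := by
  have hfin : (1 - returnProb ν)⁻¹ ≠ ∞ := ENNReal.inv_ne_top.2 (tsub_pos_of_lt hν).ne'
  have h := ENNReal.toReal_mono hfin (tsum_measure_pathSum_eq_le (ν := ν) y)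
  rwa [ENNReal.tsum_toReal_eq fun m => measure_ne_top _ _] at h

end Steps

/-! ### Identification of the variance and conclusion. -/

/-- For an even summable sequence `c` and a bounded sequence `a`. -/
theorem tsum_mul_add_reflect {c a : ℤ → ℝ} (hc : Summable fun x => |c x|)
    (hneg : ∀ x, c (-x) = c x) {B : ℝ} (ha0 : ∀ x, 0 ≤ a x) (ha : ∀ x, a x ≤ B) :
    ∑' y, c y * (a y + a (-y) + if y = 0 then 1 else 0)
      = 2 * ∑' y, ((if y = 0 then 1 else 0) + a y) * c y - c 0 := by
  have h1 : Summable fun y => a y * c y := by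
    refine (hc.mul_left B).of_norm_bounded fun y => ?_
    rw [norm_mul, Real.norm_eq_abs, Real.norm_eq_abs, abs_of_nonneg (ha0 y)]
    exact mul_le_mul_of_nonneg_right (ha y) (abs_nonneg _)
  have h2 : Summable fun y => a (-y) * c y := by
    refine ((Equiv.neg ℤ).summable_iff.2 h1).congr fun y => ?_
    simp [hneg]
  -- By evenness of `c` the reflected series has the same sum, so both sides equal `2 ∑ a c + c 0`.
  have h2' : ∑' y, a (-y) * c y = ∑' y, a y * c y := by
    rw [← (Equiv.neg ℤ).tsum_eq fun y => a y * c y]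
    simp [hneg]
  have h3 : HasSum (fun y : ℤ => if y = 0 then c 0 else 0) (c 0) := hasSum_ite_eq 0 (c 0)
  have h4 : ∀ y, c y * (a y + a (-y) + if y = 0 then 1 else 0)
      = a y * c y + a (-y) * c y + if y = 0 then c 0 else 0 := fun y => by
    split_ifs with h
    · subst h; ring
    · ring
  have h5 : ∀ y, ((if y = 0 then 1 else 0) + a y) * c y
      = (if y = 0 then c 0 else 0) + a y * c y := fun y => by
    split_ifs with h
    · subst h; ring
    · ring
  simp_rw [h4, h5]
  rw [(h1.add h2).tsum_add h3.summable, h1.tsum_add h2, h3.summable.tsum_add h1, h2', h3.tsum_eq]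
  ring

/-- A characteristic-function criterion for convergence to a centred Gaussian law. -/
theorem tendstoInDistribution_gaussianReal_of_charFun {E : Type*} [MeasurableSpace E]
    {μ : Measure E} [IsProbabilityMeasure μ] {Y : ℕ → E → ℝ} (hY : ∀ n, Measurable (Y n)) {v : ℝ}
    (hv : 0 ≤ v)
    (h : ∀ t : ℝ, Tendsto (fun n : ℕ => ∫ e, Complex.exp (((t * Y n e : ℝ) : ℂ) * Complex.I) ∂μ)
      atTop (𝓝 (Complex.exp (((-(t ^ 2 * v) / 2 : ℝ) : ℂ))))) :
    TendstoInDistribution Y atTop (id : ℝ → ℝ) (fun _ => μ) (gaussianReal 0 v.toNNReal) where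
  forall_aemeasurable n := (hY n).aemeasurable
  aemeasurable_limit := aemeasurable_id
  tendsto := by
    refine ProbabilityMeasure.tendsto_iff_tendsto_charFun.2 fun t => ?_
    have h1 : ∀ n, charFun (μ.map (Y n)) t
        = ∫ e, Complex.exp (((t * Y n e : ℝ) : ℂ) * Complex.I) ∂μ := fun n => by
      rw [charFun_apply_real, integral_map (hY n).aemeasurable (by fun_prop)]
      simp
    have h2 : charFun ((gaussianReal 0 v.toNNReal).map id) t
        = Complex.exp (((-(t ^ 2 * v) / 2 : ℝ) : ℂ)) := by
      rw [Measure.map_id, charFun_gaussianReal]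
      congr 1
      have : ((v.toNNReal : ℝ) : ℂ) = (v : ℂ) := by rw [Real.coe_toNNReal v hv]
      rw [this]
      push_cast
      ring
    simp only [ProbabilityMeasure.coe_mk, h1, h2]
    exact h t

theorem theorem4p1 {E Ω : Type*} [MeasurableSpace E] [MeasurableSpace Ω]
    (μ : Measure E) [IsProbabilityMeasure μ] (P : Measure Ω) [IsProbabilityMeasure P]
    (T : E ≃ᵐ E) (hT : MeasurePreserving T μ μ)
    (X : ℕ → Ω → ℤ) (hX : IsIIDSteps P X) (htrans : IsTransientWalk P X)
    (f : E → ℝ) (hfm : Measurable f) (hf : MemLp f 2 μ) (hf0 : ∫ e, f e ∂μ = 0)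
    (hA3 : ConditionA3 μ (fun x e => f (iterZ T x e)))
    (hσ : 0 < sigmaSq P X μ T f) :
    ∀ᵐ ω ∂P, TendstoInDistribution
      (fun (n : ℕ) (e : E) =>
        (Real.sqrt n)⁻¹ * ∑ k ∈ Finset.range (n + 1), f (iterZ T (walk X k ω) e))
      atTop (id : ℝ → ℝ) (fun _ => μ) (gaussianReal 0 (sigmaSq P X μ T f).toNNReal) := by
  set ξ : ℤ → E → ℝ := fun x e => f (iterZ T x e) with hξ
  obtain ⟨C, hC, hw⟩ := hA3.exists_weaklyDependent
  have : IsProbabilityMeasure (P.map (X 0)) :=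
    Measure.isProbabilityMeasure_map (hX.measurable 0).aemeasurable
  set ν := P.map (X 0) with hν
  have hret : returnProb ν < 1 := hX.returnProb_lt_one htrans
  have hξm : ∀ i, Measurable (ξ i) := fun i => hfm.comp (measurePreserving_iterZ hT i).measurable
  have hξ0 : ξ 0 = f := funext fun e => congrArg f (iterZ_zero T e)
  have hid : ∀ i, IdentDistrib (ξ i) (ξ 0) μ μ := fun i => identDistrib_comp_iterZ hT hfm i 0
  set c : ℤ → ℝ := fun x => ∫ e, f e * f (iterZ T x e) ∂μ with hc
  have hcov : ∀ i k, ∫ e, ξ i e * ξ k e ∂μ = c (i - k) := integral_mul_comp_iterZ hT hfm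
  have hξL : MemLp (ξ 0) 2 μ := hξ0 ▸ hf
  have hξint : ∫ e, ξ 0 e ∂μ = 0 := hξ0 ▸ hf0
  have hcs : Summable fun x => |c x| :=
    hw.summable_abs_autocov hC hξm (fun i => (hid i).memLp_iff.2 hξL)
      (fun i => (hid i).integral_eq.trans hξint) (V := c 0)
      (fun i => by simp_rw [pow_two]; rw [hcov, sub_self]) hcov
  set a : ℤ → ℝ := fun y => ∑' m, (pathLaw ν).real {x | pathSum x (m + 1) = y} with ha
  have hsig : ∑' y, c y * (a y + a (-y) + if y = 0 then 1 else 0) = sigmaSq P X μ T f := by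
    rw [tsum_mul_add_reflect hcs (integral_mul_comp_iterZ_neg hT hfm)
      (fun y => tsum_nonneg fun _ => measureReal_nonneg)
      (fun y => tsum_measureReal_pathSum_eq_le y hret), sigmaSq]
    simp_rw [hX.toReal_greenFunction htrans]
    simp only [hc, iterZ_zero, pow_two, hν]
  have hmeas : AEMeasurable (fun ω i => X i ω) P :=
    (measurable_pi_lambda _ hX.measurable).aemeasurable
  -- Only countably many lags `y` occur, so one null set of paths serves all of them and the visit
  -- bound.
  have hpath : ∀ᵐ x ∂P.map (fun ω i => X i ω),
      (∀ y, Tendsto (fun n : ℕ => (pairCount (pathSum x) n y : ℝ) / n) atTop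
        (𝓝 (a y + a (-y) + if y = 0 then 1 else 0))) ∧
      ∃ D, 0 < D ∧ ∀ n : ℕ, 1 ≤ n → ∀ z,
        (visits (pathSum x) n z : ℝ) ≤ D * (n : ℝ) ^ (1 / 100 : ℝ) := by
    rw [hX.map_eq_pathLaw]
    exact (ae_all_iff.2 fun y => ae_tendsto_pairCount hret y).and (ae_exists_visits_le hret)
  filter_upwards [ae_of_ae_map hmeas hpath] with ω hω
  obtain ⟨hpair, D, hD, hvis⟩ := hω
  refine tendstoInDistribution_gaussianReal_of_charFun
    (fun n => (Finset.measurable_fun_sum _ fun k _ => hξm (walk X k ω)).const_mul _) hσ.le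
    fun t => ?_
  rw [← hsig]
  exact hw.tendsto_charFun_sampled hC hξm hξL hid hξint hcov hpair hD hvis t
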